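/- Let $G\subset\mathbb C$ be a simply connected domain with $0\in G$, and let $M:G\to\mathbb R$ be a continuous subharmonic function with Riesz measure (mass distribution) $\nu_M=\frac1{2\pi}\Delta M$. Let $\Lambda=\{\lambda_n\}$ be a finite or infinite sequence of points of $G$ (repetitions allowed) with $\lambda_n\to\partial G$, i.e. every compact subset of $G$ contains $\lambda_n$ for only finitely many $n$. A holomorphic function $f$ on $G$ has zero set $\Lambda$ if at each $\lambda\in G$ the multiplicity of the zero of $f$ equals the number of occurrences of $\lambda$ in $\Lambda$. Let $H(G;M)$ be the set of holomorphic functions $f$ on $G$ with $\log|f|\le M+\mathrm{const}$ on $G$. A *representing measure* on $G$ is a positive Radon measure $\mu$ with compact support in $G$ such that $h(0)=\int h\,d\mu$ for every harmonic $h:G\to\mathbb R$. A *representing function* on $G$ is a subharmonic function $V$ on $G\setminus\{0\}$ (with values in $[-\infty,\infty)$, $V\not\equiv-\infty$) that vanishes outside some compact subset of $G$ and satisfies $V(z)\le-\log|z|+O(1)$ as $z\to0$. Let $g_\Lambda$ be any holomorphic function on $G$ with zero set $\Lambda$. Consider the statements 1. there is an $f\in H(G;M)$ with zero set $\Lambda$;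 2. there is a constant $C\in\mathbb R$ such that $\sum_n V(\lambda_n)\le\int V\,d\nu_M+C$ for all representing functions $V$ on $G$; 3. there is a constant $C\in\mathbb R$ such that $\int\log|g_\Lambda|\,d\mu\le\int M\,d\mu+C$ for all representing measures $\mu$ on $G$. Then (1) and (3) are equivalent, and, if $0\notin\Lambda$ (so that the sum in (2) is defined), all three statements are equivalent. -/

import Mathlib

open Set Filter Topology MeasureTheory
open scoped ContDiff

/-- The integral `∫ f⁺ dμ - ∫ f⁻ dμ` of an extended-real-valued function. In all uses below the
first term is finite, so that the value is a real number or `-∞`. -/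
noncomputable def eintegral {α : Type*} [MeasurableSpace α] (μ : Measure α) (f : α → EReal) :
    EReal :=
  ((∫⁻ x, (f x).toENNReal ∂μ : ENNReal) : EReal) - ((∫⁻ x, (-f x).toENNReal ∂μ : ENNReal) : EReal)

/-- The mean value `(1 / 2π) ∫₀^{2π} u (c + r e^{iθ}) dθ`, possibly `-∞`. -/
noncomputable def circleMean (u : ℂ → EReal) (c : ℂ) (r : ℝ) : EReal :=
  eintegral ((ENNReal.ofReal (2 * Real.pi))⁻¹ • (volume : Measure ℝ).restrict (Ioc 0 (2 * Real.pi)))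
    (fun θ => u (circleMap c r θ))

/-- `u` is subharmonic on the open set `Ω`: upper semicontinuous with values in `[-∞, ∞)`, not
identically `-∞`, and below its mean over the boundary of every closed disc in `Ω`.
Values outside `Ω` are irrelevant. -/
structure SubharmonicOn (u : ℂ → EReal) (Ω : Set ℂ) : Prop where
  ne_top : ∀ z ∈ Ω, u z ≠ ⊤
  exists_ne_bot : ∃ z ∈ Ω, u z ≠ ⊥
  usc : UpperSemicontinuousOn u Ω
  le_circleMean : ∀ (c : ℂ) (r : ℝ), 0 < r → Metric.closedBall c r ⊆ Ω → u c ≤ circleMean u c r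

/-- `ν` is the mass distribution (Riesz measure) on the open set `G` of the locally integrable
function `u`: a Radon measure on `G` with `ν = (1 / 2π) Δu` in the sense of distributions.
Measures on `G` are measures on `ℂ` for which the complement of `G` is a null set. -/
structure IsRieszMeasure (G : Set ℂ) (u : ℂ → ℝ) (ν : Measure ℂ) : Prop where
  compl_eq_zero : ν Gᶜ = 0
  lt_top : ∀ K : Set ℂ, IsCompact K → K ⊆ G → ν K < ⊤
  integral_eq : ∀ φ : ℂ → ℝ, ContDiff ℝ ∞ φ → HasCompactSupport φ → tsupport φ ⊆ G →
    ∫ z, φ z ∂ν = (2 * Real.pi)⁻¹ * ∫ z, u z * Laplacian.laplacian φ z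

open Classical in
/-- The mass distribution `ν_u` of `u` on `G` (it exists and is unique when `u` is subharmonic). -/
noncomputable def rieszMeasure (G : Set ℂ) (u : ℂ → ℝ) : Measure ℂ :=
  if h : ∃ ν, IsRieszMeasure G u ν then h.choose else 0

/-- `μ` is a representing measure on `G`: a positive Radon measure with compact support in `G`
such that `h 0 = ∫ h dμ` for all `h` harmonic in `G`. -/
structure IsRepresentingMeasure (G : Set ℂ) (μ : Measure ℂ) : Prop where
  finite : IsFiniteMeasure μ
  compact_support : ∃ K : Set ℂ, IsCompact K ∧ K ⊆ G ∧ μ Kᶜ = 0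
  eq_integral : ∀ h : ℂ → ℝ, InnerProductSpace.HarmonicOnNhd h G → h 0 = ∫ z, h z ∂μ

/-- `V` is a representing function on `G`: subharmonic in `G \ {0}`, zero off a compact subset
of `G`, and `V z ≤ -log |z| + O(1)` as `z → 0`. The value at `0` is irrelevant. -/
structure IsRepresentingFunction (G : Set ℂ) (V : ℂ → EReal) : Prop where
  subharmonic : SubharmonicOn V (G \ {0})
  eq_zero : ∃ K : Set ℂ, IsCompact K ∧ K ⊆ G ∧ ∀ z ∈ (G \ {0}) \ K, V z = 0
  le_neg_log : ∃ C : ℝ, ∀ᶠ z in 𝓝[≠] (0 : ℂ), V z ≤ ((-Real.log ‖z‖ + C : ℝ) : EReal)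

/-- `log |w|`, with `log 0 = -∞`. -/
noncomputable def elogNorm (w : ℂ) : EReal := ENNReal.log ‖w‖ₑ

/-- `f ∈ H(G; M)`: `f` is holomorphic on `G` and `log |f| ≤ M + const` on `G`. -/
def MemHol (G : Set ℂ) (M : ℂ → ℝ) (f : ℂ → ℂ) : Prop :=
  DifferentiableOn ℂ f G ∧ ∃ C : ℝ, ∀ z ∈ G, elogNorm (f z) ≤ ((M z + C : ℝ) : EReal)

/-- `f` is holomorphic on `G` with zero set `Λ`: the multiplicity of the zero of `f` at each
point of `G` is the number of occurrences of this point in the family `Λ`. -/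
def HasZeroSet {ι : Type*} (G : Set ℂ) (Λ : ι → ℂ) (f : ℂ → ℂ) : Prop :=
  DifferentiableOn ℂ f G ∧ ∀ z ∈ G, analyticOrderAt f z = {n | Λ n = z}.encard

/-- `Λ` is a zero set for `H(G; M)`. -/
def IsZeroSetFor {ι : Type*} (G : Set ℂ) (M : ℂ → ℝ) (Λ : ι → ℂ) : Prop :=
  ∃ f : ℂ → ℂ, MemHol G M f ∧ HasZeroSet G Λ f

/-! (1) implies (3): if f has zero set Λ and log|f| ≤ M + C, then q = f/g is zero-free, where g is
the given function with zero set Λ. So log|q| is harmonic, and a representing measure μ integrates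
log|g| = log|f| - log|q| to at most ∫ M dμ + C - log|q(0)|.

(3) implies (1) by duality. Let K ⊆ G be compact and suppose that no harmonic h with h(0) = -C - 1
satisfies log|g| + h < M on K. Hahn-Banach separates the open convex set of continuous f with |g|
exp f < exp M from the restrictions of these h. The separating functional is positive and, once
normalized, evaluates harmonic functions at 0: it is a representing measure violating (3). This is
`exists_harmonicOnNhd_of_forall_eintegral_le`. Simple connectivity gives h = Re H
(`exists_differentiableOn_re_eq`), so |g exp H| ≤ exp M on K, with |exp H(0)| independent of K.
Along an exhaustion of G, Montel's and Hurwitz's theorems give a zero-free limit e of the functions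
exp H, and e g is the required function.

(1) implies (2): W = M + C - log|f| is nonnegative and has distributional Laplacian 2π(ν - Σ δ_λ). A
representing function V, truncated from below by -2 log|z| - A and mollified, becomes a test
function φ with Δφ + 4πρ_ε ≥ 0, where ρ_ε is a mollifier of mass one at the origin. Integrating W
against this sum gives Σ φ(λ) ≤ ∫ φ dν + 2 ∫ ρ_ε W (`HasZeroSet.sum_le_integral_add`). As the
truncation and the mollification are removed, the last term tends to the constant 2 W(0), which does
not depend on V.

(2) implies (1): the regularized logarithmic potential of a representing measure μ, minus log|z|, is
a representing function, and its ν-integral is at most ∫ M dμ - M(0) + 1 by Green's formula. So (2)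
yields the bound required by duality for the polynomial P with the zeros λ in K, with a constant
containing Σ log|λ| (`eintegral_prod_sub_le`). That sum cancels against log|P(0)|. The resulting
functions exp(H) P therefore have fixed modulus at 0, and their limit has zero set Λ by Hurwitz's
theorem.

Distributional Laplacians are handled throughout as limits of the quotients 4 r⁻² (A_r u - u), with
A_r the mean over circles of radius r. -/

/-! ### Extended-real integrals and a reverse Fatou lemma -/

section EIntegral

variable {α : Type*} [MeasurableSpace α] {μ : Measure α}

theorem eintegral_mono_ae {f g : α → EReal} (h : ∀ᵐ x ∂μ, f x ≤ g x) :
    eintegral μ f ≤ eintegral μ g := by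
  refine EReal.sub_le_sub ?_ ?_
  · exact EReal.coe_ennreal_le_coe_ennreal_iff.2
      (lintegral_mono_ae (h.mono fun x hx => EReal.toENNReal_le_toENNReal hx))
  · exact EReal.coe_ennreal_le_coe_ennreal_iff.2
      (lintegral_mono_ae (h.mono fun x hx => EReal.toENNReal_le_toENNReal (EReal.neg_le_neg_iff.2 hx)))

theorem EReal.toENNReal_sub_toENNReal_neg (x : EReal) :
    ((x.toENNReal : ENNReal) : EReal) - (((-x).toENNReal : ENNReal) : EReal) = x := by
  rcases le_total 0 x with h | h
  · rw [EReal.toENNReal_of_nonpos (x := -x) (by simpa using h), EReal.coe_toENNReal h]; simp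
  · rw [EReal.toENNReal_of_nonpos h, EReal.coe_toENNReal (by simpa using EReal.neg_le_neg_iff.2 h)]
    simp

/-- With x = a - b this is a + x⁻ = b + x⁺, the subtraction-free form that can be integrated over
`ENNReal`. -/
theorem ENNReal.add_toENNReal_neg_sub {a b : ENNReal} (ha : a ≠ ⊤) :
    a + (-((a : EReal) - (b : EReal))).toENNReal = b + ((a : EReal) - (b : EReal)).toENNReal := by
  lift a to NNReal using ha
  induction b with
  | top => simp
  | coe b =>
    have e : (((a : NNReal) : ENNReal) : EReal) - (((b : NNReal) : ENNReal) : EReal) =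
        (((a : ℝ) - (b : ℝ) : ℝ) : EReal) := by push_cast; rfl
    rw [e, ← EReal.coe_neg, EReal.toENNReal_of_ne_top (EReal.coe_ne_top _),
      EReal.toENNReal_of_ne_top (EReal.coe_ne_top _)]
    simp only [EReal.toReal_coe]
    have h1 : (a : ENNReal) = ENNReal.ofReal (a : ℝ) := by simp
    have h2 : (b : ENNReal) = ENNReal.ofReal (b : ℝ) := by simp
    rw [h1, h2]
    rcases le_total (a : ℝ) b with h | h
    · rw [ENNReal.ofReal_of_nonpos (p := (a : ℝ) - b) (by linarith), ← ENNReal.ofReal_add (by simp)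
        (by linarith)]
      simp
    · rw [ENNReal.ofReal_of_nonpos (p := -((a : ℝ) - b)) (by linarith), ← ENNReal.ofReal_add (by simp)
        (by linarith)]
      simp

theorem EReal.coe_ennreal_sub_eq_of_add_eq {a b c d : ENNReal} (ha : a ≠ ⊤) (hc : c ≠ ⊤)
    (h : a + d = b + c) : (c : EReal) - d = (a : EReal) - b := by
  lift a to NNReal using ha
  lift c to NNReal using hc
  induction b with
  | top =>
    have : d = ⊤ := by
      rw [top_add] at h
      exact (ENNReal.add_eq_top.1 h).resolve_left (by simp)
    subst this; simp
  | coe b =>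
    induction d with
    | top => simp [← ENNReal.coe_add] at h
    | coe d =>
      norm_cast at h
      have h' : (a : ℝ) + d = b + c := by exact_mod_cast h
      have e : ∀ x y : NNReal, (((x : NNReal) : ENNReal) : EReal) - (((y : NNReal) : ENNReal) : EReal)
        = (((x : ℝ) - (y : ℝ) : ℝ) : EReal) := by intro x y; push_cast; rfl
      rw [e, e]; congr 1; linarith

/-- An extended-real integral can be computed from any decomposition `f = a - b` in which `a` has
finite integral. -/
theorem eintegral_eq_sub {f : α → EReal} {a b : α → ENNReal} (ham : AEMeasurable a μ)
    (hbm : AEMeasurable b μ) (ha : ∫⁻ x, a x ∂μ ≠ ⊤)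
    (hf : ∀ᵐ x ∂μ, f x = (a x : EReal) - (b x : EReal)) :
    eintegral μ f = ((∫⁻ x, a x ∂μ : ENNReal) : EReal) - ((∫⁻ x, b x ∂μ : ENNReal) : EReal) := by
  have hat : ∀ᵐ x ∂μ, a x ≠ ⊤ := (ae_lt_top' ham ha).mono fun x hx => hx.ne
  have hfm : AEMeasurable f μ :=
    (ham.coe_ereal_ennreal.sub hbm.coe_ereal_ennreal).congr (hf.mono fun x hx => hx.symm)
  refine EReal.coe_ennreal_sub_eq_of_add_eq ha ?_ ?_
  · refine ne_top_of_le_ne_top ha (lintegral_mono_ae (hf.mono fun x hx => ?_))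
    rw [hx]
    calc _ ≤ ((a x : EReal)).toENNReal := EReal.toENNReal_le_toENNReal
            ((EReal.sub_le_sub le_rfl (EReal.coe_ennreal_nonneg _)).trans (by simp))
      _ = a x := EReal.toENNReal_coe
  · rw [← lintegral_add_left' ham, ← lintegral_add_left' hbm]
    refine lintegral_congr_ae ?_
    filter_upwards [hf, hat] with x hx hx'
    rw [hx]; exact ENNReal.add_toENNReal_neg_sub hx'

theorem eintegral_coe {f : α → ℝ} (hf : Integrable f μ) :
    eintegral μ (fun x => (f x : EReal)) = ((∫ x, f x ∂μ : ℝ) : EReal) := by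
  rw [integral_eq_lintegral_pos_part_sub_lintegral_neg_part hf]
  unfold eintegral
  have h1 : ∀ x, ((f x : ℝ) : EReal).toENNReal = ENNReal.ofReal (f x) := fun x => by
    rw [EReal.toENNReal_of_ne_top (by simp)]; simp
  have h2 : ∀ x, (-((f x : ℝ) : EReal)).toENNReal = ENNReal.ofReal (-f x) := fun x => by
    rw [← EReal.coe_neg, EReal.toENNReal_of_ne_top (by simp)]; simp
  simp only [h1, h2]
  have a1 : ∫⁻ x, ENNReal.ofReal (f x) ∂μ ≠ ⊤ := by
    refine ne_top_of_le_ne_top hf.2.ne (lintegral_mono fun x => ?_)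
    rw [← ofReal_norm]; exact ENNReal.ofReal_le_ofReal (le_abs_self _)
  have a2 : ∫⁻ x, ENNReal.ofReal (-f x) ∂μ ≠ ⊤ := by
    refine ne_top_of_le_ne_top hf.2.ne (lintegral_mono fun x => ?_)
    rw [← ofReal_norm]; exact ENNReal.ofReal_le_ofReal (neg_le_abs _)
  rw [EReal.coe_sub, EReal.coe_ennreal_toReal a1, EReal.coe_ennreal_toReal a2]

theorem lintegral_ofReal_ne_top {f : α → ℝ} (hf : Integrable f μ) :
    ∫⁻ x, ENNReal.ofReal (f x) ∂μ ≠ ⊤ := by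
  refine ne_top_of_le_ne_top hf.2.ne (lintegral_mono fun x => ?_)
  rw [← ofReal_norm]; exact ENNReal.ofReal_le_ofReal (le_abs_self _)

theorem EReal.coe_ofReal_sub (x : ℝ) :
    ((ENNReal.ofReal x : ENNReal) : EReal) - ((ENNReal.ofReal (-x) : ENNReal) : EReal) = x := by
  have := EReal.toENNReal_sub_toENNReal_neg (x : EReal)
  rwa [← EReal.coe_neg, EReal.toENNReal_of_ne_top (EReal.coe_ne_top _),
      EReal.toENNReal_of_ne_top (EReal.coe_ne_top _)] at this

theorem integral_eq_coe_sub {f : α → ℝ} (hf : Integrable f μ) :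
    ((∫ x, f x ∂μ : ℝ) : EReal) = ((∫⁻ x, ENNReal.ofReal (f x) ∂μ : ENNReal) : EReal) -
      ((∫⁻ x, ENNReal.ofReal (-f x) ∂μ : ENNReal) : EReal) := by
  rw [integral_eq_lintegral_pos_part_sub_lintegral_neg_part hf, EReal.coe_sub,
    EReal.coe_ennreal_toReal (lintegral_ofReal_ne_top hf),
    EReal.coe_ennreal_toReal (by exact lintegral_ofReal_ne_top hf.neg)]

/-- D - V is nonnegative almost everywhere, so all that may be infinite sits in one `lintegral`, to
which Fatou's lemma applies. -/
theorem eintegral_eq_integral_sub {V : α → EReal} {D : α → ℝ} (hD : Integrable D μ)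
    (hVm : AEMeasurable V μ) (hVD : ∀ᵐ x ∂μ, V x ≤ (D x : EReal)) :
    eintegral μ V = ((∫ x, D x ∂μ : ℝ) : EReal) -
      ((∫⁻ x, ((D x : EReal) - V x).toENNReal ∂μ : ENNReal) : EReal) := by
  have hDm := hD.1.aemeasurable
  have h1 : AEMeasurable (fun x => ENNReal.ofReal (-D x)) μ := hDm.neg.ennreal_ofReal
  have h2 : AEMeasurable (fun x => ((D x : EReal) - V x).toENNReal) μ :=
    (hDm.coe_real_ereal.sub hVm).ereal_toENNReal
  rw [eintegral_eq_sub (a := fun x => ENNReal.ofReal (D x))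
    (b := fun x => ENNReal.ofReal (-D x) + ((D x : EReal) - V x).toENNReal)
    hDm.ennreal_ofReal (h1.add h2) (lintegral_ofReal_ne_top hD), lintegral_add_left' h1,
    integral_eq_coe_sub hD]
  · have t1 := lintegral_ofReal_ne_top hD
    have t2 := lintegral_ofReal_ne_top hD.neg
    simp only [Pi.neg_apply] at t2
    lift ∫⁻ x, ENNReal.ofReal (D x) ∂μ to NNReal using t1 with p
    lift ∫⁻ x, ENNReal.ofReal (-D x) ∂μ to NNReal using t2 with q
    generalize ∫⁻ x, ((D x : EReal) - V x).toENNReal ∂μ = w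
    induction w with
    | top => simp
    | coe w => 
      simp only [EReal.coe_ennreal_add]
      have e : ∀ x : NNReal, ((x : ENNReal) : EReal) = ((x : ℝ) : EReal) := fun x => rfl
      rw [e, e, e]
      simp only [← EReal.coe_add, ← EReal.coe_sub]
      congr 1; ring
  · filter_upwards [hVD] with x hx
    rw [EReal.coe_ennreal_add, EReal.coe_toENNReal (by
      rw [EReal.sub_nonneg (by simp) (by simp)]; exact hx)]
    conv_lhs => rw [← EReal.toENNReal_sub_toENNReal_neg (V x)]
    have hd := EReal.coe_ofReal_sub (D x)
    generalize V x = v at *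
    induction v with
    | top => simp at hx
    | bot => simp
    | coe v =>
      rw [EReal.toENNReal_sub_toENNReal_neg]
      have e : ∀ x : ℝ, ((ENNReal.ofReal x : ENNReal) : EReal) = ((max x 0 : ℝ) : EReal) := by
        intro x; exact EReal.coe_ennreal_ofReal
      rw [e, e] at *
      norm_cast at *
      linarith

/-- The hypothesis expresses limsup u_k ≤ v through real upper bounds, which also covers v = -∞.
Pointwise input of the reverse Fatou lemma. -/
theorem ENNReal.toENNReal_sub_le_liminf {v : EReal} {d : ℝ} {u : ℕ → ℝ}
    (h : ∀ a : ℝ, v < a → ∀ᶠ k in atTop, u k < a) :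
    ((d : EReal) - v).toENNReal ≤ liminf (fun k => ENNReal.ofReal (d - u k)) atTop := by
  refine ENNReal.le_of_forall_nnreal_lt fun t ht => ?_
  have ht' : (t : ENNReal) < ((d : EReal) - v).toENNReal := ht
  have hv : v < ((d - t : ℝ) : EReal) := by
    induction v with
    | top => simp at ht'
    | bot => exact EReal.bot_lt_coe _
    | coe v =>
      rw [← EReal.coe_sub, EReal.toENNReal_of_ne_top (EReal.coe_ne_top _), EReal.toReal_coe] at ht'
      rw [EReal.coe_lt_coe_iff]
      rw [← ENNReal.ofReal_coe_nnreal] at ht'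
      have := ENNReal.ofReal_lt_ofReal_iff_of_nonneg t.2 |>.1 ht'
      linarith [show (t : ℝ) < d - v from this]
  refine le_liminf_of_le (by isBoundedDefault) ?_
  filter_upwards [h _ hv] with k hk
  rw [← ENNReal.ofReal_coe_nnreal]
  exact ENNReal.ofReal_le_ofReal (by linarith)

/-- A reverse Fatou lemma for extended-real integrals. -/
theorem le_eintegral_add_of_forall_eventually_lt {V : α → EReal} {D : α → ℝ} {u : ℕ → α → ℝ}
    {x : EReal} {c : ℕ → ℝ} {c₀ : ℝ} (hD : Integrable D μ) (hVm : AEMeasurable V μ)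
    (hVD : ∀ᵐ x ∂μ, V x ≤ (D x : EReal)) (hu : ∀ k, Integrable (u k) μ)
    (huD : ∀ k, ∀ᵐ x ∂μ, u k x ≤ D x)
    (hlim : ∀ᵐ x ∂μ, ∀ a : ℝ, V x < a → ∀ᶠ k in atTop, u k x < a)
    (hc : Tendsto c atTop (𝓝 c₀)) (hx : ∀ k, x ≤ ((∫ y, u k y ∂μ + c k : ℝ) : EReal)) :
    x ≤ eintegral μ V + c₀ := by
  rw [eintegral_eq_integral_sub hD hVm hVD]
  induction x with
  | bot => exact bot_le
  | top => exact absurd (top_le_iff.1 (hx 0)) (EReal.coe_ne_top _)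
  | coe x =>
    have key : ∫⁻ y, ((D y : EReal) - V y).toENNReal ∂μ ≤ ENNReal.ofReal (∫ y, D y ∂μ + c₀ - x) := by
      calc ∫⁻ y, ((D y : EReal) - V y).toENNReal ∂μ
          ≤ ∫⁻ y, liminf (fun k => ENNReal.ofReal (D y - u k y)) atTop ∂μ :=
            lintegral_mono_ae (hlim.mono fun y hy => ENNReal.toENNReal_sub_le_liminf hy)
        _ ≤ liminf (fun k => ∫⁻ y, ENNReal.ofReal (D y - u k y) ∂μ) atTop :=
            lintegral_liminf_le' fun k => (hD.1.aemeasurable.sub (hu k).1.aemeasurable).ennreal_ofReal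
        _ = liminf (fun k => ENNReal.ofReal (∫ y, D y ∂μ - ∫ y, u k y ∂μ)) atTop := by
            congr 1; ext k
            rw [← integral_sub hD (hu k)]
            refine (ofReal_integral_eq_lintegral_ofReal (hD.sub (hu k)) ?_).symm
            · filter_upwards [huD k] with y hy
              simpa using hy
        _ ≤ liminf (fun k => ENNReal.ofReal (∫ y, D y ∂μ + c k - x)) atTop := by
            refine liminf_le_liminf (Eventually.of_forall fun k => ?_) (by isBoundedDefault)
              (by isBoundedDefault)
            refine ENNReal.ofReal_le_ofReal ?_
            have := EReal.coe_le_coe_iff.1 (hx k)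
            linarith
        _ = ENNReal.ofReal (∫ y, D y ∂μ + c₀ - x) := by
            refine Tendsto.liminf_eq (ENNReal.tendsto_ofReal ?_)
            exact (tendsto_const_nhds.add hc).sub tendsto_const_nhds
    -- `ENNReal.ofReal` truncates at 0, so `key` can be read as a real inequality only once its
    -- right-hand argument is known to be nonnegative.
    have hnn : 0 ≤ ∫ y, D y ∂μ + c₀ - x := by
      refine ge_of_tendsto ((tendsto_const_nhds.add hc).sub tendsto_const_nhds :
        Tendsto (fun k => ∫ y, D y ∂μ + c k - x) atTop _) (Eventually.of_forall fun k => ?_)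
      have := EReal.coe_le_coe_iff.1 (hx k)
      have h2 := integral_mono_ae (hu k) hD (huD k)
      linarith
    have := EReal.coe_ennreal_le_coe_ennreal_iff.2 key
    rw [EReal.coe_ennreal_ofReal, max_eq_left hnn] at this
    calc (x : EReal) = ((∫ y, D y ∂μ : ℝ) : EReal) - ((∫ y, D y ∂μ + c₀ - x : ℝ) : EReal) + c₀ := by
          norm_cast; ring
      _ ≤ _ := add_le_add (EReal.sub_le_sub le_rfl this) le_rfl

end EIntegral

/-! ### The Laplacian as a limit of circle means -/

section CircleLaplacian

open Real Metric

/-- The difference quotient `4 r⁻² (A_r u - u)`, where `A_r u` is the mean of `u` over circles of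
radius `r`; it approximates the Laplacian of `u`. -/
noncomputable def circleLaplacian (u : ℂ → ℝ) (r : ℝ) (z : ℂ) : ℝ :=
  4 / r ^ 2 * (circleAverage u z r - u z)

/-- The linear terms and the mixed term sin · cos average to 0, while cos² and sin² average to 1/2;
only the trace of B survives. -/
theorem circleAverage_quadratic (L : ℂ →L[ℝ] ℝ) (B : ℂ →L[ℝ] ℂ →L[ℝ] ℝ) (z : ℂ) (r : ℝ) :
    circleAverage (fun w => L (w - z) + 2⁻¹ * B (w - z) (w - z)) z r =
      r ^ 2 / 4 * (B 1 1 + B Complex.I Complex.I) := by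
  have hexp : ∀ θ : ℝ, circleMap z r θ - z = (r * cos θ) • (1 : ℂ) + (r * sin θ) • Complex.I := by
    intro θ
    rw [circleMap, Complex.exp_mul_I]
    simp only [Complex.real_smul]
    push_cast
    ring
  have h_int : ∀ θ : ℝ, L (circleMap z r θ - z) +
      2⁻¹ * B (circleMap z r θ - z) (circleMap z r θ - z) =
      (r * L 1) * cos θ + (r * L Complex.I) * sin θ + (r ^ 2 / 2 * B 1 1) * cos θ ^ 2
       + (r ^ 2 / 2 * B Complex.I Complex.I) * sin θ ^ 2 +
       (r ^ 2 / 2 * (B 1 Complex.I + B Complex.I 1)) * (sin θ * cos θ) := by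
    intro θ
    rw [hexp]
    simp only [map_add, map_smul, add_apply, smul_apply,
      smul_eq_mul]
    ring
  rw [circleAverage_def]
  simp only [h_int]
  rw [intervalIntegral.integral_add, intervalIntegral.integral_add, intervalIntegral.integral_add,
    intervalIntegral.integral_add]
  · simp only [intervalIntegral.integral_const_mul, integral_cos, integral_sin, integral_cos_sq,
      integral_sin_sq, integral_sin_mul_cos₁]
    simp
    field_simp
    ring
  all_goals exact Continuous.intervalIntegrable (by fun_prop) _ _

theorem laplacian_eq_fderiv_fderiv (φ : ℂ → ℝ) (z : ℂ) :
    Laplacian.laplacian φ z = fderiv ℝ (fderiv ℝ φ) z 1 1 +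
      fderiv ℝ (fderiv ℝ φ) z Complex.I Complex.I := by
  rw [InnerProductSpace.laplacian_eq_iteratedFDeriv_complexPlane]
  simp [iteratedFDeriv_two_apply]

/-- Mean value inequality applied twice: the oscillation η of the second derivative bounds the error
of the linearized gradient by η r, and this bounds the remainder by η r². Symmetry of the second
derivative is used to differentiate the quadratic term. -/
theorem abs_sub_taylor_two_le {φ : ℂ → ℝ} (hφ : ContDiff ℝ 2 φ) {z : ℂ} {r η : ℝ}
    (hη : ∀ w ∈ closedBall z r, ‖fderiv ℝ (fderiv ℝ φ) w - fderiv ℝ (fderiv ℝ φ) z‖ ≤ η)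
    {w : ℂ} (hw : w ∈ closedBall z r) :
    |φ w - (φ z + (fderiv ℝ φ z (w - z) + 2⁻¹ * fderiv ℝ (fderiv ℝ φ) z (w - z) (w - z)))| ≤
      η * r ^ 2 := by
  set B := fderiv ℝ (fderiv ℝ φ) z with hB
  have hη0 : 0 ≤ η := le_trans (norm_nonneg (fderiv ℝ (fderiv ℝ φ) w - B)) (hη w hw)
  have hr : 0 ≤ r := dist_nonneg.trans (mem_closedBall.1 hw)
  have hsym : ∀ a b, B a b = B b a := by
    intro a b
    exact (hφ.contDiffAt.isSymmSndFDerivAt (by simp)).eq a b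
  have hd1 : ContDiff ℝ 1 (fderiv ℝ φ) := hφ.fderiv_right (by norm_num)
  have hz : z ∈ closedBall z r := mem_closedBall_self hr
  have first : ∀ w ∈ closedBall z r, ‖fderiv ℝ φ w - fderiv ℝ φ z - B (w - z)‖ ≤ η * r := by
    intro w hw
    have := (convex_closedBall z r).norm_image_sub_le_of_norm_hasFDerivWithin_le (C := η)
      (f := fun w => fderiv ℝ φ w - B (w - z)) (f' := fun w => fderiv ℝ (fderiv ℝ φ) w - B)
      (fun x _ => (((hd1.differentiable (by norm_num) x).hasFDerivAt).sub
        (B.hasFDerivAt.comp x ((hasFDerivAt_id x).sub_const z))).hasFDerivWithinAt)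
      hη hz hw
    simp only [sub_self, map_zero, sub_zero] at this
    calc _ = ‖fderiv ℝ φ w - B (w - z) - fderiv ℝ φ z‖ := by congr 1; abel
      _ ≤ η * ‖w - z‖ := this
      _ ≤ η * r := by gcongr; exact mem_closedBall_iff_norm.1 hw
  have hder : ∀ x, HasFDerivAt (fun w => φ w - (fderiv ℝ φ z (w - z) + 2⁻¹ * B (w - z) (w - z)))
      (fderiv ℝ φ x - fderiv ℝ φ z - B (x - z)) x := by
    intro x
    have h1 := (hφ.differentiable (by norm_num) x).hasFDerivAt
    have hs : HasFDerivAt (fun w : ℂ => w - z) (ContinuousLinearMap.id ℝ ℂ) x :=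
      (hasFDerivAt_id x).sub_const z
    have h2 : HasFDerivAt (fun w : ℂ => fderiv ℝ φ z (w - z)) (fderiv ℝ φ z) x :=
      (fderiv ℝ φ z).hasFDerivAt.comp x hs
    have h3 : HasFDerivAt (fun w : ℂ => B (w - z)) B x := B.hasFDerivAt.comp x hs
    have h4 := (h3.clm_apply hs).const_mul (2⁻¹ : ℝ)
    have := h1.sub (h2.add h4)
    convert! this using 1
    ext v
    have := hsym v (x - z)
    simp only [sub_apply, add_apply, smul_apply, ContinuousLinearMap.comp_apply,
      ContinuousLinearMap.id_apply, ContinuousLinearMap.flip_apply, smul_eq_mul, this]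
    ring
  have := (convex_closedBall z r).norm_image_sub_le_of_norm_hasFDerivWithin_le
    (fun x _ => (hder x).hasFDerivWithinAt) first hz hw
  simp only [sub_self, map_zero, mul_zero, add_zero, sub_zero] at this
  rw [Real.norm_eq_abs] at this
  calc _ = |φ w - (fderiv ℝ φ z (w - z) + 2⁻¹ * B (w - z) (w - z)) - φ z| := by congr 1; ring
    _ ≤ η * r * ‖w - z‖ := this
    _ ≤ η * r * r := by gcongr; exact mem_closedBall_iff_norm.1 hw
    _ = η * r ^ 2 := by ring

/-- The circle mean of the second Taylor polynomial reproduces the Laplacian exactly. Only the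
remainder η r² contributes, and it is multiplied by 4 / r². -/
theorem abs_circleLaplacian_sub_laplacian_le {φ : ℂ → ℝ} (hφ : ContDiff ℝ 2 φ) {z : ℂ} {r η : ℝ}
    (hr : 0 < r)
    (hη : ∀ w ∈ closedBall z r, ‖fderiv ℝ (fderiv ℝ φ) w - fderiv ℝ (fderiv ℝ φ) z‖ ≤ η) :
    |circleLaplacian φ r z - Laplacian.laplacian φ z| ≤ 4 * η := by
  set q : ℂ → ℝ := fun w => φ z + (fderiv ℝ φ z (w - z) +
    2⁻¹ * fderiv ℝ (fderiv ℝ φ) z (w - z) (w - z)) with hq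
  have hqc : Continuous q := by fun_prop
  have hav : circleAverage q z r = φ z + r ^ 2 / 4 * Laplacian.laplacian φ z := by
    rw [laplacian_eq_fderiv_fderiv, ← circleAverage_quadratic (fderiv ℝ φ z), hq,
      circleAverage_fun_add, circleAverage_const]
    · exact continuous_const.continuousOn.circleIntegrable hr.le
    · exact Continuous.continuousOn (by fun_prop) |>.circleIntegrable hr.le
  have e : circleLaplacian φ r z - Laplacian.laplacian φ z =
      4 / r ^ 2 * circleAverage (fun w => φ w - q w) z r := by
    rw [circleAverage_fun_sub (hφ.continuous.continuousOn.circleIntegrable hr.le)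
      (hqc.continuousOn.circleIntegrable hr.le), hav, circleLaplacian]
    field_simp
    ring
  have hb : |circleAverage (fun w => φ w - q w) z r| ≤ η * r ^ 2 := by
    refine abs_circleAverage_le_circleAverage_abs.trans ?_
    refine circleAverage_mono_on_of_le_circle ?_ fun w hw => ?_
    · exact Continuous.continuousOn ((hφ.continuous.sub hqc).abs) |>.circleIntegrable hr.le
    · rw [abs_of_pos hr] at hw
      exact abs_sub_taylor_two_le hφ hη (sphere_subset_closedBall hw)
  rw [e, abs_mul, abs_of_pos (by positivity : (0:ℝ) < 4 / r ^ 2)]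
  calc _ ≤ 4 / r ^ 2 * (η * r ^ 2) := by gcongr
    _ = 4 * η := by field_simp

theorem continuous_fderiv_fderiv {φ : ℂ → ℝ} (hφ : ContDiff ℝ 2 φ) :
    Continuous (fderiv ℝ (fderiv ℝ φ)) :=
  (hφ.fderiv_right (m := 1) (by norm_num)).continuous_fderiv (by norm_num)

theorem continuous_laplacian {φ : ℂ → ℝ} (hφ : ContDiff ℝ 2 φ) :
    Continuous (Laplacian.laplacian φ) := by
  have := continuous_fderiv_fderiv hφ
  simp only [funext (laplacian_eq_fderiv_fderiv φ)]
  fun_prop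

theorem tendsto_circleLaplacian {φ : ℂ → ℝ} (hφ : ContDiff ℝ 2 φ) (z : ℂ) :
    Tendsto (fun r => circleLaplacian φ r z) (𝓝[>] 0) (𝓝 (Laplacian.laplacian φ z)) := by
  rw [Metric.tendsto_nhds]
  intro ε hε
  have hcn : Continuous fun w => ‖fderiv ℝ (fderiv ℝ φ) w - fderiv ℝ (fderiv ℝ φ) z‖ :=
    (continuous_norm (E := ℂ →L[ℝ] ℂ →L[ℝ] ℝ)).comp
      ((continuous_fderiv_fderiv hφ).sub continuous_const)
  obtain ⟨δ, hδ, h⟩ := Metric.continuous_iff.1 hcn z (ε / 8) (by positivity)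
  filter_upwards [Ioo_mem_nhdsGT hδ] with r hr
  rw [Real.dist_eq]
  refine (abs_circleLaplacian_sub_laplacian_le hφ hr.1 (η := ε / 8) fun w hw => ?_).trans_lt
    (by linarith)
  have := h w ((mem_closedBall.1 hw).trans_lt hr.2)
  have h0 : ‖(0 : ℂ →L[ℝ] ℂ →L[ℝ] ℝ)‖ = 0 := norm_zero (E := ℂ →L[ℝ] ℂ →L[ℝ] ℝ)
  rw [Real.dist_eq, sub_self, h0, sub_zero] at this
  exact (le_abs_self _).trans this.le

/-- Uniformity in r and z supplies the dominating functions for the passages r → 0. -/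
theorem exists_abs_circleLaplacian_le {φ : ℂ → ℝ} (hφ : ContDiff ℝ 2 φ)
    (hc : HasCompactSupport φ) : ∃ C, ∀ r > 0, ∀ z, |circleLaplacian φ r z| ≤ C := by
  obtain ⟨C, hC⟩ : ∃ C, ∀ z, ‖fderiv ℝ (fderiv ℝ φ) z‖ ≤ C := by
    have hn : Continuous fun w => ‖fderiv ℝ (fderiv ℝ φ) w‖ :=
      (continuous_norm (E := ℂ →L[ℝ] ℂ →L[ℝ] ℝ)).comp (continuous_fderiv_fderiv hφ)
    obtain ⟨C, hC⟩ := hc.isCompact.exists_bound_of_continuousOn hn.continuousOn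
    refine ⟨max C 0, fun z => ?_⟩
    by_cases hz : z ∈ tsupport φ
    · exact ((le_abs_self _).trans (hC z hz)).trans (le_max_left _ _)
    · have h0 : fderiv ℝ (fderiv ℝ φ) z = 0 := image_eq_zero_of_notMem_tsupport fun h =>
        hz (tsupport_fderiv_subset ℝ (tsupport_fderiv_subset ℝ h))
      have hn0 : ‖(0 : ℂ →L[ℝ] ℂ →L[ℝ] ℝ)‖ = 0 := norm_zero (E := ℂ →L[ℝ] ℂ →L[ℝ] ℝ)
      rw [h0, hn0]
      exact le_max_right _ _
  refine ⟨4 * (C + C) + (C + C), fun r hr z => ?_⟩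
  have h1 := abs_circleLaplacian_sub_laplacian_le hφ hr (z := z) (η := C + C)
    fun w _ => le_trans (norm_sub_le (fderiv ℝ (fderiv ℝ φ) w) _) (add_le_add (hC w) (hC z))
  have h2 : |Laplacian.laplacian φ z| ≤ C + C := by
    rw [laplacian_eq_fderiv_fderiv]
    refine (abs_add_le _ _).trans (add_le_add ?_ ?_)
    · have := ((fderiv ℝ (fderiv ℝ φ) z).le_opNorm₂ 1 1).trans
        (by simpa using hC z : _ ≤ C)
      simpa using this
    · have := ((fderiv ℝ (fderiv ℝ φ) z).le_opNorm₂ Complex.I Complex.I).trans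
        (by simpa using hC z : _ ≤ C)
      simpa using this
  have := abs_sub_abs_le_abs_sub (circleLaplacian φ r z) (Laplacian.laplacian φ z)
  linarith

theorem circleLaplacian_eq_zero_of_notMem {φ : ℂ → ℝ} {r : ℝ} (hr : 0 ≤ r) {z : ℂ}
    (hz : z ∉ cthickening r (tsupport φ)) : circleLaplacian φ r z = 0 := by
  have key : ∀ w ∈ closedBall z r, φ w = 0 := by
    intro w hw
    by_contra h
    exact hz (mem_cthickening_of_dist_le z w r _ (subset_tsupport _ h)
      (by rw [dist_comm]; exact mem_closedBall.1 hw))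
  have : circleAverage φ z r = 0 := by
    rw [circleAverage_congr_sphere (f₂ := fun _ => 0), circleAverage_const]
    intro w hw
    rw [abs_of_nonneg hr] at hw
    exact key w (sphere_subset_closedBall hw)
  rw [circleLaplacian, this, key z (mem_closedBall_self hr)]; simp

end CircleLaplacian

/-! ### Circle means under the integral sign -/

section CircleFubini

open Real Metric

/-- For each fixed angle the map is a translation of the plane. The shear carries the integrability
of u(z) φ(z - re^{iθ}) over to u(z + re^{iθ}) φ(z). -/
theorem measurePreserving_circleMap_prod (r : ℝ) :
    MeasurePreserving (fun p : ℝ × ℂ => (p.1, circleMap p.2 r p.1))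
      ((volume.restrict (Ioc 0 (2 * π))).prod volume)
      ((volume.restrict (Ioc 0 (2 * π))).prod volume) := by
  refine (MeasurePreserving.id _).skew_product (g := fun θ z => circleMap z r θ) ?_ ?_
  · simp only [Function.uncurry_def, circleMap]
    fun_prop
  · refine Eventually.of_forall fun θ => ?_
    simp only [circleMap]
    exact (measurePreserving_add_right volume _).map_eq

theorem integrable_mul_comp_sub_circleMap {u φ : ℂ → ℝ} (hu : LocallyIntegrable u)
    (hφ : Continuous φ) (hc : HasCompactSupport φ) (r : ℝ) :
    Integrable (fun p : ℝ × ℂ => u p.2 * φ (p.2 - circleMap 0 r p.1))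
      ((volume.restrict (Ioc 0 (2 * π))).prod volume) := by
  obtain ⟨R, hR⟩ := hc.isCompact.isBounded.subset_closedBall 0
  -- φ(z - re^{iθ}) ≠ 0 forces |z| ≤ R + |r|, so u may be cut off to an integrable function.
  set u' := (closedBall (0 : ℂ) (R + |r|)).indicator u with hu'
  have hu'i : Integrable u' :=
    (hu.integrableOn_isCompact (isCompact_closedBall _ _)).integrable_indicator
      measurableSet_closedBall
  obtain ⟨C, hC⟩ := hc.exists_bound_of_continuous hφ
  have hm : Continuous fun p : ℝ × ℂ => φ (p.2 - circleMap 0 r p.1) := hφ.comp (by fun_prop)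
  refine ((hu'i.comp_snd _).mul_bdd hm.aestronglyMeasurable
    (Eventually.of_forall fun p => hC _)).congr (Eventually.of_forall fun p => ?_)
  simp only
  by_cases hp : φ (p.2 - circleMap 0 r p.1) = 0
  · simp [hp]
  · have : p.2 ∈ closedBall (0 : ℂ) (R + |r|) := by
      have h3 := hR (subset_tsupport _ hp)
      rw [mem_closedBall_zero_iff] at h3 ⊢
      calc _ = ‖p.2 - circleMap 0 r p.1 + circleMap 0 r p.1‖ := by simp
        _ ≤ ‖p.2 - circleMap 0 r p.1‖ + ‖circleMap 0 r p.1‖ := norm_add_le _ _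
        _ ≤ R + |r| := by gcongr; simp
    rw [hu', indicator_of_mem this]

theorem integrable_circleMap_mul {u φ : ℂ → ℝ} (hu : LocallyIntegrable u) (hφ : Continuous φ)
    (hc : HasCompactSupport φ) (r : ℝ) :
    Integrable (fun p : ℝ × ℂ => u (circleMap p.2 r p.1) * φ p.2)
      ((volume.restrict (Ioc 0 (2 * π))).prod volume) := by
  have h2 := (measurePreserving_circleMap_prod r).integrable_comp_of_integrable
    (integrable_mul_comp_sub_circleMap hu hφ hc r)
  refine h2.congr (Eventually.of_forall fun p => ?_)
  have e : circleMap p.2 r p.1 - circleMap 0 r p.1 = p.2 := by simp [circleMap]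
  simp only [Function.comp_apply, e]

theorem circleAverage_eq_setIntegral (u : ℂ → ℝ) (z : ℂ) (r : ℝ) :
    circleAverage u z r = (2 * π)⁻¹ * ∫ θ in Ioc 0 (2 * π), u (circleMap z r θ) := by
  rw [circleAverage_def, intervalIntegral.integral_of_le (by positivity), smul_eq_mul]

theorem integrable_circleAverage_mul {u φ : ℂ → ℝ} (hu : LocallyIntegrable u) (hφ : Continuous φ)
    (hc : HasCompactSupport φ) (r : ℝ) : Integrable fun z => circleAverage u z r * φ z := by
  have := ((integrable_circleMap_mul hu hφ hc r).integral_prod_right).const_mul (2 * π)⁻¹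
  refine this.congr (Eventually.of_forall fun z => ?_)
  simp only [integral_mul_const, circleAverage_eq_setIntegral, mul_assoc]

/-- Circle averaging is self-adjoint: Fubini, then a translation by re^{iθ} for each θ, and the
symmetry of a circle about its centre. -/
theorem integral_circleAverage_mul {u φ : ℂ → ℝ} (hu : LocallyIntegrable u) (hφ : Continuous φ)
    (hc : HasCompactSupport φ) (r : ℝ) :
    ∫ z, circleAverage u z r * φ z = ∫ z, u z * circleAverage φ z r := by
  have hneg : ∀ z, circleAverage φ z r = (2 * π)⁻¹ *
      ∫ θ in Ioc 0 (2 * π), φ (z - circleMap 0 r θ) := by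
    intro z
    rw [← circleAverage_neg_radius, circleAverage_eq_setIntegral]
    congr 2; ext θ; congr 1; simp [circleMap]; ring
  have h1 := integrable_circleMap_mul hu hφ hc r
  have hi := integrable_mul_comp_sub_circleMap hu hφ hc r
  calc ∫ z, circleAverage u z r * φ z
      = (2 * π)⁻¹ * ∫ z, ∫ θ in Ioc 0 (2 * π), u (circleMap z r θ) * φ z := by
        rw [← integral_const_mul]
        simp only [integral_mul_const, circleAverage_eq_setIntegral, mul_assoc]
    _ = (2 * π)⁻¹ * ∫ θ in Ioc 0 (2 * π), ∫ z, u (circleMap z r θ) * φ z := by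
        rw [integral_integral_swap (f := fun z θ => u (circleMap z r θ) * φ z)]
        exact h1.swap
    _ = (2 * π)⁻¹ * ∫ θ in Ioc 0 (2 * π), ∫ z, u z * φ (z - circleMap 0 r θ) := by
        congr 2; ext θ
        rw [← integral_add_right_eq_self (fun z => u z * φ (z - circleMap 0 r θ)) (circleMap 0 r θ)]
        congr 1; ext z
        simp [circleMap]
    _ = (2 * π)⁻¹ * ∫ z, ∫ θ in Ioc 0 (2 * π), u z * φ (z - circleMap 0 r θ) := by
        rw [integral_integral_swap (f := fun θ z => u z * φ (z - circleMap 0 r θ))]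
        exact hi
    _ = ∫ z, u z * circleAverage φ z r := by
        rw [← integral_const_mul]
        congr 1; ext z
        rw [hneg, integral_const_mul]; ring

theorem continuous_circleAverage_center {φ : ℂ → ℝ} (hφ : Continuous φ) (r : ℝ) :
    Continuous fun z => circleAverage φ z r := by
  simp only [circleAverage_def]
  refine Continuous.const_smul (M := ℝ) ?_ _
  refine intervalIntegral.continuous_parametric_intervalIntegral_of_continuous' ?_ _ _
  simp only [Function.uncurry_def, circleMap]
  fun_prop

/-- The distributional Laplacian of a locally integrable function is the limit of its
`circleLaplacian`s. -/
theorem tendsto_integral_circleLaplacian_mul {u φ : ℂ → ℝ} (hu : LocallyIntegrable u)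
    (hφ : ContDiff ℝ 2 φ) (hc : HasCompactSupport φ) :
    Tendsto (fun r => ∫ z, circleLaplacian u r z * φ z) (𝓝[>] 0)
      (𝓝 (∫ z, u z * Laplacian.laplacian φ z)) := by
  obtain ⟨C, hC⟩ := exists_abs_circleLaplacian_le hφ hc
  have hcomp : IsCompact (cthickening 1 (tsupport φ)) := hc.isCompact.cthickening
  have hswap : ∀ r > 0, ∫ z, circleLaplacian u r z * φ z = ∫ z, u z * circleLaplacian φ r z := by
    intro r hr
    have i1 : Integrable fun z => u z * φ z := by
      have := integrable_circleAverage_mul hu hφ.continuous hc 0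
      simpa using this
    have i2 : Integrable fun z => u z * circleAverage φ z r := by
      refine (hu.integrable_smul_right_of_hasCompactSupport
        (continuous_circleAverage_center hφ.continuous r) ?_).congr
        (Eventually.of_forall fun z => by simp)
      refine HasCompactSupport.intro (hc.isCompact.cthickening (r := r)) fun z hz => ?_
      have h0 := circleLaplacian_eq_zero_of_notMem hr.le hz
      have h1 : φ z = 0 := image_eq_zero_of_notMem_tsupport fun h =>
        hz (self_subset_cthickening _ h)
      rw [circleLaplacian, h1] at h0
      simpa [hr.ne'] using h0
    simp only [circleLaplacian]
    calc ∫ z, 4 / r ^ 2 * (circleAverage u z r - u z) * φ z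
        = 4 / r ^ 2 * ∫ z, (circleAverage u z r * φ z - u z * φ z) := by
          rw [← integral_const_mul]; congr 1; ext z; ring
      _ = 4 / r ^ 2 * ∫ z, (u z * circleAverage φ z r - u z * φ z) := by
          rw [integral_sub (integrable_circleAverage_mul hu hφ.continuous hc r) i1,
            integral_sub i2 i1, integral_circleAverage_mul hu hφ.continuous hc]
      _ = _ := by
          rw [← integral_const_mul]; congr 1; ext z; ring
  -- Radii below 1 keep everything inside the closed 1-neighbourhood of the support, a compact set
  -- on which C |u| dominates.
  have hlim : Tendsto (fun r => ∫ z, u z * circleLaplacian φ r z) (𝓝[>] 0)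
      (𝓝 (∫ z, u z * Laplacian.laplacian φ z)) := by
    refine tendsto_integral_filter_of_dominated_convergence
      (fun z => (cthickening 1 (tsupport φ)).indicator (fun z => C * |u z|) z) ?_ ?_ ?_ ?_
    · refine Eventually.of_forall fun r => hu.aestronglyMeasurable.mul ?_
      exact (((continuous_circleAverage_center hφ.continuous r).sub
        hφ.continuous).const_mul _).aestronglyMeasurable
    · filter_upwards [Ioo_mem_nhdsGT (zero_lt_one (α := ℝ))] with r hr
      refine Eventually.of_forall fun z => ?_
      by_cases hz : z ∈ cthickening 1 (tsupport φ)
      · rw [indicator_of_mem hz, norm_mul, Real.norm_eq_abs, Real.norm_eq_abs, mul_comm]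
        gcongr
        exact hC r hr.1 z
      · rw [indicator_of_notMem hz, circleLaplacian_eq_zero_of_notMem hr.1.le
          fun h => hz (cthickening_mono hr.2.le _ h)]
        simp
    · refine IntegrableOn.integrable_indicator ?_ hcomp.isClosed.measurableSet
      exact ((hu.integrableOn_isCompact hcomp).abs).const_mul C
    · refine Eventually.of_forall fun z => ?_
      exact (tendsto_circleLaplacian hφ z).const_mul _
  refine hlim.congr' ?_
  filter_upwards [self_mem_nhdsWithin] with r hr
  exact (hswap r hr).symm

end CircleFubini

/-! ### The logarithm as fundamental solution of the Laplacian -/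

section LogKernel

open Real Metric

/-- The function `log⁺ (r / ‖z‖)`, the difference of the mean of `log ‖·‖` over the circle of
centre `z` and radius `r` and of its value at `z`. -/
noncomputable def logKernel (r : ℝ) (z : ℂ) : ℝ := log⁺ (r * ‖z‖⁻¹)

theorem logKernel_nonneg (r : ℝ) (z : ℂ) : 0 ≤ logKernel r z := posLog_nonneg

theorem logKernel_eq_zero {r : ℝ} (hr : 0 < r) {z : ℂ} (hz : r ≤ ‖z‖) : logKernel r z = 0 := by
  have hz0 : 0 < ‖z‖ := hr.trans_le hz
  rw [logKernel, posLog_eq_zero_iff, abs_of_pos (by positivity), ← div_eq_mul_inv, div_le_one hz0]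
  exact hz

theorem logKernel_eq_log_sub {r : ℝ} (hr : 0 < r) {z : ℂ} (hz : z ≠ 0) (h : ‖z‖ ≤ r) :
    logKernel r z = log r - log ‖z‖ := by
  have hz0 : 0 < ‖z‖ := norm_pos_iff.2 hz
  rw [logKernel, posLog_eq_log, ← div_eq_mul_inv, log_div hr.ne' hz0.ne']
  rw [abs_of_pos (by positivity), ← div_eq_mul_inv, one_le_div hz0]
  exact h

/-- Jensen's formula for a single zero: the mean is log max(r, ‖z - a‖). The centre z = a is
excluded because there `log 0 = 0` replaces -∞. -/
theorem circleAverage_log_norm_sub {r : ℝ} (hr : 0 < r) {z a : ℂ} (hz : z ≠ a) :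
    circleAverage (fun w => log ‖w - a‖) z r = log ‖z - a‖ + logKernel r (z - a) := by
  have hz0 : 0 < ‖z - a‖ := norm_pos_iff.2 (sub_ne_zero.2 hz)
  rw [circleAverage_log_norm_sub_const_eq_log_radius_add_posLog hr.ne']
  rcases le_total r ‖z - a‖ with h | h
  · rw [logKernel_eq_zero hr h, posLog_eq_log, log_mul (by positivity) (by positivity), log_inv]
    · ring
    · rw [abs_of_pos (by positivity), inv_mul_eq_div, one_le_div hr]
      exact h
  · rw [logKernel_eq_log_sub hr (sub_ne_zero.2 hz) h, (posLog_eq_zero_iff _).2]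
    · ring
    · rw [abs_of_pos (by positivity), inv_mul_eq_div, div_le_one hr]
      exact h

theorem circleLaplacian_log_norm_sub {r : ℝ} (hr : 0 < r) {z a : ℂ} (hz : z ≠ a) :
    circleLaplacian (fun w => log ‖w - a‖) r z = 4 / r ^ 2 * logKernel r (z - a) := by
  rw [circleLaplacian, circleAverage_log_norm_sub hr hz]; ring

/-- In polar coordinates the integrand becomes y log y, which is continuous up to 0. -/
theorem integrableOn_log_norm_ball (R : ℝ) :
    IntegrableOn (fun z : ℂ => log ‖z‖) (ball 0 R) := by
  have h : Integrable (fun z : ℂ => (Iio R).indicator log ‖z‖) := by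
    rw [integrable_fun_norm_addHaar volume (f := (Iio R).indicator log)]
    have : IntegrableOn (fun y : ℝ => y * log y) (Ioo 0 R) :=
      (continuous_mul_log.integrableOn_Icc (a := 0) (b := R)).mono_set Ioo_subset_Icc_self
    have h2 : Integrable ((Ioo 0 R).indicator fun y : ℝ => y * log y) :=
      this.integrable_indicator measurableSet_Ioo
    refine h2.integrableOn.congr_fun (fun y hy => ?_) measurableSet_Ioi
    have hy : 0 < y := hy
    by_cases hyR : y < R <;> simp [hy, hyR]
  refine (integrableOn_congr_fun (fun z hz => ?_) measurableSet_ball).1 h.integrableOn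
  rw [mem_ball_zero_iff] at hz
  simp [hz]

theorem locallyIntegrable_log_norm : LocallyIntegrable fun z : ℂ => log ‖z‖ := by
  refine (locallyIntegrable_iff).2 fun K hK => ?_
  obtain ⟨R, hR⟩ := hK.isBounded.subset_ball 0
  exact (integrableOn_log_norm_ball R).mono_set hR

theorem LocallyIntegrable.comp_sub_const {u : ℂ → ℝ} (hu : LocallyIntegrable u) (a : ℂ) :
    LocallyIntegrable fun z => u (z - a) := by
  refine (locallyIntegrable_iff).2 fun K hK => ?_
  have h := (hu.integrableOn_isCompact (hK.image (continuous_sub_right a)))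
  have hmp : MeasurePreserving (fun z : ℂ => z - a) volume volume := by
    simpa using measurePreserving_sub_right volume a
  have h2 := (hmp.integrableOn_comp_preimage
    (MeasurableEquiv.subRight a).measurableEmbedding).2 h
  exact h2.mono_set fun z hz => mem_image_of_mem _ hz

theorem locallyIntegrable_log_norm_sub (a : ℂ) : LocallyIntegrable fun z : ℂ => log ‖z - a‖ :=
  LocallyIntegrable.comp_sub_const locallyIntegrable_log_norm a

theorem measurable_logKernel (r : ℝ) : Measurable (logKernel r) := by
  unfold logKernel posLog
  exact measurable_const.max (measurable_log.comp (measurable_const.mul measurable_norm.inv))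

theorem integral_id_mul_log_sub {r : ℝ} (hr : 0 < r) :
    ∫ y in (0 : ℝ)..r, y * (log r - log y) = r ^ 2 / 4 := by
  have hc : Continuous fun y : ℝ => y ^ 2 / 2 * log r - y * (y * log y) / 2 + y ^ 2 / 4 := by
    have := continuous_mul_log
    fun_prop
  rw [intervalIntegral.integral_eq_sub_of_hasDerivAt_of_le hr.le
    (f := fun y => y ^ 2 / 2 * log r - y * (y * log y) / 2 + y ^ 2 / 4) hc.continuousOn]
  · simp only [ne_eq, OfNat.ofNat_ne_zero, not_false_eq_true, zero_pow, zero_div, zero_mul]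
    ring
  · intro y hy
    have hy0 : y ≠ 0 := hy.1.ne'
    have h1 : HasDerivAt (fun y : ℝ => y ^ 2 / 2 * log r) (y * log r) y := by
      have := ((hasDerivAt_pow 2 y).div_const 2).mul_const (log r)
      convert! this using 1; simp
    have h2 : HasDerivAt (fun y : ℝ => y * (y * log y) / 2) (y * log y + y / 2) y := by
      have := (((hasDerivAt_id y).mul (hasDerivAt_mul_log hy0)).div_const 2)
      convert! this using 1; simp; ring
    have h3 : HasDerivAt (fun y : ℝ => y ^ 2 / 4) (y / 2) y := by
      have := (hasDerivAt_pow 2 y).div_const 4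
      convert! this using 1; simp; ring
    convert! (h1.sub h2).add h3 using 1
    ring
  · have : Continuous fun y : ℝ => y * (log r - log y) := by
      have := continuous_mul_log
      simp only [mul_sub]
      fun_prop
    exact this.intervalIntegrable _ _

theorem integrable_logKernel {r : ℝ} (hr : 0 < r) : Integrable (logKernel r) := by
  have h : Integrable ((ball (0 : ℂ) r).indicator fun z => log r - log ‖z‖) :=
    IntegrableOn.integrable_indicator (Integrable.sub
      (integrableOn_const (measure_ball_lt_top.ne)) (integrableOn_log_norm_ball r))
      measurableSet_ball
  refine h.congr ?_
  have h0 : ∀ᵐ z : ℂ, z ≠ 0 := by simp [ae_iff]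
  filter_upwards [h0] with z hz
  by_cases hzr : ‖z‖ < r
  · rw [indicator_of_mem (by simpa using hzr), logKernel_eq_log_sub hr hz hzr.le]
  · rw [indicator_of_notMem (by simpa using hzr), logKernel_eq_zero hr (not_lt.1 hzr)]

/-- Fixes the normalization: after multiplication by 4 / r² the mass is 2π, independently of r. -/
theorem integral_logKernel {r : ℝ} (hr : 0 < r) : ∫ z, logKernel r z = π * r ^ 2 / 2 := by
  have h1 : ∀ z, logKernel r z = (fun y : ℝ => log⁺ (r * y⁻¹)) ‖z‖ := fun z => rfl
  simp only [h1]
  rw [integral_fun_norm_addHaar volume (fun y : ℝ => log⁺ (r * y⁻¹))]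
  have h2 : ∫ y in Ioi (0 : ℝ), y ^ (Module.finrank ℝ ℂ - 1) • log⁺ (r * y⁻¹) = r ^ 2 / 4 := by
    rw [← integral_id_mul_log_sub hr, intervalIntegral.integral_of_le hr.le,
      ← integral_indicator measurableSet_Ioi, ← integral_indicator measurableSet_Ioc]
    congr 1; ext y
    by_cases hy : 0 < y
    · by_cases hyr : y ≤ r
      · have := logKernel_eq_log_sub hr (z := (y : ℂ)) (by simpa using hy.ne')
          (by simpa [abs_of_pos hy] using hyr)
        simp only [logKernel, Complex.norm_real, norm_eq_abs, abs_of_pos hy] at this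
        simp [hy, hyr, this]
      · have := logKernel_eq_zero hr (z := (y : ℂ)) (by simpa [abs_of_pos hy] using (not_le.1 hyr).le)
        simp only [logKernel, Complex.norm_real, norm_eq_abs, abs_of_pos hy] at this
        simp [hy, hyr, this]
    · simp [hy]
  rw [h2]
  simp [measureReal_def, Complex.volume_ball]
  ring

/-- A nonnegative kernel of total mass one supported in a disc almost reproduces functions which
are almost constant on the disc. -/
theorem abs_integral_mul_sub_le {k φ : ℂ → ℝ} {r η a : ℝ} (hk : Integrable k) (hk0 : ∀ z, 0 ≤ k z)
    (hk1 : ∫ z, k z = 1) (hkr : ∀ z, r ≤ ‖z‖ → k z = 0) (hkφ : Integrable fun z => k z * φ z)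
    (hφ : ∀ z, ‖z‖ < r → |φ z - a| ≤ η) : |(∫ z, k z * φ z) - a| ≤ η := by
  have e : (∫ z, k z * φ z) - a = ∫ z, (k z * φ z - k z * a) := by
    rw [integral_sub hkφ (hk.mul_const a), integral_mul_const, hk1, one_mul]
  rw [e]
  calc _ ≤ ∫ z, |k z * φ z - k z * a| := abs_integral_le_integral_abs
    _ ≤ ∫ z, k z * η := by
      refine integral_mono (hkφ.sub (hk.mul_const a)).abs (hk.mul_const η) fun z => ?_
      simp only
      rw [← mul_sub, abs_mul, abs_of_nonneg (hk0 z)]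
      by_cases hz : r ≤ ‖z‖
      · simp [hkr z hz]
      · exact mul_le_mul_of_nonneg_left (hφ z (not_le.1 hz)) (hk0 z)
    _ = η := by rw [integral_mul_const, hk1, one_mul]

/-- Divided by 2π, the kernels 4 r⁻² `logKernel r` form an approximate identity: nonnegative, of
mass one, supported in shrinking discs. -/
theorem tendsto_integral_logKernel_mul {φ : ℂ → ℝ} (hφ : Continuous φ) (a : ℂ) :
    Tendsto (fun r => ∫ z, 4 / r ^ 2 * logKernel r (z - a) * φ z) (𝓝[>] 0) (𝓝 (2 * π * φ a)) := by
  have key : Tendsto (fun r => ∫ z, (4 / r ^ 2 * (2 * π)⁻¹ * logKernel r z) * φ (z + a)) (𝓝[>] 0)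
      (𝓝 (φ a)) := by
    rw [Metric.tendsto_nhds]
    intro ε hε
    obtain ⟨δ, hδ, h⟩ := Metric.continuous_iff.1 hφ a (ε / 2) (by positivity)
    filter_upwards [Ioo_mem_nhdsGT hδ] with r hr
    rw [Real.dist_eq]
    refine (abs_integral_mul_sub_le (r := r) (η := ε / 2) ((integrable_logKernel hr.1).const_mul _)
      (fun z => ?_) ?_ (fun z hz => ?_) ?_ fun z hz => ?_).trans_lt (by linarith)
    · have := logKernel_nonneg r z
      positivity
    · rw [integral_const_mul, integral_logKernel hr.1]
      have := hr.1.ne'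
      field_simp
      norm_num
    · rw [logKernel_eq_zero hr.1 hz, mul_zero]
    · obtain ⟨C, hC⟩ := (isCompact_closedBall (0 : ℂ) r).exists_bound_of_continuousOn
        (f := fun z => φ (z + a)) (by fun_prop)
      refine Integrable.mono' (((integrable_logKernel hr.1).const_mul
        (4 / r ^ 2 * (2 * π)⁻¹)).mul_const C) ?_ (Eventually.of_forall fun z => ?_)
      · exact ((measurable_logKernel r).const_mul _).aestronglyMeasurable.mul
          (hφ.comp (by fun_prop : Continuous fun z => z + a)).aestronglyMeasurable
      · have := logKernel_nonneg r z
        rw [norm_mul, norm_of_nonneg (by positivity : 0 ≤ 4 / r ^ 2 * (2 * π)⁻¹ * logKernel r z)]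
        by_cases hz : ‖z‖ ≤ r
        · gcongr
          exact hC z (by simpa using hz)
        · simp [logKernel_eq_zero hr.1 (not_le.1 hz).le]
    · have := h (z + a) (by simpa [dist_eq_norm] using hz.trans hr.2)
      rw [Real.dist_eq] at this
      exact this.le
  refine (key.const_mul (2 * π)).congr fun r => ?_
  rw [← integral_const_mul, ← integral_sub_right_eq_self _ a]
  congr 1; ext z
  simp only [sub_add_cancel]
  field_simp

/-- `log ‖· - a‖` is a fundamental solution: its distributional Laplacian is `2π δ_a`. -/
theorem integral_log_norm_sub_mul_laplacian {φ : ℂ → ℝ} (hφ : ContDiff ℝ 2 φ)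
    (hc : HasCompactSupport φ) (a : ℂ) :
    ∫ z, log ‖z - a‖ * Laplacian.laplacian φ z = 2 * π * φ a := by
  refine tendsto_nhds_unique (tendsto_integral_circleLaplacian_mul
    (locallyIntegrable_log_norm_sub a) hφ hc) ?_
  refine (tendsto_integral_logKernel_mul hφ.continuous a).congr' ?_
  filter_upwards [self_mem_nhdsWithin] with r hr
  refine integral_congr_ae ?_
  have h0 : ∀ᵐ z : ℂ, z ≠ a := by simp [ae_iff]
  filter_upwards [h0] with z hz
  rw [circleLaplacian_log_norm_sub hr hz]

end LogKernel

/-! ### Radial mollification -/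

section Mollifier

open Real Metric

/-- An unnormalized radial smooth bump function supported in the disc of radius `ε`. -/
noncomputable def radialBump (ε : ℝ) (z : ℂ) : ℝ := smoothTransition (1 - ‖z‖ ^ 2 / ε ^ 2)

/-- A radial smooth kernel of total mass one supported in the disc of radius `ε`. -/
noncomputable def mollifier (ε : ℝ) (z : ℂ) : ℝ := (∫ w, radialBump ε w)⁻¹ * radialBump ε z

/-- The convolution of `u` with the radial kernel `mollifier ε`. -/
noncomputable def mollify (ε : ℝ) (u : ℂ → ℝ) (z : ℂ) : ℝ := ∫ t, mollifier ε t * u (z - t)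

theorem contDiff_radialBump (ε : ℝ) : ContDiff ℝ ∞ (radialBump ε) :=
  smoothTransition.contDiff.comp (contDiff_const.sub ((contDiff_norm_sq ℝ).div_const _))

theorem contDiff_mollifier (ε : ℝ) : ContDiff ℝ ∞ (mollifier ε) :=
  contDiff_const.mul (contDiff_radialBump ε)

theorem radialBump_eq_zero {ε : ℝ} (hε : 0 < ε) {z : ℂ} (hz : ε ≤ ‖z‖) : radialBump ε z = 0 := by
  refine smoothTransition.zero_of_nonpos ?_
  rw [sub_nonpos, one_le_div (by positivity)]
  gcongr

theorem mollifier_eq_zero {ε : ℝ} (hε : 0 < ε) {z : ℂ} (hz : ε ≤ ‖z‖) : mollifier ε z = 0 := by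
  rw [mollifier, radialBump_eq_zero hε hz, mul_zero]

theorem mollifier_nonneg (ε : ℝ) (z : ℂ) : 0 ≤ mollifier ε z :=
  mul_nonneg (inv_nonneg.2 (integral_nonneg fun _ => smoothTransition.nonneg _))
    (smoothTransition.nonneg _)

theorem mollifier_eq_of_norm_eq (ε : ℝ) {z w : ℂ} (h : ‖z‖ = ‖w‖) :
    mollifier ε z = mollifier ε w := by
  simp only [mollifier, radialBump, h]

theorem hasCompactSupport_of_eq_zero {φ : ℂ → ℝ} {ε : ℝ} (h : ∀ z, ε ≤ ‖z‖ → φ z = 0) :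
    HasCompactSupport φ :=
  HasCompactSupport.intro (isCompact_closedBall (0 : ℂ) ε) fun z hz =>
    h z (by simpa using hz : ε < ‖z‖).le

theorem hasCompactSupport_mollifier {ε : ℝ} (hε : 0 < ε) : HasCompactSupport (mollifier ε) :=
  hasCompactSupport_of_eq_zero fun _ => mollifier_eq_zero hε

theorem continuous_mollifier (ε : ℝ) : Continuous (mollifier ε) := (contDiff_mollifier ε).continuous

theorem integrable_mollifier {ε : ℝ} (hε : 0 < ε) : Integrable (mollifier ε) :=
  (continuous_mollifier ε).integrable_of_hasCompactSupport (hasCompactSupport_mollifier hε)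

theorem integral_mollifier {ε : ℝ} (hε : 0 < ε) : ∫ z, mollifier ε z = 1 := by
  have hpos : 0 < ∫ w, radialBump ε w := by
    have hc := (contDiff_radialBump ε).continuous
    refine hc.integral_pos_of_hasCompactSupport_nonneg_nonzero
      (hasCompactSupport_of_eq_zero fun _ => radialBump_eq_zero hε)
      (fun _ => smoothTransition.nonneg _) (x := 0) ?_
    simp [radialBump]
  simp only [mollifier]
  rw [integral_const_mul, inv_mul_cancel₀ hpos.ne']

theorem mollify_eq_convolution (ε : ℝ) (u : ℂ → ℝ) :
    mollify ε u = MeasureTheory.convolution (mollifier ε) u (ContinuousLinearMap.mul ℝ ℝ) volume := by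
  ext z; simp [mollify, convolution]

theorem contDiff_mollify {ε : ℝ} (hε : 0 < ε) {u : ℂ → ℝ} (hu : LocallyIntegrable u) :
    ContDiff ℝ ∞ (mollify ε u) := by
  rw [mollify_eq_convolution]
  exact (hasCompactSupport_mollifier hε).contDiff_convolution_left _ (contDiff_mollifier ε) hu

theorem LocallyIntegrable.comp_const_sub {u : ℂ → ℝ} (hu : LocallyIntegrable u) (z : ℂ) :
    LocallyIntegrable fun t => u (z - t) := by
  refine (locallyIntegrable_iff).2 fun K hK => ?_
  have h := (hu.integrableOn_isCompact (hK.image (by fun_prop : Continuous fun t : ℂ => z - t)))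
  have h2 := ((Measure.measurePreserving_sub_left volume z).integrableOn_comp_preimage
    (MeasurableEquiv.subLeft z).measurableEmbedding).2 h
  exact h2.mono_set fun z hz => mem_image_of_mem _ hz

theorem integrable_mollifier_mul {ε : ℝ} (hε : 0 < ε) {u : ℂ → ℝ} (hu : LocallyIntegrable u)
    (z : ℂ) : Integrable fun t => mollifier ε t * u (z - t) := by
  simpa [smul_eq_mul] using (LocallyIntegrable.comp_const_sub hu
    z).integrable_smul_left_of_hasCompactSupport (continuous_mollifier ε)
    (hasCompactSupport_mollifier hε)

theorem mollify_eq_integral_mul_sub (ε : ℝ) (u : ℂ → ℝ) (z : ℂ) :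
    mollify ε u z = ∫ w, u w * mollifier ε (z - w) := by
  rw [mollify, ← integral_sub_left_eq_self _ volume z]
  congr 1; ext w; simp [mul_comm]

theorem mollify_add {ε : ℝ} (hε : 0 < ε) {u v : ℂ → ℝ} (hu : LocallyIntegrable u)
    (hv : LocallyIntegrable v) (z : ℂ) :
    mollify ε (fun w => u w + v w) z = mollify ε u z + mollify ε v z := by
  simp only [mollify, mul_add]
  exact integral_add (integrable_mollifier_mul hε hu z) (integrable_mollifier_mul hε hv z)

theorem mollify_const {ε : ℝ} (hε : 0 < ε) (c : ℝ) (z : ℂ) : mollify ε (fun _ => c) z = c := by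
  rw [mollify, integral_mul_const, integral_mollifier hε, one_mul]

theorem mollify_const_mul (ε c : ℝ) (u : ℂ → ℝ) (z : ℂ) :
    mollify ε (fun w => c * u w) z = c * mollify ε u z := by
  rw [mollify, mollify, ← integral_const_mul]; congr 1; ext t; ring

theorem mollify_congr {ε : ℝ} (hε : 0 < ε) {u v : ℂ → ℝ} {z : ℂ}
    (h : ∀ w ∈ ball z ε, u w = v w) : mollify ε u z = mollify ε v z := by
  rw [mollify, mollify]
  congr 1; ext t
  by_cases ht : ε ≤ ‖t‖
  · simp [mollifier_eq_zero hε ht]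
  · rw [h (z - t) (by simpa [dist_eq_norm] using ht)]

theorem mollify_mono {ε : ℝ} (hε : 0 < ε) {u v : ℂ → ℝ} (hu : LocallyIntegrable u)
    (hv : LocallyIntegrable v) {z : ℂ} (h : ∀ w ∈ ball z ε, u w ≤ v w) :
    mollify ε u z ≤ mollify ε v z := by
  refine integral_mono (integrable_mollifier_mul hε hu z) (integrable_mollifier_mul hε hv z)
    fun t => ?_
  by_cases ht : ε ≤ ‖t‖
  · simp [mollifier_eq_zero hε ht]
  · exact mul_le_mul_of_nonneg_left (h (z - t) (by simpa [dist_eq_norm] using ht))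
      (mollifier_nonneg _ _)

theorem mollify_le_of_forall_le {ε : ℝ} (hε : 0 < ε) {u : ℂ → ℝ} (hu : LocallyIntegrable u) {z : ℂ}
    {C : ℝ} (h : ∀ w ∈ ball z ε, u w ≤ C) : mollify ε u z ≤ C :=
  (mollify_mono hε hu (locallyIntegrable_const C) h).trans (mollify_const hε C z).le

/-- The mollifier is radial, so averaging over rotations will replace u(z - t) by the mean of u over
the circle of radius ‖t‖ about z. -/
theorem measurePreserving_rotation_prod :
    MeasurePreserving (fun p : ℝ × ℂ => (p.1, Complex.exp (p.1 * Complex.I) * p.2))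
      ((volume.restrict (Ioc 0 (2 * π))).prod volume)
      ((volume.restrict (Ioc 0 (2 * π))).prod volume) := by
  refine (MeasurePreserving.id _).skew_product
    (g := fun (θ : ℝ) z => Complex.exp (θ * Complex.I) * z) ?_ ?_
  · simp only [Function.uncurry_def]
    fun_prop
  · refine Eventually.of_forall fun θ => ?_
    have := (rotation (Circle.exp θ)).measurePreserving
    have e : (fun z : ℂ => Complex.exp (θ * Complex.I) * z) = rotation (Circle.exp θ) := by
      ext z; simp [rotation_apply]
    rw [e]
    exact this.map_eq

theorem integrable_mollifier_mul_rotation {ε : ℝ} (hε : 0 < ε) {u : ℂ → ℝ}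
    (hu : LocallyIntegrable u) (z : ℂ) :
    Integrable (fun p : ℝ × ℂ => mollifier ε p.2 * u (z - Complex.exp (p.1 * Complex.I) * p.2))
      ((volume.restrict (Ioc 0 (2 * π))).prod volume) := by
  have h := ((integrable_mollifier_mul hε hu z).comp_snd (volume.restrict (Ioc 0 (2 * π))))
  refine (measurePreserving_rotation_prod.integrable_comp_of_integrable h).congr
    (Eventually.of_forall fun p => ?_)
  simp only [Function.comp_apply]
  rw [mollifier_eq_of_norm_eq ε (z := Complex.exp (p.1 * Complex.I) * p.2) (w := p.2)
    (by simp [Complex.norm_exp_ofReal_mul_I])]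

/-- The points z - e^{iθ} t run once through the circle of radius ‖t‖, starting at the angle
arg(-t), and a circle mean does not depend on the starting angle. -/
theorem integral_rotation_eq_circleAverage (u : ℂ → ℝ) (z t : ℂ) :
    ∫ θ in Ioc 0 (2 * π), u (z - Complex.exp (θ * Complex.I) * t) =
      2 * π * circleAverage u z ‖t‖ := by
  rw [circleAverage_eq_integral_add (Complex.arg (-t)), smul_eq_mul, ← mul_assoc,
    mul_inv_cancel₀ (by positivity), one_mul, intervalIntegral.integral_of_le (by positivity)]
  congr 1; ext θ
  congr 1
  have := Complex.norm_mul_exp_arg_mul_I (-t)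
  rw [norm_neg] at this
  rw [circleMap]
  push_cast
  rw [add_mul, Complex.exp_add]
  linear_combination (-Complex.exp (θ * Complex.I)) * this

theorem integrable_mollifier_mul_circleAverage {ε : ℝ} (hε : 0 < ε) {u : ℂ → ℝ}
    (hu : LocallyIntegrable u) (z : ℂ) :
    Integrable fun t => mollifier ε t * circleAverage u z ‖t‖ := by
  have := ((integrable_mollifier_mul_rotation hε hu z).integral_prod_right).const_mul (2 * π)⁻¹
  refine this.congr (Eventually.of_forall fun t => ?_)
  simp only [integral_const_mul, integral_rotation_eq_circleAverage]
  field_simp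

/-- Convolution with a radial kernel is an average of circle means. -/
theorem mollify_eq_integral_circleAverage {ε : ℝ} (hε : 0 < ε) {u : ℂ → ℝ}
    (hu : LocallyIntegrable u) (z : ℂ) :
    mollify ε u z = ∫ t, mollifier ε t * circleAverage u z ‖t‖ := by
  have h := integrable_mollifier_mul_rotation hε hu z
  have h1 : ∀ θ : ℝ, ∫ t, mollifier ε t * u (z - Complex.exp (θ * Complex.I) * t) =
      mollify ε u z := by
    intro θ
    have hmp := (rotation (Circle.exp θ)).measurePreserving
    rw [mollify, ← hmp.integral_comp (rotation (Circle.exp θ)).toHomeomorph.measurableEmbedding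
      (fun t => mollifier ε t * u (z - t))]
    congr 1; ext t
    simp only [rotation_apply, Circle.coe_exp]
    rw [mollifier_eq_of_norm_eq ε (z := Complex.exp (θ * Complex.I) * t) (w := t)
      (by simp [Complex.norm_exp_ofReal_mul_I])]
  have h2 := integral_integral_swap (f := fun (θ : ℝ) t =>
    mollifier ε t * u (z - Complex.exp (θ * Complex.I) * t)) h
  simp only [h1, integral_const_mul, integral_rotation_eq_circleAverage] at h2
  have h3 : ∫ _ in Ioc 0 (2 * π), mollify ε u z = 2 * π * mollify ε u z := by
    simp [measureReal_def, pi_pos.le]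
  rw [h3] at h2
  have h4 : ∫ t, mollifier ε t * (2 * π * circleAverage u z ‖t‖) =
      2 * π * ∫ t, mollifier ε t * circleAverage u z ‖t‖ := by
    rw [← integral_const_mul]; congr 1; ext t; ring
  rw [h4] at h2
  exact mul_left_cancel₀ (by positivity) h2

/-- Mollification averages circle means of radii below ε with total weight one. The radius 0 is not
covered by the hypothesis, but t = 0 is a null set. -/
theorem le_mollify_of_forall_le_circleAverage {ε : ℝ} (hε : 0 < ε) {u : ℂ → ℝ}
    (hu : LocallyIntegrable u) {z : ℂ} {a : ℝ}
    (h : ∀ r, 0 < r → r < ε → a ≤ circleAverage u z r) : a ≤ mollify ε u z := by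
  rw [mollify_eq_integral_circleAverage hε hu, ← one_mul a, ← integral_mollifier hε,
    ← integral_mul_const]
  refine integral_mono_ae ((integrable_mollifier hε).mul_const _)
    (integrable_mollifier_mul_circleAverage hε hu z) ?_
  have h0 : ∀ᵐ t : ℂ, t ≠ 0 := by simp [ae_iff]
  filter_upwards [h0] with t ht
  by_cases ht' : ε ≤ ‖t‖
  · simp [mollifier_eq_zero hε ht']
  · exact mul_le_mul_of_nonneg_left (h _ (norm_pos_iff.2 ht) (not_le.1 ht')) (mollifier_nonneg _ _)

theorem mollify_le_of_forall_circleAverage_le {ε : ℝ} (hε : 0 < ε) {u : ℂ → ℝ}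
    (hu : LocallyIntegrable u) {z : ℂ} {a : ℝ}
    (h : ∀ r, 0 < r → r < ε → circleAverage u z r ≤ a) : mollify ε u z ≤ a := by
  rw [mollify_eq_integral_circleAverage hε hu, ← one_mul a, ← integral_mollifier hε,
    ← integral_mul_const]
  refine integral_mono_ae (integrable_mollifier_mul_circleAverage hε hu z)
    ((integrable_mollifier hε).mul_const _) ?_
  have h0 : ∀ᵐ t : ℂ, t ≠ 0 := by simp [ae_iff]
  filter_upwards [h0] with t ht
  by_cases ht' : ε ≤ ‖t‖
  · simp [mollifier_eq_zero hε ht']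
  · exact mul_le_mul_of_nonneg_left (h _ (norm_pos_iff.2 ht) (not_le.1 ht')) (mollifier_nonneg _ _)

theorem integrable_mollifier_sub_mul_circleMap {ε : ℝ} (hε : 0 < ε) {u : ℂ → ℝ}
    (hu : LocallyIntegrable u) (z : ℂ) (r : ℝ) :
    Integrable (fun p : ℝ × ℂ => u (circleMap p.2 r p.1) * mollifier ε (z - p.2))
      ((volume.restrict (Ioc 0 (2 * π))).prod volume) := by
  refine integrable_circleMap_mul hu ((continuous_mollifier ε).comp (by fun_prop)) ?_ r
  refine HasCompactSupport.intro (isCompact_closedBall z ε) fun w hw => mollifier_eq_zero hε ?_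
  have := (not_le.1 (fun h => hw (mem_closedBall.2 h))).le
  rwa [dist_comm, dist_eq_norm] at this

/-- Both operations average translates of u, so they commute by Fubini. -/
theorem circleAverage_mollify {ε : ℝ} (hε : 0 < ε) {u : ℂ → ℝ} (hu : LocallyIntegrable u) (z : ℂ)
    (r : ℝ) :
    circleAverage (mollify ε u) z r = mollify ε (fun w => circleAverage u w r) z := by
  have h := integrable_mollifier_sub_mul_circleMap hε hu z r
  have h2 := integral_integral_swap (f := fun (θ : ℝ) w =>
    u (circleMap w r θ) * mollifier ε (z - w)) h
  have h1 : ∀ θ : ℝ, ∫ w, u (circleMap w r θ) * mollifier ε (z - w) =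
      mollify ε u (circleMap z r θ) := by
    intro θ
    rw [mollify_eq_integral_mul_sub, ← integral_add_right_eq_self
      (fun w => u w * mollifier ε (circleMap z r θ - w)) (circleMap 0 r θ)]
    congr 1; ext w
    congr 2
    · simp [circleMap]
    · simp [circleMap]
  simp only [h1, integral_mul_const] at h2
  rw [circleAverage_eq_setIntegral, h2, mollify_eq_integral_mul_sub, ← integral_const_mul]
  congr 1; ext w
  rw [circleAverage_eq_setIntegral, mul_assoc]

theorem integrable_mollifier_mul_circleAverage_sub {ε : ℝ} (hε : 0 < ε) {u : ℂ → ℝ}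
    (hu : LocallyIntegrable u) (z : ℂ) (r : ℝ) :
    Integrable fun t => mollifier ε t * circleAverage u (z - t) r := by
  have := ((integrable_mollifier_sub_mul_circleMap hε hu z r).integral_prod_right).const_mul
    (2 * π)⁻¹
  have h2 := (Measure.measurePreserving_sub_left volume z).integrable_comp_of_integrable this
  refine h2.congr (Eventually.of_forall fun t => ?_)
  simp only [Function.comp_apply, integral_mul_const, circleAverage_eq_setIntegral, sub_sub_cancel]
  ring

theorem circleLaplacian_mollify {ε : ℝ} (hε : 0 < ε) {u : ℂ → ℝ} (hu : LocallyIntegrable u) (z : ℂ)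
    (r : ℝ) :
    circleLaplacian (mollify ε u) r z = ∫ t, mollifier ε t * circleLaplacian u r (z - t) := by
  rw [circleLaplacian, circleAverage_mollify hε hu, mollify, mollify, ← integral_sub
    (integrable_mollifier_mul_circleAverage_sub hε hu z r) (integrable_mollifier_mul hε hu z),
    ← integral_const_mul]
  congr 1; ext t
  rw [circleLaplacian]; ring

theorem integrable_mollifier_mul_circleLaplacian {ε : ℝ} (hε : 0 < ε) {u : ℂ → ℝ}
    (hu : LocallyIntegrable u) (z : ℂ) (r : ℝ) :
    Integrable fun t => mollifier ε t * circleLaplacian u r (z - t) := by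
  refine (((integrable_mollifier_mul_circleAverage_sub hε hu z r).sub
    (integrable_mollifier_mul hε hu z)).const_mul (4 / r ^ 2)).congr
    (Eventually.of_forall fun t => ?_)
  simp only [Pi.sub_apply]
  rw [circleLaplacian]; ring

end Mollifier

theorem ContDiff.two_of_infty {φ : ℂ → ℝ} (h : ContDiff ℝ ∞ φ) : ContDiff ℝ 2 φ :=
  contDiff_infty.1 h 2

/-! ### The mollified logarithm -/

section SmoothLog

open Real Metric

/-- The convolution of `log ‖·‖` with a radial kernel. -/
noncomputable def smoothLog (ε : ℝ) : ℂ → ℝ := mollify ε fun z => log ‖z‖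

theorem contDiff_smoothLog {ε : ℝ} (hε : 0 < ε) : ContDiff ℝ ∞ (smoothLog ε) :=
  contDiff_mollify hε locallyIntegrable_log_norm

/-- Circle Laplacians commute with mollification, so the quotient at z is the integral of 4 r⁻²
`logKernel r` against w ↦ `mollifier ε (z - w)`, and these kernels tend to 2π δ₀. -/
theorem laplacian_smoothLog {ε : ℝ} (hε : 0 < ε) (z : ℂ) :
    Laplacian.laplacian (smoothLog ε) z = 2 * π * mollifier ε z := by
  refine tendsto_nhds_unique (tendsto_circleLaplacian
    (contDiff_smoothLog hε).two_of_infty z) ?_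
  have h := tendsto_integral_logKernel_mul (φ := fun w => mollifier ε (z - w))
    ((continuous_mollifier ε).comp (by fun_prop)) 0
  simp only [sub_zero] at h
  refine h.congr' ?_
  filter_upwards [self_mem_nhdsWithin] with r hr
  rw [smoothLog, circleLaplacian_mollify hε locallyIntegrable_log_norm,
    ← integral_sub_left_eq_self _ volume z]
  refine integral_congr_ae ?_
  have h0 : ∀ᵐ t : ℂ, t ≠ z := by simp [ae_iff]
  filter_upwards [h0] with t ht
  have h1 : z - t ≠ 0 := sub_ne_zero.2 ht.symm
  have := circleLaplacian_log_norm_sub hr h1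
  simp only [sub_zero] at this
  simp only [sub_sub_cancel, this]
  ring

/-- Circles of radius below ε about z do not enclose the origin, so log ‖·‖ has mean log ‖z‖ on
them. -/
theorem smoothLog_eq_log {ε : ℝ} (hε : 0 < ε) {z : ℂ} (hz : ε ≤ ‖z‖) :
    smoothLog ε z = log ‖z‖ := by
  have hz0 : z ≠ 0 := norm_pos_iff.1 (hε.trans_le hz)
  have key : ∀ r, 0 < r → r < ε → circleAverage (fun w => log ‖w‖) z r = log ‖z‖ := by
    intro r hr hrε
    have := circleAverage_log_norm_sub hr hz0
    simpa [logKernel_eq_zero hr (hrε.le.trans hz)] using this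
  exact le_antisymm
    (mollify_le_of_forall_circleAverage_le hε locallyIntegrable_log_norm
      fun r h1 h2 => (key r h1 h2).le)
    (le_mollify_of_forall_le_circleAverage hε locallyIntegrable_log_norm
      fun r h1 h2 => (key r h1 h2).ge)

theorem log_norm_le_smoothLog {ε : ℝ} (hε : 0 < ε) {z : ℂ} (hz : z ≠ 0) :
    log ‖z‖ ≤ smoothLog ε z := by
  refine le_mollify_of_forall_le_circleAverage hε locallyIntegrable_log_norm fun r hr _ => ?_
  have := circleAverage_log_norm_sub hr hz
  simp only [sub_zero] at this
  linarith [logKernel_nonneg r z]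

/-- The means of log ‖·‖ over circles of radius r about z are log max(r, ‖z‖), also at z = 0, and r
< ε. -/
theorem smoothLog_le_log {ε : ℝ} (hε : 0 < ε) {z : ℂ} (hz : ‖z‖ ≤ ε) : smoothLog ε z ≤ log ε := by
  refine mollify_le_of_forall_circleAverage_le hε locallyIntegrable_log_norm fun r hr hrε => ?_
  have h := circleAverage_log_norm_sub_const_eq_log_radius_add_posLog (a := 0) (c := z) hr.ne'
  simp only [sub_zero] at h
  rw [h, show log⁺ (r⁻¹ * ‖z‖) = max 0 (log (r⁻¹ * ‖z‖)) from rfl]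
  rcases le_total (log (r⁻¹ * ‖z‖)) 0 with h0 | h0
  · rw [max_eq_left h0, add_zero]
    exact log_le_log hr hrε.le
  · rw [max_eq_right h0]
    by_cases hz0 : ‖z‖ = 0
    · simp [hz0]; exact log_le_log hr hrε.le
    · rw [log_mul (by positivity) hz0, log_inv]
      have := log_le_log (by positivity) hz
      linarith

theorem smoothLog_le_circleAverage {ε : ℝ} (hε : 0 < ε) (z : ℂ) {r : ℝ} (hr : 0 < r) :
    smoothLog ε z ≤ circleAverage (smoothLog ε) z r := by
  rw [smoothLog, circleAverage_mollify hε locallyIntegrable_log_norm]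
  refine integral_mono_ae (integrable_mollifier_mul hε locallyIntegrable_log_norm z)
    (integrable_mollifier_mul_circleAverage_sub hε locallyIntegrable_log_norm z r) ?_
  have h0 : ∀ᵐ t : ℂ, t ≠ z := by simp [ae_iff]
  filter_upwards [h0] with t ht
  refine mul_le_mul_of_nonneg_left ?_ (mollifier_nonneg _ _)
  have := circleAverage_log_norm_sub hr (sub_ne_zero.2 ht.symm)
  simp only [sub_zero] at this
  linarith [logKernel_nonneg r (z - t)]

end SmoothLog

/-! ### Existence of the Riesz measure -/

section RieszMeasure

open Real Metric

theorem circleMean_coe {v : ℂ → ℝ} {c : ℂ} {r : ℝ} (hv : CircleIntegrable v c r) :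
    circleMean (fun z => (v z : EReal)) c r = ((circleAverage v c r : ℝ) : EReal) := by
  have h2π : ENNReal.ofReal (2 * π) ≠ 0 := by simp [pi_pos]
  rw [circleMean, eintegral_coe, circleAverage_eq_setIntegral, integral_smul_measure]
  · simp [pi_pos.le]
  · refine Integrable.smul_measure ?_ (by simp [pi_pos])
    exact (intervalIntegrable_iff_integrableOn_Ioc_of_le (by positivity)).1 hv

theorem le_circleAverage_of_subharmonicOn {G : Set ℂ} {M : ℂ → ℝ} (hMc : ContinuousOn M G)
    (hMs : SubharmonicOn (fun z => (M z : EReal)) G) {c : ℂ} {r : ℝ} (hr : 0 < r)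
    (hcr : closedBall c r ⊆ G) : M c ≤ circleAverage M c r := by
  have h := hMs.le_circleMean c r hr hcr
  rw [circleMean_coe ((hMc.mono (sphere_subset_closedBall.trans hcr)).circleIntegrable hr.le)] at h
  exact EReal.coe_le_coe_iff.1 h

theorem exists_cthickening_subset {G K : Set ℂ} (hG : IsOpen G) (hK : IsCompact K) (hKG : K ⊆ G) :
    ∃ r > 0, cthickening r K ⊆ G :=
  hK.exists_cthickening_subset_open hG hKG

theorem laplacian_eq_zero_of_notMem_tsupport {φ : ℂ → ℝ} {z : ℂ} (hz : z ∉ tsupport φ) :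
    Laplacian.laplacian φ z = 0 := by
  have h : φ =ᶠ[𝓝 z] fun _ => (0 : ℝ) := notMem_tsupport_iff_eventuallyEq.1 hz
  have := (InnerProductSpace.laplacian_congr_nhds h).self_of_nhds
  simpa using this

/-- The distributional Laplacian of a continuous subharmonic function is nonnegative. -/
theorem integral_mul_laplacian_nonneg {G : Set ℂ} (hG : IsOpen G) {M : ℂ → ℝ}
    (hMc : ContinuousOn M G) (hMs : SubharmonicOn (fun z => (M z : EReal)) G) {φ : ℂ → ℝ}
    (hφ : ContDiff ℝ ∞ φ) (hc : HasCompactSupport φ) (hφG : tsupport φ ⊆ G) (h0 : ∀ z, 0 ≤ φ z) :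
    0 ≤ ∫ z, M z * Laplacian.laplacian φ z := by
  obtain ⟨r₀, hr₀, hr₀G⟩ := exists_cthickening_subset hG hc.isCompact hφG
  have hcomp : IsCompact (cthickening r₀ (tsupport φ)) := hc.isCompact.cthickening
  -- The cutoff is integrable on the plane and has the same circle means as M at points of the
  -- support of φ, for radii below r₀.
  set u := (cthickening r₀ (tsupport φ)).indicator M with hu
  have hui : Integrable u :=
    ((hMc.mono hr₀G).integrableOn_compact hcomp).integrable_indicator hcomp.isClosed.measurableSet
  have e : ∫ z, M z * Laplacian.laplacian φ z = ∫ z, u z * Laplacian.laplacian φ z := by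
    congr 1; ext z
    by_cases hz : z ∈ tsupport φ
    · rw [hu, indicator_of_mem (self_subset_cthickening _ hz)]
    · simp [laplacian_eq_zero_of_notMem_tsupport hz]
  rw [e]
  refine ge_of_tendsto (tendsto_integral_circleLaplacian_mul hui.locallyIntegrable
    hφ.two_of_infty hc) ?_
  filter_upwards [Ioo_mem_nhdsGT hr₀] with r hr
  refine integral_nonneg fun z => ?_
  by_cases hz : z ∈ tsupport φ
  · refine mul_nonneg ?_ (h0 z)
    have hsub : closedBall z r ⊆ cthickening r₀ (tsupport φ) :=
      (closedBall_subset_closedBall hr.2.le).trans (closedBall_subset_cthickening hz r₀)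
    have h1 : circleAverage u z r = circleAverage M z r := by
      refine circleAverage_congr_sphere fun w hw => ?_
      rw [abs_of_pos hr.1] at hw
      rw [hu, indicator_of_mem (hsub (sphere_subset_closedBall hw))]
    rw [circleLaplacian, h1, hu, indicator_of_mem (self_subset_cthickening _ hz)]
    have := le_circleAverage_of_subharmonicOn hMc hMs hr.1 (hsub.trans hr₀G)
    have h4 := hr.1
    exact mul_nonneg (by positivity) (by linarith)
  · simp [image_eq_zero_of_notMem_tsupport hz]

/-- A smooth cutoff function. -/
theorem exists_contDiff_eq_one {G K : Set ℂ} (hG : IsOpen G) (hK : IsCompact K) (hKG : K ⊆ G) :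
    ∃ χ : ℂ → ℝ, ContDiff ℝ ∞ χ ∧ HasCompactSupport χ ∧ tsupport χ ⊆ G ∧ (∀ z, 0 ≤ χ z) ∧
      ∀ z ∈ K, χ z = 1 := by
  obtain ⟨r, hr, hrG⟩ := exists_cthickening_subset hG hK hKG
  -- Mollified at scale r/2, the indicator of the r/2-neighbourhood is still 1 on K and vanishes off
  -- the r-neighbourhood.
  set S := cthickening (r / 2) K
  have hS : IsCompact S := hK.cthickening
  have hloc : LocallyIntegrable (S.indicator fun _ => (1 : ℝ)) :=
    (IntegrableOn.integrable_indicator (integrableOn_const hS.measure_lt_top.ne)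
      hS.isClosed.measurableSet).locallyIntegrable
  have hzero : ∀ z ∉ cthickening r K, mollify (r / 2) (S.indicator fun _ => (1 : ℝ)) z = 0 := by
    intro z hz
    rw [mollify_congr (by positivity) (v := fun _ => 0) fun w hw => ?_, mollify_const (by positivity)]
    refine indicator_of_notMem (fun hwS => hz ?_) _
    have := cthickening_cthickening_subset (half_pos hr).le (half_pos hr).le K
    rw [add_halves] at this
    refine this (mem_cthickening_of_dist_le z w _ _ hwS ?_)
    rw [dist_comm]; exact (mem_ball.1 hw).le
  have hts : tsupport (mollify (r / 2) (S.indicator fun _ => (1 : ℝ))) ⊆ cthickening r K := by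
    refine closure_minimal (fun z hz => ?_) isClosed_cthickening
    by_contra h
    exact hz (hzero z h)
  refine ⟨mollify (r / 2) (S.indicator fun _ => 1), contDiff_mollify (by positivity) hloc,
    HasCompactSupport.intro hK.cthickening hzero, hts.trans hrG, fun z => ?_, fun z hz => ?_⟩
  · exact integral_nonneg fun t => mul_nonneg (mollifier_nonneg _ _)
      (indicator_nonneg (fun _ _ => zero_le_one) _)
  · rw [mollify_congr (by positivity) (v := fun _ => 1) fun w hw => ?_, mollify_const (by positivity)]
    refine indicator_of_mem ?_ _
    exact closedBall_subset_cthickening hz _ (ball_subset_closedBall hw)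

open CompactlySupported

/-- Extension by zero of a function on a subset of the plane. -/
noncomputable def extendZero {G : Set ℂ} (ψ : G → ℝ) : ℂ → ℝ :=
  Function.extend Subtype.val ψ 0

theorem extendZero_coe {G : Set ℂ} (ψ : G → ℝ) (x : G) : extendZero ψ x = ψ x :=
  Subtype.val_injective.extend_apply _ _ _

theorem extendZero_of_notMem {G : Set ℂ} (ψ : G → ℝ) {z : ℂ} (hz : z ∉ G) : extendZero ψ z = 0 :=
  Function.extend_apply' _ _ _ fun ⟨x, hx⟩ => hz (hx ▸ x.2)

theorem extendZero_add {G : Set ℂ} (ψ ψ' : G → ℝ) :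
    extendZero (ψ + ψ') = extendZero ψ + extendZero ψ' := by
  ext z
  by_cases hz : z ∈ G
  · lift z to G using hz
    simp [extendZero_coe]
  · simp [extendZero_of_notMem _ hz]

theorem extendZero_smul {G : Set ℂ} (c : ℝ) (ψ : G → ℝ) :
    extendZero (c • ψ) = c • extendZero ψ := by
  ext z
  by_cases hz : z ∈ G
  · lift z to G using hz
    simp [extendZero_coe]
  · simp [extendZero_of_notMem _ hz]

theorem tsupport_extendZero_subset {G : Set ℂ} (ψ : C_c(G, ℝ)) :
    tsupport (extendZero ψ) ⊆ Subtype.val '' tsupport ψ := by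
  refine closure_minimal (fun z hz => ?_)
    (ψ.hasCompactSupport.isCompact.image continuous_subtype_val).isClosed
  by_cases hzG : z ∈ G
  · lift z to G using hzG
    rw [Function.mem_support, extendZero_coe] at hz
    exact mem_image_of_mem _ (subset_tsupport _ hz)
  · exact absurd (extendZero_of_notMem _ hzG) hz

theorem hasCompactSupport_extendZero {G : Set ℂ} (ψ : C_c(G, ℝ)) :
    HasCompactSupport (extendZero ψ) :=
  (ψ.hasCompactSupport.isCompact.image continuous_subtype_val).of_isClosed_subset
    (isClosed_tsupport _) (tsupport_extendZero_subset ψ)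

theorem tsupport_extendZero_subset' {G : Set ℂ} (ψ : C_c(G, ℝ)) : tsupport (extendZero ψ) ⊆ G := by
  refine (tsupport_extendZero_subset ψ).trans ?_
  rintro _ ⟨x, -, rfl⟩
  exact x.2

theorem integrable_mul_laplacian {G : Set ℂ} {M : ℂ → ℝ} (hMc : ContinuousOn M G) {φ : ℂ → ℝ}
    (hφ : ContDiff ℝ 2 φ) (hc : HasCompactSupport φ) (hφG : tsupport φ ⊆ G) :
    Integrable fun z => M z * Laplacian.laplacian φ z := by
  have h : IntegrableOn (fun z => M z * Laplacian.laplacian φ z) (tsupport φ) :=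
    ((hMc.mono hφG).mul (continuous_laplacian hφ).continuousOn).integrableOn_compact hc.isCompact
  refine (integrableOn_iff_integrable_of_support_subset fun z hz => ?_).1 h
  by_contra hz'
  exact hz (by simp [laplacian_eq_zero_of_notMem_tsupport hz'])

/-- Restriction of a compactly supported function to an open set containing its support. -/
noncomputable def restrictCompactlySupported {G : Set ℂ} {φ : ℂ → ℝ} (hφ : Continuous φ)
    (hc : HasCompactSupport φ) (hφG : tsupport φ ⊆ G) : C_c(G, ℝ) where
  toFun x := φ x
  continuous_toFun := hφ.comp continuous_subtype_val
  hasCompactSupport' := by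
    have : IsCompact (Subtype.val ⁻¹' tsupport φ : Set G) := by
      rw [Subtype.isCompact_iff, Subtype.image_preimage_coe, inter_eq_right.2 hφG]
      exact hc
    refine HasCompactSupport.intro this fun x hx => ?_
    exact image_eq_zero_of_notMem_tsupport hx

theorem extendZero_restrict {G : Set ℂ} {φ : ℂ → ℝ} (hφ : Continuous φ)
    (hc : HasCompactSupport φ) (hφG : tsupport φ ⊆ G) :
    extendZero (restrictCompactlySupported hφ hc hφG) = φ := by
  ext z
  by_cases hz : z ∈ G
  · lift z to G using hz
    rw [extendZero_coe]; rfl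
  · rw [extendZero_of_notMem _ hz]
    exact (image_eq_zero_of_notMem_tsupport fun h => hz (hφG h)).symm

/-- The distributional Laplacian, divided by `2π`, as a partially defined functional on the space
of compactly supported continuous functions. -/
noncomputable def laplacianPMap {G : Set ℂ} {M : ℂ → ℝ} (hMc : ContinuousOn M G) :
    C_c(G, ℝ) →ₗ.[ℝ] ℝ where
  domain :=
    { carrier := {ψ | ContDiff ℝ ∞ (extendZero ψ)}
      add_mem' := fun {a b} ha hb => by
        change ContDiff ℝ ∞ (extendZero (a + b))
        rw [CompactlySupportedContinuousMap.coe_add, extendZero_add]; exact ContDiff.add ha hb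
      zero_mem' := by
        have : extendZero (0 : C_c(G, ℝ)) = fun _ => 0 := by
          ext z
          by_cases hz : z ∈ G
          · lift z to G using hz
            rw [extendZero_coe]; rfl
          · exact extendZero_of_notMem _ hz
        change ContDiff ℝ ∞ (extendZero (0 : C_c(G, ℝ)))
        rw [this]; exact contDiff_const
      smul_mem' := fun c a ha => by
        change ContDiff ℝ ∞ (extendZero (c • a))
        rw [CompactlySupportedContinuousMap.coe_smul, extendZero_smul]; exact ContDiff.const_smul c ha }
  toFun :=
    { toFun := fun ψ => (2 * π)⁻¹ * ∫ z, M z * Laplacian.laplacian (extendZero ψ.1) z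
      map_add' := fun a b => by
        have ha : ContDiff ℝ 2 (extendZero a.1) := ContDiff.two_of_infty a.2
        have hb : ContDiff ℝ 2 (extendZero b.1) := ContDiff.two_of_infty b.2
        rw [← mul_add, ← integral_add
          (integrable_mul_laplacian hMc ha (hasCompactSupport_extendZero _)
            (tsupport_extendZero_subset' _))
          (integrable_mul_laplacian hMc hb (hasCompactSupport_extendZero _)
            (tsupport_extendZero_subset' _))]
        congr 1
        refine integral_congr_ae (Eventually.of_forall fun z => ?_)
        change M z * Laplacian.laplacian (extendZero (a.1 + b.1 : C_c(G, ℝ))) z = _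
        rw [CompactlySupportedContinuousMap.coe_add, extendZero_add, ContDiffAt.laplacian_add ha.contDiffAt hb.contDiffAt]; ring
      map_smul' := fun c a => by
        have ha : ContDiff ℝ 2 (extendZero a.1) := ContDiff.two_of_infty a.2
        have h : ∀ z, M z * Laplacian.laplacian (extendZero (c • a.1 : C_c(G, ℝ))) z =
            c * (M z * Laplacian.laplacian (extendZero a.1) z) := fun z => by
          rw [CompactlySupportedContinuousMap.coe_smul, extendZero_smul,
            InnerProductSpace.laplacian_smul c ha.contDiffAt, smul_eq_mul]; ring
        change (2 * π)⁻¹ * ∫ z, M z * Laplacian.laplacian (extendZero (c • a.1 : C_c(G, ℝ))) z =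
          c * ((2 * π)⁻¹ * ∫ z, M z * Laplacian.laplacian (extendZero a.1) z)
        simp only [h, integral_const_mul]
        ring }

/-- The distributional Laplacian is positive, but only defined on smooth test functions. M. Riesz's
extension theorem produces a positive functional on C_c(G), and the Riesz-Markov-Kakutani theorem
represents it by a measure on the subtype, which is pushed forward to the plane. -/
theorem exists_isRieszMeasure {G : Set ℂ} (hG : IsOpen G) {M : ℂ → ℝ} (hMc : ContinuousOn M G)
    (hMs : SubharmonicOn (fun z => (M z : EReal)) G) : ∃ ν, IsRieszMeasure G M ν := by
  have : LocallyCompactSpace G := hG.locallyCompactSpace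
  let cone : PointedCone ℝ C_c(G, ℝ) :=
    { carrier := {x | 0 ≤ x}
      add_mem' := fun {a b} ha hb x => add_nonneg (ha x) (hb x)
      zero_mem' := le_refl (0 : C_c(G, ℝ))
      smul_mem' := fun c a ha x => mul_nonneg c.2 (ha x) }
  have hnonneg : ∀ ψ : (laplacianPMap hMc).domain, (ψ : C_c(G, ℝ)) ∈ cone →
      0 ≤ laplacianPMap hMc ψ := by
    intro ψ hψ
    have hψ' : ∀ z, 0 ≤ extendZero ψ.1 z := by
      intro z
      by_cases hz : z ∈ G
      · lift z to G using hz
        rw [extendZero_coe]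
        exact hψ z
      · rw [extendZero_of_notMem _ hz]
    exact mul_nonneg (by positivity) (integral_mul_laplacian_nonneg hG hMc hMs ψ.2
      (hasCompactSupport_extendZero _) (tsupport_extendZero_subset' _) hψ')
  -- Cofinality needed for the extension: a multiple of a smooth cutoff equal to 1 on the support of
  -- y dominates -y.
  have hdense : ∀ y : C_c(G, ℝ), ∃ x : (laplacianPMap hMc).domain, (x : C_c(G, ℝ)) + y ∈ cone := by
    intro y
    obtain ⟨χ, hχ, hχc, hχG, hχ0, hχ1⟩ := exists_contDiff_eq_one hG
      (hasCompactSupport_extendZero y).isCompact (tsupport_extendZero_subset' y)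
    obtain ⟨C, hC⟩ := y.hasCompactSupport.exists_bound_of_continuous (map_continuous y)
    set ψ := restrictCompactlySupported hχ.continuous hχc hχG with hψ
    refine ⟨⟨C • ψ, ?_⟩, ?_⟩
    · change ContDiff ℝ ∞ (extendZero (C • ψ : C_c(G, ℝ)))
      rw [CompactlySupportedContinuousMap.coe_smul, extendZero_smul, hψ, extendZero_restrict]
      exact contDiff_const.smul hχ
    · change ∀ x : G, 0 ≤ C * χ x + y x
      intro x
      by_cases hx : y x = 0
      · rw [hx, add_zero]
        exact mul_nonneg ((norm_nonneg _).trans (hC x)) (hχ0 x)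
      · rw [hχ1 x (subset_tsupport _ (by rw [Function.mem_support, extendZero_coe]; exact hx))]
        have := (neg_le_abs (y x)).trans (hC x)
        linarith
  obtain ⟨L, hL, hL0⟩ := riesz_extension cone (laplacianPMap hMc) hnonneg hdense
  set Λ : C_c(G, ℝ) →ₚ[ℝ] ℝ := PositiveLinearMap.mk₀ L fun x hx => hL0 x hx
  refine ⟨(RealRMK.rieszMeasure Λ).map Subtype.val, ?_, fun K hK hKG => ?_,
    fun φ hφ hc hφG => ?_⟩
  · rw [Measure.map_apply measurable_subtype_coe hG.measurableSet.compl]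
    have : (Subtype.val ⁻¹' Gᶜ : Set G) = ∅ := by ext x; simp
    rw [this, measure_empty]
  · rw [Measure.map_apply measurable_subtype_coe hK.measurableSet]
    have : IsCompact (Subtype.val ⁻¹' K : Set G) := by
      rw [Subtype.isCompact_iff, Subtype.image_preimage_coe, inter_eq_right.2 hKG]
      exact hK
    exact this.measure_lt_top
  · rw [integral_map measurable_subtype_coe.aemeasurable
      hφ.continuous.aestronglyMeasurable]
    have h1 := RealRMK.integral_rieszMeasure Λ (restrictCompactlySupported hφ.continuous hc hφG)
    have h2 := hL ⟨restrictCompactlySupported hφ.continuous hc hφG, by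
      change ContDiff ℝ ∞ (extendZero _)
      rw [extendZero_restrict]; exact hφ⟩
    calc _ = ∫ x, restrictCompactlySupported hφ.continuous hc hφG x ∂(RealRMK.rieszMeasure Λ) :=
          rfl
      _ = L (restrictCompactlySupported hφ.continuous hc hφG) := h1
      _ = _ := by
        rw [h2]
        change (2 * π)⁻¹ * ∫ z, M z * Laplacian.laplacian (extendZero _) z = _
        rw [extendZero_restrict]

theorem isRieszMeasure_rieszMeasure {G : Set ℂ} (hG : IsOpen G) {M : ℂ → ℝ}
    (hMc : ContinuousOn M G) (hMs : SubharmonicOn (fun z => (M z : EReal)) G) :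
    IsRieszMeasure G M (rieszMeasure G M) := by
  have h := exists_isRieszMeasure hG hMc hMs
  rw [rieszMeasure, dif_pos h]
  exact h.choose_spec

end RieszMeasure

/-! ### Harmonic conjugates on simply connected domains -/

section HarmonicConjugate

open Metric InnerProductSpace

/-- The real numbers with the discrete topology. -/
structure DiscreteReal where
  /-- The underlying real number. -/
  val : ℝ

instance : TopologicalSpace DiscreteReal := ⊥

instance : DiscreteTopology DiscreteReal := ⟨rfl⟩

/-- The covering space of an open set associated with holomorphic functions `H i` on discs whose
imaginary parts differ by constants on the intersections of the discs. -/
def coveringCore {G : Set ℂ} (r : G → ℝ) (hr : ∀ i, 0 < r i) (H : G → ℂ → ℂ)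
    (hH : ∀ i j : G, ∃ c, ∀ x ∈ ball (i : ℂ) (r i) ∩ ball (j : ℂ) (r j), H i x - H j x = c) :
    FiberBundleCore G G DiscreteReal where
  baseSet i := Subtype.val ⁻¹' ball (i : ℂ) (r i)
  isOpen_baseSet i := isOpen_ball.preimage continuous_subtype_val
  indexAt x := x
  mem_baseSet_at x := mem_ball_self (hr x)
  -- The coordinate v is the constant to be added to Im H i; the change of chart keeps Im H i x + v
  -- fixed. Local constancy of these changes makes them continuous for the discrete fibre.
  coordChange i j x v := ⟨v.val + (H i x - H j x).im⟩
  coordChange_self i x _ v := by simp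
  continuousOn_coordChange i j := by
    obtain ⟨c, hc⟩ := hH i j
    have hcont : Continuous fun p : G × DiscreteReal => (⟨p.2.val + c.im⟩ : DiscreteReal) :=
      (continuous_of_discreteTopology (f := fun v : DiscreteReal =>
        (⟨v.val + c.im⟩ : DiscreteReal))).comp continuous_snd
    refine hcont.continuousOn.congr fun p hp => ?_
    simp only [hc p.1 hp.1]
  coordChange_comp i j k x _ v := by
    simp only [Complex.sub_im, DiscreteReal.mk.injEq]
    ring

/-- A harmonic function on a simply connected domain is the real part of a holomorphic function. -/
theorem exists_differentiableOn_re_eq {G : Set ℂ} (hGo : IsOpen G) (hGs : IsSimplyConnected G)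
    {h : ℂ → ℝ} (hh : HarmonicOnNhd h G) :
    ∃ H : ℂ → ℂ, DifferentiableOn ℂ H G ∧ ∀ z ∈ G, (H z).re = h z := by
  classical
  have := hGs.simplyConnectedSpace
  have := hGo.locallyPathConnectedSpace
  have hball : ∀ i : G, ∃ r : ℝ, 0 < r ∧ ball (i : ℂ) r ⊆ G := fun i =>
    Metric.isOpen_iff.1 hGo i i.2
  choose r hr hrG using hball
  have hloc : ∀ i : G, ∃ F : ℂ → ℂ, AnalyticOnNhd ℂ F (ball (i : ℂ) (r i)) ∧
      EqOn (fun z => (F z).re) h (ball (i : ℂ) (r i)) := fun i =>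
    HarmonicOnNhd.exists_analyticOnNhd_ball_re_eq fun x hx => hh x (hrG i hx)
  choose H hHa hHre using hloc
  have hre : ∀ i j : G, ∀ x ∈ ball (i : ℂ) (r i) ∩ ball (j : ℂ) (r j), (H i x - H j x).re = 0 := by
    intro i j x hx
    have h1 : (H i x).re = h x := hHre i hx.1
    have h2 : (H j x).re = h x := hHre j hx.2
    rw [Complex.sub_re, h1, h2, sub_self]
  -- The difference is holomorphic with vanishing real part on an intersection of discs, which is
  -- convex and hence connected.
  have hH : ∀ i j : G, ∃ c, ∀ x ∈ ball (i : ℂ) (r i) ∩ ball (j : ℂ) (r j), H i x - H j x = c := by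
    intro i j
    rcases (ball (i : ℂ) (r i) ∩ ball (j : ℂ) (r j)).eq_empty_or_nonempty with he | hne
    · exact ⟨0, fun x hx => by simp [he] at hx⟩
    · exact AnalyticOnNhd.eq_const_of_re_eq_const (f := fun x => H i x - H j x) (c₀ := 0)
        (fun x hx => (hHa i x hx.1).sub (hHa j x hx.2)) (hre i j)
        (isOpen_ball.inter isOpen_ball)
        ⟨hne, ((convex_ball _ _).inter (convex_ball _ _)).isPreconnected⟩
  obtain ⟨x₀⟩ := hGs.nonempty.to_subtype
  let Z := coveringCore r hr H hH
  have hcov : IsCoveringMap (Bundle.TotalSpace.proj : Bundle.TotalSpace DiscreteReal Z.Fiber → G) :=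
    FiberBundle.isCoveringMap
  -- Simple connectivity enters here: the identity of G lifts to a global section of the covering,
  -- which is a coherent choice of additive constants.
  obtain ⟨S, ⟨-, hS⟩, -⟩ := hcov.existsUnique_continuousMap_lifts (ContinuousMap.id G) x₀
    (⟨x₀, (⟨0⟩ : DiscreteReal)⟩ : Bundle.TotalSpace DiscreteReal Z.Fiber) rfl
  have hS' : ∀ x, (S x).1 = x := fun x => congrFun hS x
  let fib : Bundle.TotalSpace DiscreteReal Z.Fiber → DiscreteReal := fun p => p.2
  let value : G → ℂ := fun y => H y y + Complex.I * (fib (S y)).val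
  have hval : ∀ x : G, ∃ c : ℂ, ∀ᶠ y in 𝓝 x, value y = H x y + c := by
    intro x
    have hsrc : S x ∈ (Z.localTriv x).source := by
      rw [Z.mem_localTriv_source, hS']
      exact mem_ball_self (hr x)
    have hcont : ContinuousAt (fun y => (Z.localTriv x (S y)).2) x :=
      continuous_snd.continuousAt.comp
        (((Z.localTriv x).continuousAt hsrc).comp S.continuous.continuousAt)
    -- A continuous map into a discrete space is locally constant, so in the chart at x the glued
    -- function is H x plus a constant.
    have hev : ∀ᶠ y in 𝓝 x, (Z.localTriv x (S y)).2 = (Z.localTriv x (S x)).2 :=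
      hcont.eventually (p := fun v => v = (Z.localTriv x (S x)).2)
        (by rw [nhds_discrete]; exact eventually_pure.2 rfl)
    have hnear : ∀ᶠ y : G in 𝓝 x, (y : ℂ) ∈ ball (x : ℂ) (r x) :=
      continuous_subtype_val.continuousAt.eventually (ball_mem_nhds _ (hr x))
    refine ⟨Complex.I * ((Z.localTriv x (S x)).2).val, ?_⟩
    filter_upwards [hev, hnear] with y hy hyx
    have e1 : ((Z.localTriv x (S y)).2).val =
        (fib (S y)).val + (H (S y).1 (S y).1 - H x (S y).1).im := rfl
    rw [hy, hS'] at e1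
    have e2 := hre y x y ⟨mem_ball_self (hr y), hyx⟩
    simp only [value]
    rw [e1]
    apply Complex.ext
    · simp at e2 ⊢
      linarith
    · simp
      ring
  refine ⟨fun z => if hz : z ∈ G then value ⟨z, hz⟩ else 0, ?_, ?_⟩
  · intro z hz
    obtain ⟨c, hc⟩ := hval ⟨z, hz⟩
    have hd : DifferentiableAt ℂ (fun y => H ⟨z, hz⟩ y + c) z :=
      ((hHa ⟨z, hz⟩ z (mem_ball_self (hr _))).differentiableAt).add_const c
    refine DifferentiableAt.differentiableWithinAt (hd.congr_of_eventuallyEq ?_)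
    rw [nhds_subtype_eq_comap, eventually_comap] at hc
    filter_upwards [hc, hGo.mem_nhds hz] with y hy hyG
    simp only [dif_pos hyG]
    exact hy ⟨y, hyG⟩ rfl
  · intro z hz
    simp only [dif_pos hz, value]
    have h1 : (H ⟨z, hz⟩ z).re = h z := hHre ⟨z, hz⟩ (mem_ball_self (hr _))
    simp [h1]

end HarmonicConjugate

/-! ### Division, Montel's theorem and Hurwitz's theorem -/

section HolomorphicLimits

open Metric

theorem AnalyticAt.exists_eventually_eq_mul {f g : ℂ → ℂ} {z : ℂ} (hf : AnalyticAt ℂ f z)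
    (hg : AnalyticAt ℂ g z) (hgt : analyticOrderAt g z ≠ ⊤)
    (hle : analyticOrderAt g z ≤ analyticOrderAt f z) :
    ∃ q : ℂ → ℂ, AnalyticAt ℂ q z ∧ ∀ᶠ w in 𝓝 z, f w = q w * g w := by
  obtain ⟨E, hE, hE0, hgE⟩ := (hg.analyticOrderAt_ne_top).1 hgt
  rw [← Nat.cast_analyticOrderNatAt hgt] at hle
  obtain ⟨F, hF, hfF⟩ := (natCast_le_analyticOrderAt hf).1 hle
  refine ⟨fun w => F w / E w, hF.div hE hE0, ?_⟩
  filter_upwards [hgE, hfF, hE.continuousAt.eventually_ne hE0] with w h1 h2 h3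
  rw [h1, h2, smul_eq_mul, smul_eq_mul]
  field_simp

/-- Division of holomorphic functions. -/
theorem exists_differentiableOn_eq_mul {G : Set ℂ} (hGo : IsOpen G) {f g : ℂ → ℂ}
    (hf : DifferentiableOn ℂ f G) (hg : DifferentiableOn ℂ g G)
    (hgt : ∀ z ∈ G, analyticOrderAt g z ≠ ⊤)
    (hle : ∀ z ∈ G, analyticOrderAt g z ≤ analyticOrderAt f z) :
    ∃ q : ℂ → ℂ, DifferentiableOn ℂ q G ∧ ∀ z ∈ G, f z = q z * g z := by
  have hfa : ∀ z ∈ G, AnalyticAt ℂ f z := fun z hz => hf.analyticAt (hGo.mem_nhds hz)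
  have hga : ∀ z ∈ G, AnalyticAt ℂ g z := fun z hz => hg.analyticAt (hGo.mem_nhds hz)
  have hloc : ∀ z : ℂ, ∃ q : ℂ → ℂ, z ∈ G →
      AnalyticAt ℂ q z ∧ ∀ᶠ w in 𝓝 z, f w = q w * g w := fun z => by
    by_cases hz : z ∈ G
    · obtain ⟨q, hq⟩ := (hfa z hz).exists_eventually_eq_mul (hga z hz) (hgt z hz) (hle z hz)
      exact ⟨q, fun _ => hq⟩
    · exact ⟨0, fun h => absurd h hz⟩
  choose q hq using hloc
  have hval : ∀ z ∈ G, f z = q z z * g z := fun z hz => (hq z hz).2.self_of_nhds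
  -- The quotient is the diagonal of the local quotients. Near z, off the isolated zeros of g,
  -- cancelling g shows that it agrees with the single analytic function `q z`.
  refine ⟨fun z => q z z, fun z hz => ?_, hval⟩
  refine (((hq z hz).1.differentiableAt).congr_of_eventuallyEq ?_).differentiableWithinAt
  have hne : ∀ᶠ w in 𝓝[≠] z, g w ≠ 0 := by
    rcases (hga z hz).eventually_eq_zero_or_eventually_ne_zero with h | h
    · exact absurd (analyticOrderAt_eq_top.2 h) (hgt z hz)
    · exact h
  have h1 : ∀ᶠ w in 𝓝[≠] z, q w w = q z w := by
    filter_upwards [hne, nhdsWithin_le_nhds (hq z hz).2, nhdsWithin_le_nhds (hGo.mem_nhds hz)]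
      with w h2 h3 hw
    exact mul_right_cancel₀ h2 ((hval w hw).symm.trans h3)
  rw [eventually_nhdsWithin_iff] at h1
  filter_upwards [h1] with w hw
  rcases eq_or_ne w z with rfl | h
  · rfl
  · exact hw h

theorem analyticOrderAt_eq_add_of_eq_mul {G : Set ℂ} (hGo : IsOpen G) {f g q : ℂ → ℂ}
    (hg : DifferentiableOn ℂ g G) (hq : DifferentiableOn ℂ q G)
    (h : ∀ z ∈ G, f z = q z * g z) {z : ℂ} (hz : z ∈ G) :
    analyticOrderAt f z = analyticOrderAt q z + analyticOrderAt g z := by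
  rw [← analyticOrderAt_mul (hq.analyticAt (hGo.mem_nhds hz)) (hg.analyticAt (hGo.mem_nhds hz))]
  exact analyticOrderAt_congr (by filter_upwards [hGo.mem_nhds hz] with w hw using h w hw)

/-- If two holomorphic functions have the same zeros with multiplicities, then their quotient has
no zeros. -/
theorem exists_differentiableOn_eq_mul_ne_zero {G : Set ℂ} (hGo : IsOpen G) {f g : ℂ → ℂ}
    (hf : DifferentiableOn ℂ f G) (hg : DifferentiableOn ℂ g G)
    (hgt : ∀ z ∈ G, analyticOrderAt g z ≠ ⊤)
    (hle : ∀ z ∈ G, analyticOrderAt g z ≤ analyticOrderAt f z) :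
    ∃ q : ℂ → ℂ, DifferentiableOn ℂ q G ∧ (∀ z ∈ G, f z = q z * g z) ∧
      ∀ z ∈ G, analyticOrderAt g z = analyticOrderAt f z → q z ≠ 0 := by
  obtain ⟨q, hq, h⟩ := exists_differentiableOn_eq_mul hGo hf hg hgt hle
  refine ⟨q, hq, h, fun z hz he hq0 => ?_⟩
  have h1 := analyticOrderAt_eq_add_of_eq_mul hGo hg hq h hz
  rw [← he] at h1
  have h2 : analyticOrderAt q z = 0 := by
    have h3 : (0 : ℕ∞) + analyticOrderAt g z = analyticOrderAt q z + analyticOrderAt g z := by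
      rw [zero_add]; exact h1
    exact ENat.add_left_injective_of_ne_top (hgt z hz) h3.symm
  exact ((hq.analyticAt (hGo.mem_nhds hz)).analyticOrderAt_eq_zero.1 h2) hq0

/-- **Montel's theorem** along an ultrafilter. -/
theorem exists_tendstoLocallyUniformlyOn_hyperfilter {U : Set ℂ} (hU : IsOpen U)
    {F : ℕ → ℂ → ℂ} (hF : ∀ m, DifferentiableOn ℂ (F m) U)
    (hb : ∀ z ∈ U, ∃ ε > 0, ∃ B : ℝ, ∀ᶠ m in atTop, ∀ w ∈ ball z ε, ‖F m w‖ ≤ B) :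
    ∃ f : ℂ → ℂ, TendstoLocallyUniformlyOn F f (hyperfilter ℕ : Filter ℕ) U := by
  have hat : (hyperfilter ℕ : Filter ℕ) ≤ atTop := Nat.hyperfilter_le_atTop
  -- Bounded values converge along an ultrafilter by compactness of closed discs, so no diagonal
  -- subsequence is needed.
  have hlim : ∀ z : ℂ, ∃ a : ℂ, z ∈ U → Tendsto (fun m => F m z) (hyperfilter ℕ : Filter ℕ) (𝓝 a) := by
    intro z
    by_cases hz : z ∈ U
    · obtain ⟨ε, hε, B, hB⟩ := hb z hz
      have h1 : ∀ᶠ m in (hyperfilter ℕ : Filter ℕ), F m z ∈ closedBall (0 : ℂ) B :=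
        hat (hB.mono fun m hm => by simpa using hm z (mem_ball_self hε))
      obtain ⟨a, -, ha⟩ := (isCompact_closedBall (0 : ℂ) B).ultrafilter_le_nhds
        ((hyperfilter ℕ).map fun m => F m z) (by
          rw [le_principal_iff]; exact h1)
      exact ⟨a, fun _ => ha⟩
    · exact ⟨0, fun h => absurd h hz⟩
  choose f hf using hlim
  refine ⟨f, Metric.tendstoLocallyUniformlyOn_iff.2 fun η hη x hx => ?_⟩
  obtain ⟨ε₁, hε₁, B, hB⟩ := hb x hx
  obtain ⟨ε₂, hε₂, hε₂U⟩ := Metric.isOpen_iff.1 hU x hx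
  set ε := min ε₁ ε₂
  have hε : 0 < ε := lt_min hε₁ hε₂
  set L := (2 * |B| + 1) / ε
  have hL : 0 < L := by positivity
  -- Schwarz lemma: F m maps the ε-disc into a disc of radius 2|B| + 1 about F m x, which gives a
  -- Lipschitz constant independent of m. The summand 1 keeps it positive.
  have hlip : ∀ᶠ m in atTop, ∀ y ∈ ball x ε, dist (F m y) (F m x) ≤ L * dist y x := by
    filter_upwards [hB] with m hm y hy
    refine Complex.dist_le_div_mul_dist_of_mapsTo_ball (R₂ := 2 * |B| + 1)
      ((hF m).mono ((ball_subset_ball (min_le_right _ _)).trans hε₂U)) (fun w hw => ?_) hy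
    have h1 := hm w (ball_subset_ball (min_le_left _ _) hw)
    have h2 := hm x (mem_ball_self hε₁)
    have h3 := norm_sub_le (F m w) (F m x)
    have h4 := le_abs_self B
    rw [mem_closedBall, dist_eq_norm]
    linarith
  have hball : ball x (min ε (η / (3 * L))) ∈ 𝓝[U] x :=
    nhdsWithin_le_nhds (ball_mem_nhds x (lt_min hε (by positivity)))
  refine ⟨ball x (min ε (η / (3 * L))) ∩ U, inter_mem hball self_mem_nhdsWithin, ?_⟩
  have hx' : ∀ᶠ m in (hyperfilter ℕ : Filter ℕ), dist (F m x) (f x) < η / 3 :=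
    Metric.tendsto_nhds.1 (hf x hx) (η / 3) (by positivity)
  filter_upwards [hat hlip, hx'] with m hm hmx y hy
  have hy1 : y ∈ ball x ε := ball_subset_ball (min_le_left _ _) hy.1
  have hy2 : L * dist y x < η / 3 := by
    have : dist y x < η / (3 * L) := lt_of_lt_of_le hy.1 (min_le_right _ _)
    rw [lt_div_iff₀ (by positivity)] at this
    linarith
  have h1 : dist (f y) (f x) ≤ L * dist y x :=
    le_of_tendsto ((hf y hy.2).dist (hf x hx)) (Eventually.mono (hat hlip) fun k hk => hk y hy1)
  have h2 := hm y hy1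
  have h3 := dist_triangle (f y) (f x) (F m y)
  have h4 := dist_triangle (f x) (F m x) (F m y)
  rw [dist_comm (f x) (F m x), dist_comm (F m x) (F m y)] at h4
  linarith

/-- Maximum and minimum principle for a quotient by a power without zeros. -/
theorem norm_bounds_of_eq_mul_pow {F q : ℂ → ℂ} {z₀ : ℂ} {r a b : ℝ} {N : ℕ} (hr : 0 < r)
    (hq : DifferentiableOn ℂ q (closedBall z₀ r)) (hq0 : ∀ z ∈ closedBall z₀ r, q z ≠ 0)
    (hF : ∀ z ∈ closedBall z₀ r, F z = q z * (z - z₀) ^ N) (ha : 0 < a)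
    (hs : ∀ z ∈ sphere z₀ r, a ≤ ‖F z‖ ∧ ‖F z‖ ≤ b) {w : ℂ} (hw : w ∈ ball z₀ r) :
    a / r ^ N * ‖w - z₀‖ ^ N ≤ ‖F w‖ ∧ ‖F w‖ ≤ b / r ^ N * ‖w - z₀‖ ^ N := by
  have hcl : closure (ball z₀ r) = closedBall z₀ r := closure_ball z₀ hr.ne'
  have hfr : frontier (ball z₀ r) = sphere z₀ r := frontier_ball z₀ hr.ne'
  have hsq : ∀ z ∈ sphere z₀ r, ‖F z‖ = ‖q z‖ * r ^ N := fun z hz => by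
    rw [hF z (sphere_subset_closedBall hz), norm_mul, norm_pow, mem_sphere_iff_norm.1 hz]
  have hup : ‖q w‖ ≤ b / r ^ N := by
    refine Complex.norm_le_of_forall_mem_frontier_norm_le isBounded_ball
      (DifferentiableOn.diffContOnCl (by rwa [hcl])) (fun z hz => ?_) (subset_closure hw)
    rw [hfr] at hz
    rw [le_div_iff₀ (by positivity), ← hsq z hz]
    exact (hs z hz).2
  -- The minimum principle, as the maximum principle for 1/q.
  have hlow : ‖(q w)⁻¹‖ ≤ (a / r ^ N)⁻¹ := by
    refine Complex.norm_le_of_forall_mem_frontier_norm_le (f := fun z => (q z)⁻¹) isBounded_ball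
      (DifferentiableOn.diffContOnCl (by rw [hcl]; exact hq.inv hq0)) (fun z hz => ?_)
      (subset_closure hw)
    rw [hfr] at hz
    rw [norm_inv]
    apply inv_anti₀ (by positivity)
    rw [div_le_iff₀ (by positivity), ← hsq z hz]
    exact (hs z hz).1
  have hwc := ball_subset_closedBall hw
  rw [norm_inv, inv_le_inv₀ (norm_pos_iff.2 (hq0 w hwc)) (by positivity)] at hlow
  rw [hF w hwc, norm_mul, norm_pow]
  exact ⟨by gcongr, by gcongr⟩

/-- The order of a zero is read off from two-sided growth bounds on |f|. Such bounds pass to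
pointwise limits, which replaces the argument principle in Hurwitz's theorem. -/
theorem analyticOrderAt_eq_of_norm_bounds {f : ℂ → ℂ} {z₀ : ℂ} {a b : ℝ} {N : ℕ}
    (hf : AnalyticAt ℂ f z₀) (ha : 0 < a)
    (h : ∀ᶠ w in 𝓝[≠] z₀, a * ‖w - z₀‖ ^ N ≤ ‖f w‖ ∧ ‖f w‖ ≤ b * ‖w - z₀‖ ^ N) :
    analyticOrderAt f z₀ = N := by
  have hpos : ∀ᶠ w in 𝓝[≠] z₀, 0 < ‖w - z₀‖ := by
    filter_upwards [self_mem_nhdsWithin] with w hw using norm_pos_iff.2 (sub_ne_zero.2 hw)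
  have hnt : analyticOrderAt f z₀ ≠ ⊤ := by
    intro ht
    have h1 : ∀ᶠ w in 𝓝[≠] z₀, f w = 0 := nhdsWithin_le_nhds (analyticOrderAt_eq_top.1 ht)
    obtain ⟨w, h2, h3, h4⟩ := (h1.and (h.and hpos)).exists
    rw [h2, norm_zero] at h3
    have : 0 < a * ‖w - z₀‖ ^ N := by positivity
    linarith [h3.1]
  obtain ⟨e, he, he0, hfe⟩ := hf.analyticOrderAt_ne_top.1 hnt
  set k := analyticOrderNatAt f z₀ with hk
  have hen : Tendsto (fun w => ‖e w‖) (𝓝[≠] z₀) (𝓝 ‖e z₀‖) :=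
    (he.continuousAt.norm).tendsto.mono_left nhdsWithin_le_nhds
  have hzn : Tendsto (fun w => ‖w - z₀‖) (𝓝[≠] z₀) (𝓝 0) := by
    have : Continuous fun w : ℂ => ‖w - z₀‖ := by fun_prop
    simpa using (this.tendsto z₀).mono_left nhdsWithin_le_nhds
  have hnorm : ∀ᶠ w in 𝓝[≠] z₀, ‖f w‖ = ‖w - z₀‖ ^ k * ‖e w‖ := by
    filter_upwards [nhdsWithin_le_nhds hfe] with w hw
    rw [hw, smul_eq_mul, norm_mul, norm_pow]
  rw [← Nat.cast_analyticOrderNatAt hnt, ← hk]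
  rcases lt_trichotomy k N with hlt | heq | hlt
  · exfalso
    have h1 : ‖e z₀‖ ≤ b * 0 ^ (N - k) := by
      refine le_of_tendsto_of_tendsto hen ((hzn.pow (N - k)).const_mul b) ?_
      filter_upwards [h, hpos, hnorm] with w h2 h3 h4
      have h5 := h2.2
      rw [h4, show N = k + (N - k) by omega, pow_add] at h5
      have h6 : 0 < ‖w - z₀‖ ^ k := by positivity
      have h7 : ‖w - z₀‖ ^ k * ‖e w‖ ≤ ‖w - z₀‖ ^ k * (b * ‖w - z₀‖ ^ (N - k)) := by
        refine h5.trans (le_of_eq (by ring_nf))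
      exact le_of_mul_le_mul_left h7 h6
    rw [zero_pow (by omega), mul_zero] at h1
    exact he0 (norm_le_zero_iff.1 h1)
  · rw [heq]
  · exfalso
    have h1 : a ≤ 0 ^ (k - N) * ‖e z₀‖ := by
      refine ge_of_tendsto ((hzn.pow (k - N)).mul hen) ?_
      filter_upwards [h, hpos, hnorm] with w h2 h3 h4
      have h5 := h2.1
      rw [h4, show k = N + (k - N) by omega, pow_add] at h5
      have h6 : 0 < ‖w - z₀‖ ^ N := by positivity
      have h7 : ‖w - z₀‖ ^ N * a ≤ ‖w - z₀‖ ^ N * (‖w - z₀‖ ^ (k - N) * ‖e w‖) := by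
        refine le_trans (le_of_eq (by ring)) (h5.trans (le_of_eq ?_))
        ring_nf
      exact le_of_mul_le_mul_left h7 h6
    rw [zero_pow (by omega), zero_mul] at h1
    linarith

theorem analyticOrderAt_sub_pow (z₀ z : ℂ) (N : ℕ) :
    analyticOrderAt (fun w => (w - z₀) ^ N) z = if z = z₀ then (N : ℕ∞) else 0 := by
  split_ifs with h
  · subst h
    exact analyticOrderAt_centeredMonomial
  · refine (AnalyticAt.analyticOrderAt_eq_zero (by fun_prop)).2 ?_
    exact pow_ne_zero _ (sub_ne_zero.2 h)

/-- **Hurwitz's theorem**: a limit of holomorphic functions whose zeros stabilize on compact sets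
has the limiting zero set, unless it vanishes identically. -/
theorem hasZeroSet_of_tendstoLocallyUniformlyOn {G : Set ℂ} (hGo : IsOpen G)
    (hGc : IsPreconnected G) {ι : Type*} {Λ : ι → ℂ}
    (hΛ : ∀ K : Set ℂ, IsCompact K → K ⊆ G → {n | Λ n ∈ K}.Finite)
    {F : ℕ → ℂ → ℂ} {f : ℂ → ℂ} {l : Filter ℕ} [l.NeBot]
    (hF : ∀ m, DifferentiableOn ℂ (F m) G) (hlim : TendstoLocallyUniformlyOn F f l G)
    (hord : ∀ K : Set ℂ, IsCompact K → K ⊆ G → ∀ᶠ m in l, ∀ z ∈ K,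
      analyticOrderAt (F m) z = {n | Λ n = z}.encard)
    (hne : ∃ z ∈ G, f z ≠ 0) : HasZeroSet G Λ f := by
  have hfd : DifferentiableOn ℂ f G := hlim.differentiableOn (Eventually.of_forall hF) hGo
  have hfa : AnalyticOnNhd ℂ f G := hfd.analyticOnNhd hGo
  refine ⟨hfd, fun z₀ hz₀ => ?_⟩
  have hfin : {n | Λ n = z₀}.Finite := hΛ {z₀} isCompact_singleton (by simpa using hz₀)
  set N := {n | Λ n = z₀}.ncard
  have hN : {n | Λ n = z₀}.encard = N := (hfin.cast_ncard_eq).symm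
  rw [hN]
  have hfne : ∀ᶠ w in 𝓝[≠] z₀, f w ≠ 0 := by
    rcases (hfa z₀ hz₀).eventually_eq_zero_or_eventually_ne_zero with h | h
    · obtain ⟨z₁, hz₁, hz₁'⟩ := hne
      exact absurd (hfa.eqOn_zero_of_preconnected_of_eventuallyEq_zero hGc hz₀ h hz₁) hz₁'
    · exact h
  obtain ⟨ρ, hρ, hρG⟩ := Metric.isOpen_iff.1 hGo z₀ hz₀
  have hΛne : ∀ᶠ w in 𝓝[≠] z₀, ∀ n, Λ n ≠ w := by
    have hfin' : (Λ '' {n | Λ n ∈ closedBall z₀ (ρ / 2)} \ {z₀}).Finite :=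
      ((hΛ _ (isCompact_closedBall _ _)
        ((closedBall_subset_ball (by linarith)).trans hρG)).image Λ).subset sdiff_subset
    have h1 : ∀ᶠ w in 𝓝 z₀, w ∉ Λ '' {n | Λ n ∈ closedBall z₀ (ρ / 2)} \ {z₀} :=
      hfin'.isClosed.isOpen_compl.mem_nhds (by simp)
    filter_upwards [nhdsWithin_le_nhds h1, self_mem_nhdsWithin,
      nhdsWithin_le_nhds (closedBall_mem_nhds z₀ (half_pos hρ))] with w hw1 hw2 hw3 n hn
    exact hw1 ⟨⟨n, by simpa [hn] using hw3, hn⟩, hw2⟩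
  obtain ⟨s, hs, hsub⟩ := Metric.mem_nhdsWithin_iff.1 (hfne.and hΛne)
  obtain ⟨r, hr, hrs, hrρ⟩ : ∃ r, 0 < r ∧ r < s ∧ r < ρ :=
    ⟨min s ρ / 2, by positivity, by linarith [min_le_left s ρ, lt_min hs hρ],
      by linarith [min_le_right s ρ, lt_min hs hρ]⟩
  have hrG : closedBall z₀ r ⊆ G := (closedBall_subset_ball hrρ).trans hρG
  have hpt : ∀ w ∈ closedBall z₀ r, w ≠ z₀ → f w ≠ 0 ∧ ∀ n, Λ n ≠ w := fun w hw hne =>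
    hsub ⟨closedBall_subset_ball hrs hw, hne⟩
  have hsne : ∀ w ∈ sphere z₀ r, f w ≠ 0 := fun w hw =>
    (hpt w (sphere_subset_closedBall hw) (ne_of_mem_sphere hw hr.ne')).1
  have hScomp : IsCompact (sphere z₀ r) := isCompact_sphere _ _
  have hSG : sphere z₀ r ⊆ G := sphere_subset_closedBall.trans hrG
  have hfc : ContinuousOn (fun w => ‖f w‖) (sphere z₀ r) := (hfd.continuousOn.mono hSG).norm
  have hSne : (sphere z₀ r).Nonempty := NormedSpace.sphere_nonempty.2 hr.le
  obtain ⟨w₁, hw₁, hmin⟩ := hScomp.exists_isMinOn hSne hfc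
  obtain ⟨w₂, hw₂, hmax⟩ := hScomp.exists_isMaxOn hSne hfc
  set δ := ‖f w₁‖ / 2 with hδ
  have hδ0 : 0 < δ := half_pos (norm_pos_iff.2 (hsne w₁ hw₁))
  have hunif : ∀ᶠ m in l, ∀ w ∈ sphere z₀ r, dist (f w) (F m w) < δ :=
    Metric.tendstoUniformlyOn_iff.1
      ((tendstoLocallyUniformlyOn_iff_forall_isCompact hGo).1 hlim _ hSG hScomp) δ hδ0
  -- On the circle |F m| lies between δ, half the minimum of |f|, and max |f| + δ. Dividing by (z -
  -- z₀)^N carries these bounds into the disc uniformly in m.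
  have hbd : ∀ᶠ m in l, ∀ w ∈ ball z₀ r, δ / r ^ N * ‖w - z₀‖ ^ N ≤ ‖F m w‖ ∧
      ‖F m w‖ ≤ (‖f w₂‖ + δ) / r ^ N * ‖w - z₀‖ ^ N := by
    filter_upwards [hunif, hord _ (isCompact_closedBall z₀ r) hrG] with m hm1 hm2 w hw
    have hord1 : ∀ z ∈ closedBall z₀ r,
        analyticOrderAt (fun w => (w - z₀) ^ N) z = analyticOrderAt (F m) z := fun z hz => by
      rw [analyticOrderAt_sub_pow, hm2 z hz]
      split_ifs with h
      · rw [h, hN]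
      · have : {n | Λ n = z} = ∅ := by
          ext n; simpa using (hpt z hz h).2 n
        rw [this, encard_empty]
    obtain ⟨q, hq, hFq, hq0⟩ := exists_differentiableOn_eq_mul_ne_zero hGo (hF m)
      (g := fun w => (w - z₀) ^ N) (by fun_prop)
      (fun z _ => by rw [analyticOrderAt_sub_pow]; split_ifs <;> simp)
      (fun z hz => by
        by_cases h : z = z₀
        · exact (hord1 z (by simp [h, hr.le])).le
        · simp [analyticOrderAt_sub_pow, h])
    refine norm_bounds_of_eq_mul_pow hr (hq.mono hrG) (fun z hz => hq0 z (hrG hz) (hord1 z hz))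
      (fun z hz => hFq z (hrG hz)) hδ0 (fun z hz => ?_) hw
    have h1 := hm1 z hz
    have h2 : ‖f w₁‖ ≤ ‖f z‖ := hmin hz
    have h3 : ‖f z‖ ≤ ‖f w₂‖ := hmax hz
    have h4 := norm_sub_norm_le (f z) (F m z)
    have h5 := norm_sub_norm_le (F m z) (f z)
    rw [dist_eq_norm] at h1
    rw [norm_sub_rev] at h5
    constructor <;> linarith
  refine analyticOrderAt_eq_of_norm_bounds (hfa z₀ hz₀) (a := δ / r ^ N)
    (b := (‖f w₂‖ + δ) / r ^ N) (by positivity) ?_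
  filter_upwards [nhdsWithin_le_nhds (ball_mem_nhds z₀ hr)] with w hw
  have ht : Tendsto (fun m => ‖F m w‖) l (𝓝 ‖f w‖) :=
    (hlim.tendsto_at (hrG (ball_subset_closedBall hw))).norm
  exact ⟨ge_of_tendsto ht (hbd.mono fun m hm => (hm w hw).1),
    le_of_tendsto ht (hbd.mono fun m hm => (hm w hw).2)⟩

end HolomorphicLimits

/-! ### The extended-valued logarithm of the modulus -/

section LogNorm

theorem elogNorm_eq_log {w : ℂ} (hw : w ≠ 0) : elogNorm w = (Real.log ‖w‖ : ℝ) := by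
  rw [elogNorm, ← ofReal_norm, ENNReal.log_ofReal_of_pos (norm_pos_iff.2 hw)]

@[simp] theorem elogNorm_zero : elogNorm 0 = ⊥ := by simp [elogNorm]

theorem elogNorm_lt_coe {w : ℂ} {a : ℝ} : elogNorm w < a ↔ ‖w‖ < Real.exp a := by
  rcases eq_or_ne w 0 with rfl | hw
  · simp [EReal.bot_lt_coe, Real.exp_pos]
  · rw [elogNorm_eq_log hw, EReal.coe_lt_coe_iff, Real.log_lt_iff_lt_exp (norm_pos_iff.2 hw)]

theorem elogNorm_le_coe {w : ℂ} {a : ℝ} : elogNorm w ≤ a ↔ ‖w‖ ≤ Real.exp a := by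
  rcases eq_or_ne w 0 with rfl | hw
  · simp [Real.exp_nonneg]
  · rw [elogNorm_eq_log hw, EReal.coe_le_coe_iff, Real.log_le_iff_le_exp (norm_pos_iff.2 hw)]

theorem measurable_elogNorm : Measurable elogNorm :=
  ENNReal.log_monotone.measurable.comp measurable_enorm

end LogNorm

/-! ### Duality between harmonic majorization and representing measures -/

section Duality

open InnerProductSpace
open scoped CompactlySupported

/-- The restrictions to `K` of harmonic functions on `G` with value `c` at the origin. -/
def harmonicRestrictions (G K : Set ℂ) (c : ℝ) : Set C(K, ℝ) :=
  {f | ∃ h : ℂ → ℝ, HarmonicOnNhd h G ∧ h 0 = c ∧ ∀ z : K, f z = h z}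

/-- The continuous functions `f` on `K` with `‖g‖ exp f < exp M`. -/
def expStrictMinorants {K : Set ℂ} (g : ℂ → ℂ) (M : ℂ → ℝ) : Set C(K, ℝ) :=
  {f | ∀ z : K, ‖g z‖ * Real.exp (f z) < Real.exp (M z)}

theorem convex_harmonicRestrictions (G K : Set ℂ) (c : ℝ) :
    Convex ℝ (harmonicRestrictions G K c) := by
  rintro f₁ ⟨h₁, hh₁, h₁0, hf₁⟩ f₂ ⟨h₂, hh₂, h₂0, hf₂⟩ a b - - hab
  refine ⟨a • h₁ + b • h₂, hh₁.const_smul.add hh₂.const_smul, ?_, fun z => ?_⟩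
  · simp [h₁0, h₂0, ← add_mul, hab]
  · simp [hf₁, hf₂]

/-- The exponential form of log|g| + f < M imposes nothing at the zeros of g, and convexity of the
set reduces to convexity of exp. -/
theorem convex_expStrictMinorants {K : Set ℂ} (g : ℂ → ℂ) (M : ℂ → ℝ) :
    Convex ℝ (expStrictMinorants (K := K) g M) := by
  intro f₁ hf₁ f₂ hf₂ a b ha hb hab z
  have h1 := convexOn_exp.2 (mem_univ (f₁ z)) (mem_univ (f₂ z)) ha hb hab
  simp only [smul_eq_mul] at h1
  have e : (a • f₁ + b • f₂) z = a * f₁ z + b * f₂ z := by simp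
  rw [e]
  calc ‖g z‖ * Real.exp (a * f₁ z + b * f₂ z)
      ≤ ‖g z‖ * (a * Real.exp (f₁ z) + b * Real.exp (f₂ z)) := by gcongr
    _ = a * (‖g z‖ * Real.exp (f₁ z)) + b * (‖g z‖ * Real.exp (f₂ z)) := by ring
    _ < a * Real.exp (M z) + b * Real.exp (M z) := by
        rcases ha.eq_or_lt with rfl | ha'
        · rw [zero_add] at hab
          subst hab
          simpa using hf₂ z
        · have := mul_lt_mul_of_pos_left (hf₁ z) ha'
          have := mul_le_mul_of_nonneg_left (hf₂ z).le hb
          linarith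
    _ = Real.exp (M z) := by rw [← add_mul, hab, one_mul]

/-- On a compact set a strict inequality between continuous functions is stable under small uniform
perturbations. -/
theorem isOpen_expStrictMinorants {K : Set ℂ} (hK : IsCompact K) {g : ℂ → ℂ} {M : ℂ → ℝ}
    (hg : ContinuousOn g K) (hM : ContinuousOn M K) :
    IsOpen (expStrictMinorants (K := K) g M) := by
  have : CompactSpace K := isCompact_iff_compactSpace.1 hK
  let gK : C(K, ℝ) := ⟨fun z => ‖g z‖, (continuousOn_iff_continuous_domRestrict.1 hg).norm⟩
  let MK : C(K, ℝ) := ⟨fun z => Real.exp (M z),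
    Real.continuous_exp.comp (continuousOn_iff_continuous_domRestrict.1 hM)⟩
  let ex : C(ℝ, ℝ) := ⟨Real.exp, Real.continuous_exp⟩
  have hcont : Continuous fun f : C(K, ℝ) => MK - gK * ex.comp f :=
    continuous_const.sub (continuous_const.mul (ContinuousMap.continuous_postcomp ex))
  have hopen : IsOpen {f : C(K, ℝ) | MapsTo f univ (Ioi 0)} :=
    ContinuousMap.isOpen_setOfPred_mapsTo isCompact_univ isOpen_Ioi
  convert hopen.preimage hcont using 1
  ext f
  have e : ∀ z : K, (MK - gK * ex.comp f) z = Real.exp (M z) - ‖g z‖ * Real.exp (f z) :=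
    fun _ => rfl
  simp only [expStrictMinorants, MapsTo, mem_ofPred_eq, mem_preimage, mem_Ioi, mem_univ,
    true_implies, e, sub_pos]

/-- **Duality**: if the integral of `log |g|` is dominated by that of `M` for all representing
measures carried by the compact set `K`, up to an additive constant, then `log |g| + h < M` on `K`
for some function `h` harmonic on `G`. -/
theorem exists_harmonicOnNhd_of_forall_eintegral_le {G K : Set ℂ} (hK : IsCompact K)
    (hKG : K ⊆ G) {g : ℂ → ℂ} {M : ℂ → ℝ} (hg : ContinuousOn g K)
    (hM : ContinuousOn M K) {C : ℝ}
    (H : ∀ μ : Measure ℂ, IsRepresentingMeasure G μ → μ Kᶜ = 0 →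
      eintegral μ (fun z => elogNorm (g z)) ≤ ((∫ z, M z ∂μ + C : ℝ) : EReal)) :
    ∃ h : ℂ → ℝ, HarmonicOnNhd h G ∧ h 0 = -C - 1 ∧
      ∀ z ∈ K, ‖g z‖ * Real.exp (h z) < Real.exp (M z) := by
  have : CompactSpace K := isCompact_iff_compactSpace.1 hK
  by_contra hcon
  push Not at hcon
  have hdisj : Disjoint (expStrictMinorants (K := K) g M)
      (harmonicRestrictions G K (-C - 1)) := by
    rw [Set.disjoint_left]
    rintro f hf ⟨h, hh, h0, hfh⟩
    obtain ⟨z, hz, hle⟩ := hcon h hh h0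
    have := hf ⟨z, hz⟩
    rw [hfh] at this
    exact absurd this (not_lt.2 hle)
  obtain ⟨L, u, hLA, hLB⟩ := geometric_hahn_banach_open (convex_expStrictMinorants g M)
    (isOpen_expStrictMinorants hK hg hM) (convex_harmonicRestrictions G K (-C - 1)) hdisj
  have hgc : Continuous fun z : K => ‖g z‖ := (continuousOn_iff_continuous_domRestrict.1 hg).norm
  have hMc : Continuous fun z : K => M z := continuousOn_iff_continuous_domRestrict.1 hM
  -- Nearly extremal members of the open set, continuous across the zeros of g. The value 0 for ε ≤
  -- 0 is a dummy.
  let fε : ℝ → C(K, ℝ) := fun ε => if hε : 0 < ε then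
    ⟨fun z => M z - Real.log (‖g z‖ + ε),
      hMc.sub ((hgc.add continuous_const).log fun z => by
        have := norm_nonneg (g z); exact (by linarith : 0 < ‖g z‖ + ε).ne')⟩ else 0
  have hfε : ∀ ε, 0 < ε → ∀ z, fε ε z = M z - Real.log (‖g z‖ + ε) := fun ε hε z => by
    simp [fε, hε]
  have hfεA : ∀ ε, 0 < ε → fε ε ∈ expStrictMinorants (K := K) g M := fun ε hε z => by
    have hp : 0 < ‖g z‖ + ε := by positivity
    rw [hfε ε hε, Real.exp_sub, Real.exp_log hp, mul_div_assoc', div_lt_iff₀ hp, mul_comm]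
    exact mul_lt_mul_of_pos_left (by linarith) (Real.exp_pos _)
  -- The open set is stable under subtracting nonnegative functions and L is bounded above by u on
  -- it, so L cannot be negative on a nonnegative f.
  have hpos : ∀ f : C(K, ℝ), 0 ≤ f → 0 ≤ L f := by
    intro f hf
    by_contra hneg
    rw [not_le] at hneg
    have key : ∀ t : ℝ, 0 ≤ t → L (fε 1) + t * (-L f) < u := fun t ht => by
      have hmem : fε 1 - t • f ∈ expStrictMinorants (K := K) g M := fun z => by
        refine lt_of_le_of_lt ?_ (hfεA 1 one_pos z)
        have : 0 ≤ t * f z := mul_nonneg ht (hf z)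
        gcongr
        simpa using this
      have := hLA _ hmem
      rw [map_sub, map_smul, smul_eq_mul] at this
      linarith
    have h1 := key (|u - L (fε 1)| / (-L f)) (by have : 0 < -L f := by linarith
                                                 positivity)
    rw [div_mul_cancel₀ _ (by linarith)] at h1
    linarith [le_abs_self (u - L (fε 1))]
  have hconst : ∀ c : ℝ, ContinuousMap.const K c ∈ harmonicRestrictions G K c := fun c =>
    ⟨fun _ => c, fun _ _ => by simp, rfl, fun _ => rfl⟩
  set ℓ := L (ContinuousMap.const K 1) with hℓ
  have hℓc : ∀ c : ℝ, L (ContinuousMap.const K c) = c * ℓ := fun c => by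
    rw [hℓ, ← smul_eq_mul, ← map_smul]
    congr 1
    ext; simp
  -- If ℓ = 0, positivity applied to f + ‖f‖ gives L f ≥ 0 for all f, while separation from the
  -- constant -C - 1 gives L < u ≤ 0 on the open set.
  have hℓ0 : 0 < ℓ := by
    rcases (hpos (ContinuousMap.const K 1) fun z => zero_le_one).eq_or_lt with h | h
    · exfalso
      have hz : ∀ f : C(K, ℝ), 0 ≤ L f := fun f => by
        have h1 := hpos (f + ContinuousMap.const K ‖f‖) fun z => by
          have := (abs_le.1 (f.norm_coe_le_norm z)).1
          change 0 ≤ f z + ‖f‖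
          linarith
        rwa [map_add, hℓc, hℓ, ← h, mul_zero, add_zero] at h1
      have h1 := hLA _ (hfεA 1 one_pos)
      have h2 := hLB _ (hconst _)
      have h3 := hz (fε 1)
      rw [hℓc, hℓ, ← h, mul_zero] at h2
      linarith
    · exact h
  -- Multiples of h - h(0) may be added without changing the value at 0. L is bounded below on the
  -- resulting line, so its slope d vanishes.
  have hharm : ∀ h : ℂ → ℝ, HarmonicOnNhd h G → ∀ f : C(K, ℝ), (∀ z : K, f z = h z) →
      L f = h 0 * ℓ := by
    intro h hh f hf
    set d := L f - h 0 * ℓ with hd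
    have key : ∀ t : ℝ, u ≤ (-C - 1) * ℓ + t * d := fun t => by
      have hmem : ContinuousMap.const K (-C - 1) + t • (f - ContinuousMap.const K (h 0)) ∈
          harmonicRestrictions G K (-C - 1) := by
        refine ⟨(fun _ => -C - 1) + t • (h - fun _ => h 0), ?_, by simp, fun z => by simp [hf]⟩
        exact HarmonicOnNhd.add (fun _ _ => by simp)
          ((hh.sub (fun _ _ => by simp)).const_smul)
      have := hLB _ hmem
      rw [map_add, map_smul, map_sub, hℓc, hℓc, smul_eq_mul] at this
      exact this
    by_contra hne
    have hd0 : d ≠ 0 := sub_ne_zero.2 hne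
    have := key ((u - (-C - 1) * ℓ - 1) / d)
    rw [div_mul_cancel₀ _ hd0] at this
    linarith
  let Λ : C_c(K, ℝ) →ₚ[ℝ] ℝ := PositiveLinearMap.mk₀
    { toFun := fun f => ℓ⁻¹ * L f.toContinuousMap
      map_add' := fun f₁ f₂ => by
        rw [← mul_add, ← map_add]; rfl
      map_smul' := fun a f => by
        have : L (a • f).toContinuousMap = a * L f.toContinuousMap := by
          rw [← smul_eq_mul, ← map_smul]; rfl
        rw [this]; simp; ring }
    fun f hf => mul_nonneg (by positivity) (hpos _ hf)
  set μ₀ := RealRMK.rieszMeasure Λ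
  have h_int₀ : ∀ f : C(K, ℝ), ∫ z, f z ∂μ₀ = ℓ⁻¹ * L f := fun f =>
    RealRMK.integral_rieszMeasure Λ
      ⟨f, HasCompactSupport.of_compactSpace f⟩
  have : IsFiniteMeasure μ₀ := ⟨isCompact_univ.measure_lt_top⟩
  set μ := μ₀.map (Subtype.val : K → ℂ)
  have hemb : MeasurableEmbedding (Subtype.val : K → ℂ) :=
    MeasurableEmbedding.subtype_coe hK.measurableSet
  have h_int : ∀ v : ℂ → ℝ, ∀ f : C(K, ℝ), (∀ z : K, f z = v z) → ∫ z, v z ∂μ = ℓ⁻¹ * L f := by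
    intro v f hf
    rw [hemb.integral_map, ← h_int₀]
    simp only [hf]
  have hμK : μ Kᶜ = 0 := by
    rw [hemb.map_apply]; simp
  have hμ : IsRepresentingMeasure G μ := by
    refine ⟨inferInstance, ⟨K, hK, hKG, hμK⟩, fun h hh => ?_⟩
    have hhc : Continuous fun z : K => h z :=
      continuousOn_iff_continuous_domRestrict.1 (hh.continuousOn.mono hKG)
    rw [h_int h ⟨_, hhc⟩ fun _ => rfl, hharm h hh ⟨_, hhc⟩ fun _ => rfl]
    field_simp
  have h_intb : ∀ v : ℂ → ℝ, ContinuousOn v K → Integrable v μ := by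
    intro v hv
    rw [hemb.integrable_map_iff]
    exact (continuousOn_iff_continuous_domRestrict.1 hv).integrable_of_hasCompactSupport
      (HasCompactSupport.of_compactSpace _)
  have hlogc : ∀ ε, 0 < ε → ContinuousOn (fun z => Real.log (‖g z‖ + ε)) K := fun ε hε =>
    (hg.norm.add continuousOn_const).log fun z _ =>
      (add_pos_of_nonneg_of_pos (norm_nonneg (g z)) hε).ne'
  have hεle : ∀ ε, 0 < ε → ∫ z, M z ∂μ + (C + 1) ≤ ∫ z, Real.log (‖g z‖ + ε) ∂μ := by
    intro ε hε
    have h1 : ∫ z, (M z - Real.log (‖g z‖ + ε)) ∂μ = ℓ⁻¹ * L (fε ε) :=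
      h_int _ _ (hfε ε hε)
    rw [integral_sub (h_intb _ hM) (h_intb _ (hlogc ε hε))] at h1
    have h2 := (hLA _ (hfεA ε hε)).trans_le (hLB _ (hconst _))
    rw [hℓc] at h2
    have h3 : ℓ⁻¹ * L (fε ε) ≤ -C - 1 := by
      rw [inv_mul_le_iff₀ hℓ0]; linarith
    linarith
  -- Letting ε → 0 gives ∫ log|g| dμ ≥ ∫ M dμ + C + 1. The extra 1, built into h(0) = -C - 1,
  -- contradicts the hypothesis.
  have hfin := le_eintegral_add_of_forall_eventually_lt (μ := μ)
    (V := fun z => elogNorm (g z)) (D := fun z => Real.log (‖g z‖ + 1))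
    (u := fun k z => Real.log (‖g z‖ + 1 / ((k : ℝ) + 1)))
    (x := ((∫ z, M z ∂μ + (C + 1) : ℝ) : EReal)) (c := fun _ => 0) (c₀ := 0)
    (h_intb _ (hlogc 1 one_pos)) ?_ ?_ (fun k => h_intb _ (hlogc _ (by positivity))) ?_ ?_
    tendsto_const_nhds ?_
  · have := hfin.trans (add_le_add_left (H μ hμ hμK) _)
    rw [← EReal.coe_add, EReal.coe_le_coe_iff] at this
    linarith
  · refine measurable_elogNorm.comp_aemeasurable ?_
    rw [hemb.aemeasurable_map_iff]
    exact (continuousOn_iff_continuous_domRestrict.1 hg).measurable.aemeasurable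
  · refine ae_of_all _ fun z => ?_
    rw [elogNorm_le_coe, Real.exp_log (by positivity)]
    linarith
  · refine fun k => ae_of_all _ fun z => ?_
    refine Real.log_le_log (by positivity) ?_
    gcongr
    rw [div_le_one (by positivity)]
    linarith [(Nat.cast_nonneg k : (0:ℝ) ≤ k)]
  · refine ae_of_all _ fun z a ha => ?_
    rw [elogNorm_lt_coe] at ha
    have ht : Tendsto (fun k : ℕ => ‖g z‖ + 1 / ((k : ℝ) + 1)) atTop (𝓝 (‖g z‖ + 0)) :=
      tendsto_const_nhds.add tendsto_one_div_add_atTop_nhds_zero_nat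
    rw [add_zero] at ht
    filter_upwards [ht.eventually_lt_const ha] with k hk
    rwa [Real.log_lt_iff_lt_exp (by positivity)]
  · intro k
    rw [EReal.coe_le_coe_iff, add_zero]
    exact hεle _ (by positivity)

end Duality

/-! ### Exhaustion by compact sets -/

section Exhaustion

open Metric

/-- The standard exhaustion of an open subset of the plane by compact sets. -/
def planeExhaustion (G : Set ℂ) (m : ℕ) : Set ℂ :=
  {z | ‖z‖ ≤ m ∧ ∀ b ∉ G, 1 / ((m : ℝ) + 1) ≤ dist z b}

theorem planeExhaustion_subset (G : Set ℂ) (m : ℕ) : planeExhaustion G m ⊆ G := by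
  intro z hz
  by_contra h
  have := hz.2 z h
  rw [dist_self] at this
  have : (0 : ℝ) < 1 / ((m : ℝ) + 1) := by positivity
  linarith

theorem isCompact_planeExhaustion (G : Set ℂ) (m : ℕ) : IsCompact (planeExhaustion G m) := by
  refine (isCompact_closedBall (0 : ℂ) m).of_isClosed_subset ?_ fun z hz => by simpa using hz.1
  have : planeExhaustion G m = {z | ‖z‖ ≤ m} ∩ ⋂ b ∈ Gᶜ, {z | 1 / ((m : ℝ) + 1) ≤ dist z b} := by
    ext z; simp [planeExhaustion]
  rw [this]
  exact (isClosed_le continuous_norm continuous_const).inter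
    (isClosed_biInter fun b _ => isClosed_le continuous_const (continuous_id.dist continuous_const))

theorem eventually_subset_planeExhaustion {G K : Set ℂ} (hG : IsOpen G) (hK : IsCompact K)
    (hKG : K ⊆ G) : ∀ᶠ m in atTop, K ⊆ planeExhaustion G m := by
  obtain ⟨r, hr, hrG⟩ := exists_cthickening_subset hG hK hKG
  obtain ⟨R, hR⟩ := hK.isBounded.exists_norm_le
  have h1 : ∀ᶠ m : ℕ in atTop, R ≤ (m : ℝ) := tendsto_natCast_atTop_atTop.eventually_ge_atTop R
  have h2 : ∀ᶠ m : ℕ in atTop, 1 / ((m : ℝ) + 1) < r :=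
    tendsto_one_div_add_atTop_nhds_zero_nat.eventually_lt_const hr
  filter_upwards [h1, h2] with m hm1 hm2 z hz
  refine ⟨(hR z hz).trans hm1, fun b hb => ?_⟩
  by_contra hlt
  rw [not_le] at hlt
  exact hb (hrG (mem_cthickening_of_dist_le b z r K hz (by rw [dist_comm]; linarith)))

end Exhaustion

/-! ### Basic properties of representing measures -/

section RepresentingMeasure

open InnerProductSpace

theorem integrable_of_continuousOn_of_compl_eq_zero {μ : Measure ℂ} [IsFiniteMeasure μ]
    {K : Set ℂ} (hK : IsCompact K) (hμ : μ Kᶜ = 0) {v : ℂ → ℝ} (hv : ContinuousOn v K) :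
    Integrable v μ := by
  have h1 : IntegrableOn v K μ := hv.integrableOn_compact hK
  rwa [IntegrableOn, Measure.restrict_eq_self_of_ae_mem (by rwa [ae_iff])] at h1

theorem IsRepresentingMeasure.integrable {G : Set ℂ} {μ : Measure ℂ}
    (hμ : IsRepresentingMeasure G μ) {v : ℂ → ℝ} (hv : ContinuousOn v G) : Integrable v μ := by
  have := hμ.finite
  obtain ⟨K, hK, hKG, hK0⟩ := hμ.compact_support
  exact integrable_of_continuousOn_of_compl_eq_zero hK hK0 (hv.mono hKG)

theorem IsRepresentingMeasure.integral_const {G : Set ℂ} {μ : Measure ℂ}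
    (hμ : IsRepresentingMeasure G μ) (c : ℝ) : ∫ _, c ∂μ = c :=
  (hμ.eq_integral (fun _ => c) fun _ _ => by simp).symm

theorem IsRepresentingMeasure.ae_mem {G : Set ℂ} {μ : Measure ℂ}
    (hμ : IsRepresentingMeasure G μ) : ∀ᵐ z ∂μ, z ∈ G := by
  obtain ⟨K, hK, hKG, hK0⟩ := hμ.compact_support
  rw [ae_iff]
  exact measure_mono_null (fun z (hz : z ∉ G) hzK => hz (hKG hzK)) hK0

theorem harmonicOnNhd_log_norm {G : Set ℂ} (hGo : IsOpen G) {q : ℂ → ℂ}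
    (hq : DifferentiableOn ℂ q G) (hq0 : ∀ z ∈ G, q z ≠ 0) :
    HarmonicOnNhd (fun z => Real.log ‖q z‖) G := fun z hz =>
  (hq.analyticAt (hGo.mem_nhds hz)).harmonicAt_log_norm (hq0 z hz)

end RepresentingMeasure

/-! ### Equivalence of (1) and (3) -/

section ZeroSets

open Metric InnerProductSpace

variable {G : Set ℂ} {ι : Type*} {Λ : ι → ℂ} {M : ℂ → ℝ} {g : ℂ → ℂ}

theorem HasZeroSet.analyticOrderAt_ne_top (hg : HasZeroSet G Λ g)
    (hΛ : ∀ K : Set ℂ, IsCompact K → K ⊆ G → {n | Λ n ∈ K}.Finite) {z : ℂ} (hz : z ∈ G) :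
    analyticOrderAt g z ≠ ⊤ := by
  rw [hg.2 z hz]
  have : {n | Λ n = z}.Finite := hΛ {z} isCompact_singleton (by simpa using hz)
  exact this.encard_lt_top.ne

/-- The quotient q = f/g is zero-free, so log|q| is harmonic and integrates to log|q(0)|. This
produces the constant C - log|q(0)|. -/
theorem IsZeroSetFor.exists_eintegral_le (hGo : IsOpen G)
    (hMc : ContinuousOn M G) (hΛ : ∀ K : Set ℂ, IsCompact K → K ⊆ G → {n | Λ n ∈ K}.Finite)
    (hg : HasZeroSet G Λ g) (h : IsZeroSetFor G M Λ) :
    ∃ C : ℝ, ∀ μ : Measure ℂ, IsRepresentingMeasure G μ →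
      eintegral μ (fun z => elogNorm (g z)) ≤ ((∫ z, M z ∂μ + C : ℝ) : EReal) := by
  obtain ⟨f, ⟨hfd, C, hC⟩, hf⟩ := h
  obtain ⟨q, hq, hfq, hq0⟩ := exists_differentiableOn_eq_mul_ne_zero hGo hfd hg.1
    (fun z hz => hg.analyticOrderAt_ne_top hΛ hz) (fun z hz => by rw [hf.2 z hz, hg.2 z hz])
  have hq0' : ∀ z ∈ G, q z ≠ 0 := fun z hz => hq0 z hz (by rw [hf.2 z hz, hg.2 z hz])
  have hharm := harmonicOnNhd_log_norm hGo hq hq0'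
  refine ⟨C - Real.log ‖q 0‖, fun μ hμ => ?_⟩
  have hMi := hμ.integrable hMc
  have hqi := hμ.integrable hharm.continuousOn
  have := hμ.finite
  have hle : eintegral μ (fun z => elogNorm (g z)) ≤
      eintegral μ (fun z => ((M z + C - Real.log ‖q z‖ : ℝ) : EReal)) := by
    refine eintegral_mono_ae (hμ.ae_mem.mono fun z hz => ?_)
    have h1 := hC z hz
    rw [elogNorm_le_coe, hfq z hz, norm_mul] at h1
    have h2 : 0 < ‖q z‖ := norm_pos_iff.2 (hq0' z hz)
    rw [elogNorm_le_coe, Real.exp_sub, Real.exp_log h2, le_div_iff₀ h2, mul_comm]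
    exact h1
  refine hle.trans (le_of_eq ?_)
  rw [eintegral_coe (f := fun z => M z + C - Real.log ‖q z‖)
      ((hMi.add (integrable_const C)).sub hqi),
    integral_sub (f := fun z => M z + C) (hMi.add (integrable_const C)) hqi, integral_add hMi (integrable_const C),
    hμ.integral_const, ← hμ.eq_integral _ hharm, add_sub_assoc]

/-- Around every point there are small circles avoiding the zeros of a nonzero holomorphic
function. -/
theorem exists_sphere_ne_zero (hGo : IsOpen G) (hg : DifferentiableOn ℂ g G) {z₀ : ℂ}
    (hz₀ : z₀ ∈ G) (ht : analyticOrderAt g z₀ ≠ ⊤) :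
    ∃ r > 0, closedBall z₀ r ⊆ G ∧ ∀ z ∈ sphere z₀ r, g z ≠ 0 := by
  have hne : ∀ᶠ w in 𝓝[≠] z₀, g w ≠ 0 := by
    rcases (hg.analyticAt (hGo.mem_nhds hz₀)).eventually_eq_zero_or_eventually_ne_zero with h | h
    · exact absurd (analyticOrderAt_eq_top.2 h) ht
    · exact h
  obtain ⟨s, hs, hsub⟩ := Metric.mem_nhdsWithin_iff.1 hne
  obtain ⟨ρ, hρ, hρG⟩ := Metric.isOpen_iff.1 hGo z₀ hz₀
  have hm := lt_min hs hρ
  refine ⟨min s ρ / 2, by positivity,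
    (closedBall_subset_ball (by linarith [min_le_right s ρ])).trans hρG, fun z hz => ?_⟩
  refine hsub ⟨closedBall_subset_ball (by linarith [min_le_left s ρ])
    (sphere_subset_closedBall hz), ne_of_mem_sphere hz (by positivity)⟩

/-- Local bounds for holomorphic functions `E` from bounds for `g E`. -/
theorem exists_forall_norm_le_of_norm_mul_le (hGo : IsOpen G) (hg : DifferentiableOn ℂ g G)
    (hMc : ContinuousOn M G) {z₀ : ℂ} (hz₀ : z₀ ∈ G) (ht : analyticOrderAt g z₀ ≠ ⊤) :
    ∃ r > 0, closedBall z₀ r ⊆ G ∧ ∃ B : ℝ, ∀ E : ℂ → ℂ, DifferentiableOn ℂ E G →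
      (∀ z ∈ closedBall z₀ r, ‖g z‖ * ‖E z‖ ≤ Real.exp (M z)) →
      ∀ z ∈ ball z₀ r, ‖E z‖ ≤ B := by
  obtain ⟨r, hr, hrG, hne⟩ := exists_sphere_ne_zero hGo hg hz₀ ht
  have hSG : sphere z₀ r ⊆ G := sphere_subset_closedBall.trans hrG
  -- The function g does not vanish on the circle, so E is bounded there by exp M / |g|. The maximum
  -- principle carries the bound inside, across zeros of g.
  have hcont : ContinuousOn (fun z => Real.exp (M z) / ‖g z‖) (sphere z₀ r) :=
    (Real.continuous_exp.comp_continuousOn (hMc.mono hSG)).div (hg.continuousOn.mono hSG).norm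
      fun z hz => norm_ne_zero_iff.2 (hne z hz)
  obtain ⟨B, hB⟩ := (isCompact_sphere z₀ r).exists_bound_of_continuousOn hcont
  refine ⟨r, hr, hrG, B, fun E hE hbd z hz => ?_⟩
  refine Complex.norm_le_of_forall_mem_frontier_norm_le isBounded_ball
    (DifferentiableOn.diffContOnCl (by rw [closure_ball z₀ hr.ne']; exact hE.mono hrG))
    (fun w hw => ?_) (subset_closure hz)
  rw [frontier_ball z₀ hr.ne'] at hw
  refine le_trans ?_ ((le_abs_self _).trans (hB w hw))
  rw [le_div_iff₀ (norm_pos_iff.2 (hne w hw)), mul_comm]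
  exact hbd w (sphere_subset_closedBall hw)

/-- Duality on the sets of the exhaustion gives zero-free E m with |g E m| ≤ exp M there and |E m 0|
= exp(-C - 1). The fixed value at 0 prevents the limit e from vanishing identically, so e is
zero-free by Hurwitz's theorem and e g has the required properties. -/
theorem isZeroSetFor_of_exists_eintegral_le (hGo : IsOpen G) (hGs : IsSimplyConnected G)
    (hG0 : (0 : ℂ) ∈ G) (hMc : ContinuousOn M G)
    (hΛ : ∀ K : Set ℂ, IsCompact K → K ⊆ G → {n | Λ n ∈ K}.Finite)
    (hg : HasZeroSet G Λ g)
    (h : ∃ C : ℝ, ∀ μ : Measure ℂ, IsRepresentingMeasure G μ →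
      eintegral μ (fun z => elogNorm (g z)) ≤ ((∫ z, M z ∂μ + C : ℝ) : EReal)) :
    IsZeroSetFor G M Λ := by
  obtain ⟨C, hC⟩ := h
  have hex : ∀ m : ℕ, ∃ E : ℂ → ℂ, DifferentiableOn ℂ E G ∧ (∀ z ∈ G, E z ≠ 0) ∧
      ‖E 0‖ = Real.exp (-C - 1) ∧
      ∀ z ∈ planeExhaustion G m, ‖g z‖ * ‖E z‖ ≤ Real.exp (M z) := by
    intro m
    obtain ⟨h, hh, h0, hle⟩ := exists_harmonicOnNhd_of_forall_eintegral_le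
      (isCompact_planeExhaustion G m) (planeExhaustion_subset G m)
      (hg.1.continuousOn.mono (planeExhaustion_subset G m))
      (hMc.mono (planeExhaustion_subset G m)) fun μ hμ _ => hC μ hμ
    obtain ⟨H, hH, hHre⟩ := exists_differentiableOn_re_eq hGo hGs hh
    refine ⟨fun z => Complex.exp (H z), hH.cexp, fun z _ => Complex.exp_ne_zero _, ?_, ?_⟩
    · rw [Complex.norm_exp, hHre 0 hG0, h0]
    · intro z hz
      rw [Complex.norm_exp, hHre z (planeExhaustion_subset G m hz)]
      exact (hle z hz).le
  choose E hEd hE0 hEz hEle using hex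
  obtain ⟨e, he⟩ := exists_tendstoLocallyUniformlyOn_hyperfilter hGo hEd fun z hz => by
    obtain ⟨r, hr, hrG, B, hB⟩ := exists_forall_norm_le_of_norm_mul_le hGo hg.1 hMc hz
      (hg.analyticOrderAt_ne_top hΛ hz)
    refine ⟨r, hr, B, ?_⟩
    filter_upwards [eventually_subset_planeExhaustion hGo (isCompact_closedBall z r) hrG] with m hm
    exact hB (E m) (hEd m) fun w hw => hEle m w (hm hw)
  have hez : e 0 ≠ 0 := by
    have h1 : Tendsto (fun m => ‖E m 0‖) (hyperfilter ℕ : Filter ℕ) (𝓝 ‖e 0‖) :=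
      (he.tendsto_at hG0).norm
    simp only [hEz] at h1
    have h2 := tendsto_nhds_unique h1 tendsto_const_nhds
    exact norm_ne_zero_iff.1 (by rw [h2]; positivity)
  -- Hurwitz's theorem for the empty family: e has no zeros.
  have hez' : HasZeroSet G (Empty.elim : Empty → ℂ) e := by
    refine hasZeroSet_of_tendstoLocallyUniformlyOn hGo hGs.isPathConnected.isConnected.isPreconnected
      (fun _ _ _ => Set.toFinite _) hEd he (fun K _ hKG => Eventually.of_forall fun m z hz => ?_)
      ⟨0, hG0, hez⟩
    rw [((hEd m).analyticAt (hGo.mem_nhds (hKG hz))).analyticOrderAt_eq_zero.2 (hE0 m z (hKG hz))]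
    simp [Set.eq_empty_of_isEmpty]
  have hfd : DifferentiableOn ℂ (fun z => e z * g z) G := hez'.1.mul hg.1
  refine ⟨fun z => e z * g z, ⟨hfd, 0, fun z hz => ?_⟩, hfd, fun z hz => ?_⟩
  · rw [elogNorm_le_coe, norm_mul, add_zero, mul_comm]
    have h1 : Tendsto (fun m => ‖g z‖ * ‖E m z‖) (hyperfilter ℕ : Filter ℕ) (𝓝 (‖g z‖ * ‖e z‖)) :=
      ((he.tendsto_at hz).norm).const_mul _
    refine le_of_tendsto h1 (Nat.hyperfilter_le_atTop ?_)
    filter_upwards [eventually_subset_planeExhaustion hGo (isCompact_singleton (x := z))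
      (by simpa using hz)] with m hm
    exact hEle m z (hm rfl)
  · rw [analyticOrderAt_eq_add_of_eq_mul hGo hg.1 hez'.1 (fun _ _ => rfl) hz, hg.2 z hz,
      hez'.2 z hz]
    simp [Set.eq_empty_of_isEmpty]

end ZeroSets

/-! ### The distributional Laplacian of log |f| -/

section ZeroCounting

open Metric InnerProductSpace Real

/-- By the mean value property the circle Laplacians vanish on the support of φ for small radii. -/
theorem integral_harmonic_mul_laplacian {G : Set ℂ} (hG : IsOpen G) {h : ℂ → ℝ}
    (hh : HarmonicOnNhd h G) {φ : ℂ → ℝ} (hφ : ContDiff ℝ 2 φ) (hc : HasCompactSupport φ)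
    (hφG : tsupport φ ⊆ G) : ∫ z, h z * Laplacian.laplacian φ z = 0 := by
  obtain ⟨r₀, hr₀, hr₀G⟩ := exists_cthickening_subset hG hc.isCompact hφG
  have hcomp : IsCompact (cthickening r₀ (tsupport φ)) := hc.isCompact.cthickening
  set u := (cthickening r₀ (tsupport φ)).indicator h with hu
  have hui : Integrable u := ((hh.continuousOn.mono hr₀G).integrableOn_compact hcomp).integrable_indicator
    hcomp.isClosed.measurableSet
  have e : ∫ z, h z * Laplacian.laplacian φ z = ∫ z, u z * Laplacian.laplacian φ z := by
    congr 1; ext z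
    by_cases hz : z ∈ tsupport φ
    · rw [hu, indicator_of_mem (self_subset_cthickening _ hz)]
    · simp [laplacian_eq_zero_of_notMem_tsupport hz]
  rw [e]
  refine tendsto_nhds_unique (tendsto_integral_circleLaplacian_mul hui.locallyIntegrable hφ hc)
    (tendsto_const_nhds.congr' ?_)
  filter_upwards [Ioo_mem_nhdsGT hr₀] with r hr
  symm
  refine integral_eq_zero_of_ae (ae_of_all _ fun z => ?_)
  by_cases hz : z ∈ tsupport φ
  · have hsub : closedBall z r ⊆ cthickening r₀ (tsupport φ) :=
      (closedBall_subset_closedBall hr.2.le).trans (closedBall_subset_cthickening hz r₀)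
    have h1 : circleAverage u z r = circleAverage h z r := by
      refine circleAverage_congr_sphere fun w hw => ?_
      rw [abs_of_pos hr.1] at hw
      rw [hu, indicator_of_mem (hsub (sphere_subset_closedBall hw))]
    have h2 : circleAverage h z r = h z :=
      InnerProductSpace.HarmonicOnNhd.circleAverage_eq (by
        rw [abs_of_pos hr.1]; exact hh.mono (hsub.trans hr₀G))
    have h3 : u z = h z := indicator_of_mem (self_subset_cthickening _ hz) h
    simp [circleLaplacian, h1, h2, h3]
  · simp [image_eq_zero_of_notMem_tsupport hz]

theorem analyticOrderAt_prod_sub {ι : Type*} (s : Finset ι) (Λ : ι → ℂ) (z : ℂ) :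
    analyticOrderAt (fun w => ∏ n ∈ s, (w - Λ n)) z = {n | n ∈ s ∧ Λ n = z}.encard := by
  classical
  induction s using Finset.induction_on with
  | empty =>
    have : AnalyticAt ℂ (fun _ : ℂ => (1 : ℂ)) z := analyticAt_const
    simp [this.analyticOrderAt_eq_zero.2]
  | insert a s ha ih =>
    have hprod : AnalyticAt ℂ (fun w => ∏ n ∈ s, (w - Λ n)) z :=
      (DifferentiableOn.analyticAt (s := univ) (by fun_prop) univ_mem)
    have hlin : AnalyticAt ℂ (fun w => w - Λ a) z := by fun_prop
    have e : (fun w => ∏ n ∈ insert a s, (w - Λ n)) =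
        (fun w => w - Λ a) * fun w => ∏ n ∈ s, (w - Λ n) := by
      ext w; simp [Finset.prod_insert ha]
    rw [e, analyticOrderAt_mul hlin hprod, ih]
    have h1 := analyticOrderAt_sub_pow (Λ a) z 1
    simp only [pow_one, Nat.cast_one] at h1
    rw [h1]
    split_ifs with h
    · have : {n | n ∈ insert a s ∧ Λ n = z} = insert a {n | n ∈ s ∧ Λ n = z} := by
        ext n
        simp only [Finset.mem_insert, mem_ofPred_eq, mem_insert_iff]
        constructor
        · rintro ⟨rfl | hn, hz⟩
          · exact Or.inl rfl
          · exact Or.inr ⟨hn, hz⟩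
        · rintro (rfl | ⟨hn, hz⟩)
          · exact ⟨Or.inl rfl, h.symm⟩
          · exact ⟨Or.inr hn, hz⟩
      rw [this, encard_insert_of_notMem (by simp [ha]), add_comm]
    · have : {n | n ∈ insert a s ∧ Λ n = z} = {n | n ∈ s ∧ Λ n = z} := by
        ext n
        simp only [Finset.mem_insert, mem_ofPred_eq]
        constructor
        · rintro ⟨rfl | hn, hz⟩
          · exact absurd hz.symm h
          · exact ⟨hn, hz⟩
        · rintro ⟨hn, hz⟩
          exact ⟨Or.inr hn, hz⟩
      rw [this, zero_add]

variable {G : Set ℂ} {ι : Type*} {Λ : ι → ℂ} {f : ℂ → ℂ}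

/-- A holomorphic function is, near a compact set, the product of a polynomial and a function
without zeros there. -/
theorem HasZeroSet.exists_eq_mul_prod (hGo : IsOpen G) (hf : HasZeroSet G Λ f) {K : Set ℂ}
    {s : Finset ι} (hs : ∀ n, n ∈ s ↔ Λ n ∈ K) :
    ∃ q : ℂ → ℂ, DifferentiableOn ℂ q G ∧ (∀ z ∈ G, f z = q z * ∏ n ∈ s, (z - Λ n)) ∧
      ∀ z ∈ G, z ∈ K → q z ≠ 0 := by
  have hfin : ∀ z, {n | n ∈ s ∧ Λ n = z}.Finite := fun z =>
    s.finite_toSet.subset fun n hn => hn.1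
  obtain ⟨q, hq, hfq, hq0⟩ := exists_differentiableOn_eq_mul_ne_zero hGo hf.1
    (g := fun z => ∏ n ∈ s, (z - Λ n)) (by fun_prop)
    (fun z _ => by rw [analyticOrderAt_prod_sub]; exact (hfin z).encard_lt_top.ne)
    (fun z hz => by
      rw [analyticOrderAt_prod_sub, hf.2 z hz]
      exact encard_le_encard fun n hn => hn.2)
  refine ⟨q, hq, hfq, fun z hz hzK => hq0 z hz ?_⟩
  rw [analyticOrderAt_prod_sub, hf.2 z hz]
  congr 1
  ext n
  simp only [mem_ofPred_eq, hs, and_iff_right_iff_imp]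
  rintro rfl
  exact hzK

/-- Near the support of φ, f is a zero-free factor with harmonic log-modulus times finitely many
linear factors, and each of these contributes a fundamental solution. -/
theorem HasZeroSet.integral_log_norm_mul_laplacian (hGo : IsOpen G) (hf : HasZeroSet G Λ f)
    {φ : ℂ → ℝ} (hφ : ContDiff ℝ 2 φ) (hc : HasCompactSupport φ) (hφG : tsupport φ ⊆ G)
    {s : Finset ι} (hs : ∀ n, n ∈ s ↔ Λ n ∈ tsupport φ) :
    Integrable (fun z => log ‖f z‖ * Laplacian.laplacian φ z) ∧
      ∫ z, log ‖f z‖ * Laplacian.laplacian φ z = 2 * π * ∑ n ∈ s, φ (Λ n) := by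
  obtain ⟨q, hq, hfq, hq0⟩ := hf.exists_eq_mul_prod hGo hs
  -- q still vanishes at the points of Λ off the support of φ, so G is shrunk.
  set G' := G ∩ {z | q z ≠ 0}
  have hG'o : IsOpen G' := hq.continuousOn.isOpen_inter_preimage hGo isOpen_ne
  have hφG' : tsupport φ ⊆ G' := fun z hz => ⟨hφG hz, hq0 z (hφG hz) hz⟩
  have hharm : HarmonicOnNhd (fun z => log ‖q z‖) G' :=
    harmonicOnNhd_log_norm hG'o (hq.mono inter_subset_left) fun z hz => hz.2
  have hi1 : Integrable fun z => log ‖q z‖ * Laplacian.laplacian φ z :=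
    integrable_mul_laplacian hharm.continuousOn hφ hc hφG'
  have hi2 : ∀ n, Integrable fun z => log ‖z - Λ n‖ * Laplacian.laplacian φ z := fun n => by
    have hcs : HasCompactSupport (Laplacian.laplacian φ) :=
      hc.mono' fun z hz => by
        by_contra h; exact hz (laplacian_eq_zero_of_notMem_tsupport h)
    have := (locallyIntegrable_log_norm_sub (Λ n)).integrable_smul_left_of_hasCompactSupport
      (continuous_laplacian hφ) hcs
    simpa [mul_comm] using this
  have hae : (fun z => log ‖f z‖ * Laplacian.laplacian φ z) =ᵐ[volume]
      fun z => log ‖q z‖ * Laplacian.laplacian φ z +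
        ∑ n ∈ s, log ‖z - Λ n‖ * Laplacian.laplacian φ z := by
    have hne : ∀ᵐ z : ℂ, ∀ n ∈ s, z ≠ Λ n := by
      rw [Finset.eventually_all]
      exact fun n _ => by simp [ae_iff]
    filter_upwards [hne] with z hz
    by_cases hzφ : z ∈ tsupport φ
    · rw [hfq z (hφG hzφ), norm_mul, log_mul (norm_ne_zero_iff.2 (hq0 z (hφG hzφ) hzφ)), norm_prod,
        log_prod, add_mul, Finset.sum_mul]
      · exact fun n hn => norm_ne_zero_iff.2 (sub_ne_zero.2 (hz n hn))
      · rw [norm_ne_zero_iff, Finset.prod_ne_zero_iff]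
        exact fun n hn => sub_ne_zero.2 (hz n hn)
    · simp [laplacian_eq_zero_of_notMem_tsupport hzφ]
  have hsum : Integrable fun z => ∑ n ∈ s, log ‖z - Λ n‖ * Laplacian.laplacian φ z :=
    integrable_finsetSum _ fun n _ => hi2 n
  refine ⟨(hi1.add hsum).congr hae.symm, ?_⟩
  rw [integral_congr_ae hae, integral_add hi1 hsum,
    integral_harmonic_mul_laplacian hG'o hharm hφ hc hφG', integral_finsetSum _ fun n _ => hi2 n,
    zero_add, Finset.mul_sum]
  exact Finset.sum_congr rfl fun n _ => integral_log_norm_sub_mul_laplacian hφ hc (Λ n)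

end ZeroCounting

/-! ### The Riesz measure near the origin -/

section RieszMeasureNearPoint

open Metric Real

variable {G : Set ℂ} {M : ℂ → ℝ} {ν : Measure ℂ}

theorem integrable_mollifier_mul_of_continuousOn {ε : ℝ} (hε : 0 < ε)
    (hM : ContinuousOn M (closedBall 0 ε)) : Integrable fun z => mollifier ε z * M z := by
  have h1 : IntegrableOn (fun z => mollifier ε z * M z) (closedBall 0 ε) :=
    ((continuous_mollifier ε).continuousOn.mul hM).integrableOn_compact (isCompact_closedBall 0 ε)
  refine (integrableOn_iff_integrable_of_support_subset fun z hz => ?_).1 h1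
  by_contra h
  refine hz ?_
  simp only [mem_closedBall, dist_zero_right, not_le] at h
  simp [mollifier_eq_zero hε h.le]

theorem tendsto_integral_mollifier_mul (hG : IsOpen G) (h0 : (0 : ℂ) ∈ G) (hM : ContinuousOn M G) :
    Tendsto (fun ε => ∫ z, mollifier ε z * M z) (𝓝[>] 0) (𝓝 (M 0)) := by
  rw [Metric.tendsto_nhds]
  intro η hη
  have hc : ContinuousAt M 0 := hM.continuousAt (hG.mem_nhds h0)
  obtain ⟨d, hd, hdM⟩ := Metric.continuousAt_iff.1 hc (η / 2) (half_pos hη)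
  obtain ⟨ρ, hρ, hρG⟩ := Metric.isOpen_iff.1 hG 0 h0
  filter_upwards [Ioo_mem_nhdsGT (lt_min hd hρ)] with ε hε
  have hεd : ε < d := hε.2.trans_le (min_le_left _ _)
  have hεG : closedBall (0 : ℂ) ε ⊆ G :=
    (closedBall_subset_ball (hε.2.trans_le (min_le_right _ _))).trans hρG
  have := abs_integral_mul_sub_le (integrable_mollifier hε.1) (mollifier_nonneg ε)
    (integral_mollifier hε.1) (fun z => mollifier_eq_zero hε.1)
    (integrable_mollifier_mul_of_continuousOn hε.1 (hM.mono hεG)) (a := M 0) (η := η / 2)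
    fun z hz => (hdM (by rw [dist_zero_right]; exact hz.trans hεd)).le
  rw [Real.dist_eq]
  linarith

theorem smoothLog_le_log_max {ε : ℝ} (hε : 0 < ε) (z : ℂ) : smoothLog ε z ≤ log (max ε ‖z‖) := by
  rcases le_total ε ‖z‖ with h | h
  · rw [smoothLog_eq_log hε h, max_eq_right h]
  · rw [max_eq_left h]; exact smoothLog_le_log hε h

/-- Both functions equal log ‖·‖ off the disc of radius s, so their difference is a test function.
Its Laplacian is 2π times the difference of the mollifiers. -/
theorem integral_smoothLog_sub (hν : IsRieszMeasure G M ν) (hM : ContinuousOn M G) {s ε : ℝ}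
    (hε : 0 < ε) (hεs : ε ≤ s) (hs : closedBall 0 s ⊆ G) :
    ∫ z, (smoothLog s z - smoothLog ε z) ∂ν =
      (∫ z, mollifier s z * M z) - ∫ z, mollifier ε z * M z := by
  have hs0 : 0 < s := hε.trans_le hεs
  have hz : ∀ z : ℂ, s ≤ ‖z‖ → smoothLog s z - smoothLog ε z = 0 := fun z hz => by
    rw [smoothLog_eq_log hs0 hz, smoothLog_eq_log hε (hεs.trans hz), sub_self]
  have hsm : ContDiff ℝ ∞ fun z => smoothLog s z - smoothLog ε z :=
    (contDiff_smoothLog hs0).sub (contDiff_smoothLog hε)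
  have hsub : tsupport (fun z => smoothLog s z - smoothLog ε z) ⊆ closedBall 0 s := by
    refine closure_minimal (fun z hzs => ?_) isClosed_closedBall
    by_contra h
    simp only [mem_closedBall, dist_zero_right, not_le] at h
    exact hzs (hz z h.le)
  rw [hν.integral_eq _ hsm (hasCompactSupport_of_eq_zero hz) (hsub.trans hs),
    ← integral_sub (integrable_mollifier_mul_of_continuousOn hs0 (hM.mono hs))
      (integrable_mollifier_mul_of_continuousOn hε
        (hM.mono ((closedBall_subset_closedBall hεs).trans hs))), ← integral_const_mul]
  congr 1; ext z
  have hl : Laplacian.laplacian (fun z => smoothLog s z - smoothLog ε z) z =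
      2 * π * mollifier s z - 2 * π * mollifier ε z := by
    have := ((contDiff_smoothLog hs0).two_of_infty.contDiffAt (x := z)).laplacian_sub
      ((contDiff_smoothLog hε).two_of_infty.contDiffAt (x := z))
    rw [laplacian_smoothLog hs0, laplacian_smoothLog hε] at this
    exact this
  rw [hl]
  field_simp

theorem IsRieszMeasure.integrableOn_of_continuousOn (hν : IsRieszMeasure G M ν) {K : Set ℂ}
    (hK : IsCompact K) (hKG : K ⊆ G) {v : ℂ → ℝ} (hv : ContinuousOn v K) : IntegrableOn v K ν := by
  have : IsFiniteMeasure (ν.restrict K) := ⟨by simpa using hν.lt_top K hK hKG⟩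
  refine integrable_of_continuousOn_of_compl_eq_zero hK ?_ hv
  rw [Measure.restrict_apply hK.measurableSet.compl, compl_inter_self, measure_empty]

/-- As ε → 0, the right-hand side of `integral_smoothLog_sub` stays finite because M is continuous
at 0, and Fatou's lemma bounds the ν-integral of the limit. The summand c + log s makes the
integrand nonnegative, and ⊤ stands for -log 0. -/
theorem IsRieszMeasure.lintegral_log_ne_top (hG : IsOpen G) (h0 : (0 : ℂ) ∈ G)
    (hν : IsRieszMeasure G M ν) (hM : ContinuousOn M G) {s : ℝ} (hs0 : 0 < s)
    (hs : closedBall 0 s ⊆ G) : ∃ c : ℝ, (∀ z ∈ closedBall (0 : ℂ) s, |smoothLog s z| ≤ c) ∧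
      ∫⁻ z in closedBall 0 s, (if z = 0 then ⊤ else
        ENNReal.ofReal (smoothLog s z - log ‖z‖ + (c + log s))) ∂ν ≠ ⊤ := by
  obtain ⟨c, hc⟩ := (isCompact_closedBall (0 : ℂ) s).exists_bound_of_continuousOn
    (contDiff_smoothLog hs0).continuous.continuousOn
  refine ⟨c, hc, ?_⟩
  set B := closedBall (0 : ℂ) s
  have hνB : ν B < ⊤ := hν.lt_top B (isCompact_closedBall 0 s) hs
  have : IsFiniteMeasure (ν.restrict B) := ⟨by simpa using hνB⟩
  set ε : ℕ → ℝ := fun k => s / ((k : ℝ) + 1)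
  have hε : ∀ k, 0 < ε k := fun k => by positivity
  have hεs : ∀ k, ε k ≤ s := fun k => div_le_self hs0.le (by linarith [(Nat.cast_nonneg k : (0:ℝ) ≤ k)])
  have hεt : Tendsto ε atTop (𝓝 0) := by
    have := tendsto_one_div_add_atTop_nhds_zero_nat (𝕜 := ℝ) |>.const_mul s
    rw [mul_zero] at this
    refine this.congr fun k => ?_
    simp only [ε]; ring
  have hεt' : Tendsto ε atTop (𝓝[>] 0) := tendsto_nhdsWithin_iff.2 ⟨hεt, Eventually.of_forall hε⟩
  set ψ : ℕ → ℂ → ℝ := fun k z => smoothLog s z - smoothLog (ε k) z + (c + log s)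
  have hψc : ∀ k, Continuous (ψ k) := fun k =>
    ((contDiff_smoothLog hs0).continuous.sub (contDiff_smoothLog (hε k)).continuous).add
      continuous_const
  have hψ0 : ∀ k, ∀ z ∈ B, 0 ≤ ψ k z := fun k z hz => by
    have h1 := (abs_le.1 (hc z hz)).1
    have h2 := smoothLog_le_log_max (hε k) z
    have h3 : log (max (ε k) ‖z‖) ≤ log s :=
      log_le_log (lt_max_of_lt_left (hε k)) (max_le (hεs k) (by simpa [B] using hz))
    simp only [ψ]
    linarith
  have hψi : ∀ k, Integrable (ψ k) (ν.restrict B) := fun k =>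
    hν.integrableOn_of_continuousOn (isCompact_closedBall 0 s) hs (hψc k).continuousOn
  have hdi : ∀ k, Integrable (fun z => smoothLog s z - smoothLog (ε k) z) (ν.restrict B) := fun k => by
    exact hν.integrableOn_of_continuousOn (isCompact_closedBall 0 s) hs
      ((contDiff_smoothLog hs0).continuous.sub (contDiff_smoothLog (hε k)).continuous).continuousOn
  have hval : ∀ k, ∫ z in B, ψ k z ∂ν = (∫ z, mollifier s z * M z) -
      (∫ z, mollifier (ε k) z * M z) + (c + log s) * (ν B).toReal := fun k => by
    rw [← integral_smoothLog_sub hν hM (hε k) (hεs k) hs, integral_add (hdi k) (integrable_const _),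
      setIntegral_eq_integral_of_forall_compl_eq_zero]
    · simp [mul_comm, measureReal_def]
    · intro z hz
      simp only [B, mem_closedBall, dist_zero_right, not_le] at hz
      rw [smoothLog_eq_log hs0 hz.le, smoothLog_eq_log (hε k) ((hεs k).trans hz.le), sub_self]
  have hlim : Tendsto (fun k => ENNReal.ofReal (∫ z in B, ψ k z ∂ν)) atTop
      (𝓝 (ENNReal.ofReal ((∫ z, mollifier s z * M z) - M 0 + (c + log s) * (ν B).toReal))) := by
    simp only [hval]
    exact ENNReal.tendsto_ofReal ((tendsto_const_nhds.sub
      ((tendsto_integral_mollifier_mul hG h0 hM).comp hεt')).add tendsto_const_nhds)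
  have hpt : ∀ z, Tendsto (fun k => ENNReal.ofReal (ψ k z)) atTop (𝓝 (if z = 0 then ⊤ else
        ENNReal.ofReal (smoothLog s z - log ‖z‖ + (c + log s)))) := by
    intro z
    split_ifs with hz
    · subst hz
      refine ENNReal.tendsto_ofReal_nhds_top.2 ?_
      have h1 : Tendsto (fun k => -log (ε k) + (smoothLog s 0 + (c + log s))) atTop atTop :=
        tendsto_atTop_add_const_right _ _ (tendsto_neg_atBot_atTop.comp
          (tendsto_log_nhdsGT_zero.comp hεt'))
      refine tendsto_atTop_mono (fun k => ?_) h1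
      have := smoothLog_le_log (hε k) (z := 0) (by simpa using (hε k).le)
      simp only [ψ]
      linarith
    · refine tendsto_const_nhds.congr' ?_
      filter_upwards [hεt.eventually_lt_const (norm_pos_iff.2 hz)] with k hk
      simp only [ψ, smoothLog_eq_log (hε k) hk.le]
  have hfatou := lintegral_liminf_le (μ := ν.restrict B) (u := atTop)
    (f := fun k z => ENNReal.ofReal (ψ k z))
    fun k => (hψc k).measurable.ennreal_ofReal
  simp only [(hpt _).liminf_eq] at hfatou
  have e : ∀ k, ∫⁻ z in B, ENNReal.ofReal (ψ k z) ∂ν = ENNReal.ofReal (∫ z in B, ψ k z ∂ν) := fun k =>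
    (ofReal_integral_eq_lintegral_ofReal (hψi k)
      ((ae_restrict_iff' isClosed_closedBall.measurableSet).2 (ae_of_all _ (hψ0 k)))).symm
  simp only [e, hlim.liminf_eq] at hfatou
  exact (hfatou.trans_lt ENNReal.ofReal_lt_top).ne

/-- An atom at 0 would make the preceding integral infinite. Consequently removing the origin from G
does not change ν. -/
theorem IsRieszMeasure.singleton_zero (hG : IsOpen G) (h0 : (0 : ℂ) ∈ G)
    (hν : IsRieszMeasure G M ν) (hM : ContinuousOn M G) : ν {0} = 0 := by
  obtain ⟨s, hs0, hs⟩ := Metric.nhds_basis_closedBall.mem_iff.1 (hG.mem_nhds h0)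
  obtain ⟨c, hc, hfin⟩ := hν.lintegral_log_ne_top hG h0 hM hs0 hs
  by_contra hne
  refine hfin (top_le_iff.1 ?_)
  have hmem : {(0 : ℂ)} ⊆ closedBall 0 s := by simpa using hs0.le
  calc (⊤ : ENNReal) = ∫⁻ z in {(0 : ℂ)}, ⊤ ∂ν := by
        rw [setLIntegral_const, ENNReal.top_mul hne]
    _ = ∫⁻ z in {(0 : ℂ)}, (if z = 0 then ⊤ else
        ENNReal.ofReal (smoothLog s z - log ‖z‖ + (c + log s))) ∂ν :=
        setLIntegral_congr_fun (measurableSet_singleton 0) fun z hz => by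
          simp [mem_singleton_iff.1 hz]
    _ ≤ _ := lintegral_mono_set hmem

theorem IsRieszMeasure.integrableOn_log_norm (hG : IsOpen G) (h0 : (0 : ℂ) ∈ G)
    (hν : IsRieszMeasure G M ν) (hM : ContinuousOn M G) {s : ℝ} (hs0 : 0 < s)
    (hs : closedBall 0 s ⊆ G) : IntegrableOn (fun z => log ‖z‖) (closedBall 0 s) ν := by
  obtain ⟨c, hc, hfin⟩ := hν.lintegral_log_ne_top hG h0 hM hs0 hs
  set B := closedBall (0 : ℂ) s
  have hνB : ν B < ⊤ := hν.lt_top B (isCompact_closedBall 0 s) hs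
  have : IsFiniteMeasure (ν.restrict B) := ⟨by simpa using hνB⟩
  have hsi : Integrable (fun z => smoothLog s z + (c + log s)) (ν.restrict B) :=
    hν.integrableOn_of_continuousOn (isCompact_closedBall 0 s) hs
      ((contDiff_smoothLog hs0).continuous.add continuous_const).continuousOn
  have hne : ∀ᵐ z ∂(ν.restrict B), z ≠ 0 := by
    rw [ae_iff]
    simp only [ne_eq, not_not]
    exact le_antisymm ((Measure.restrict_apply_le _ _).trans
      (le_of_eq (hν.singleton_zero hG h0 hM))) bot_le
  have hBm : ∀ᵐ z ∂(ν.restrict B), z ∈ B := ae_restrict_mem isClosed_closedBall.measurableSet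
  have hi : Integrable (fun z => smoothLog s z - log ‖z‖ + (c + log s)) (ν.restrict B) := by
    refine ⟨?_, ?_⟩
    · exact (((contDiff_smoothLog hs0).continuous.measurable.sub
        (measurable_norm.log)).add_const _).aestronglyMeasurable
    · rw [hasFiniteIntegral_iff_ofReal]
      · refine lt_of_le_of_lt (lintegral_mono_ae ?_) hfin.lt_top
        filter_upwards [hne] with z hz
        simp [hz]
      · filter_upwards [hne, hBm] with z hz hzB
        have h1 := (abs_le.1 (hc z hzB)).1
        have h3 : log ‖z‖ ≤ log s := log_le_log (norm_pos_iff.2 hz) (by simpa [B] using hzB)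
        simp only [Pi.zero_apply]
        linarith
  refine (hsi.sub hi).congr (ae_of_all _ fun z => ?_)
  simp only [Pi.sub_apply]
  ring

/-- Makes the majorants constant - 2 log ‖·‖ of truncated representing functions ν-integrable. -/
theorem IsRieszMeasure.integrableOn_log_norm_of_isCompact (hG : IsOpen G) (h0 : (0 : ℂ) ∈ G)
    (hν : IsRieszMeasure G M ν) (hM : ContinuousOn M G) {K : Set ℂ} (hK : IsCompact K)
    (hKG : K ⊆ G) : IntegrableOn (fun z => log ‖z‖) K ν := by
  obtain ⟨s, hs0, hs⟩ := Metric.nhds_basis_closedBall.mem_iff.1 (hG.mem_nhds h0)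
  have hK' : IsCompact (K \ ball 0 s) := hK.diff isOpen_ball
  have h1 : IntegrableOn (fun z => log ‖z‖) (K \ ball 0 s) ν := by
    have hc : ContinuousOn (fun z : ℂ => log ‖z‖) (K \ ball 0 s) :=
      continuous_norm.continuousOn.log fun z hz h => by
        refine hz.2 ?_
        rw [mem_ball, dist_zero_right, h]; exact hs0
    exact hν.integrableOn_of_continuousOn hK' (sdiff_subset.trans hKG) hc
  refine (h1.union (hν.integrableOn_log_norm hG h0 hM hs0 hs)).mono_set fun z hz => ?_
  by_cases h : z ∈ ball 0 s
  · exact Or.inr (ball_subset_closedBall h)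
  · exact Or.inl ⟨hz, h⟩

end RieszMeasureNearPoint

/-! ### The zero-counting inequality for test functions -/

section NecessaryInequality

open Metric InnerProductSpace Real

/-- The Laplacian of the regularization of a function which is subharmonic up to twice the
logarithmic pole at the origin. -/
theorem le_laplacian_mollify {v : ℂ → ℝ} (hv : LocallyIntegrable v) {r₀ : ℝ} (hr₀ : 0 < r₀)
    (h : ∀ z ≠ 0, ∀ r, 0 < r → r < r₀ → r ≠ ‖z‖ → v z - 2 * logKernel r z ≤ circleAverage v z r)
    {ε : ℝ} (hε : 0 < ε) (z : ℂ) :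
    -(4 * π) * mollifier ε z ≤ Laplacian.laplacian (mollify ε v) z := by
  have h1 := tendsto_circleLaplacian (contDiff_mollify hε hv).two_of_infty z
  have h2 := tendsto_circleLaplacian (contDiff_smoothLog hε).two_of_infty z
  rw [laplacian_smoothLog hε] at h2
  -- The hypothesis is the sub-mean value inequality for v + 2 log ‖·‖, so the mollification of this
  -- sum has nonnegative Laplacian.
  have h3 : 0 ≤ Laplacian.laplacian (mollify ε v) z + 2 * (2 * π * mollifier ε z) := by
    refine ge_of_tendsto (h1.add (h2.const_mul 2)) ?_
    filter_upwards [Ioo_mem_nhdsGT hr₀] with r hr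
    have hr0 := hr.1
    rw [smoothLog, circleLaplacian_mollify hε hv, circleLaplacian_mollify hε
      locallyIntegrable_log_norm, ← integral_const_mul, ← integral_add
      (integrable_mollifier_mul_circleLaplacian hε hv z r)
      ((integrable_mollifier_mul_circleLaplacian hε locallyIntegrable_log_norm z r).const_mul 2)]
    refine integral_nonneg_of_ae ?_
    have hne : ∀ᵐ t : ℂ, t ≠ z := by simp [ae_iff]
    -- The excluded radius, for which the circle passes through the pole, occurs only for t on a
    -- circle.
    have hsph : ∀ᵐ t : ℂ, r ≠ ‖z - t‖ := by
      rw [ae_iff]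
      refine measure_mono_null (fun t ht => ?_) (Measure.addHaar_sphere volume z r)
      rw [mem_sphere_iff_norm, norm_sub_rev]
      exact (not_not.1 ht).symm
    filter_upwards [hne, hsph] with t ht hts
    have htz : z - t ≠ 0 := sub_ne_zero.2 ht.symm
    have e := circleLaplacian_log_norm_sub hr0 htz
    simp only [sub_zero] at e
    have h4 := h (z - t) htz r hr.1 hr.2 hts
    have h5 : 0 ≤ circleLaplacian v r (z - t) + 2 * (4 / r ^ 2 * logKernel r (z - t)) := by
      rw [circleLaplacian]
      have : 0 ≤ 4 / r ^ 2 * (circleAverage v (z - t) r - v (z - t) + 2 * logKernel r (z - t)) :=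
        mul_nonneg (by positivity) (by linarith)
      linarith
    simp only [Pi.zero_apply]
    rw [e]
    have := mul_nonneg (mollifier_nonneg ε t) h5
    linarith
  linarith

variable {G : Set ℂ} {M : ℂ → ℝ} {ν : Measure ℂ} {ι : Type*} {Λ : ι → ℂ} {f : ℂ → ℂ}

/-- Summation over the zeros against integration with respect to the mass distribution. -/
theorem HasZeroSet.sum_le_integral_add (hG : IsOpen G) (hM : ContinuousOn M G)
    (hν : IsRieszMeasure G M ν) (hf : HasZeroSet G Λ f) {C : ℝ}
    (hC : ∀ z ∈ G, elogNorm (f z) ≤ ((M z + C : ℝ) : EReal))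
    {φ : ℂ → ℝ} (hφ : ContDiff ℝ ∞ φ) (hc : HasCompactSupport φ) (hφG : tsupport φ ⊆ G)
    {s : Finset ι} (hs : ∀ n, n ∈ s ↔ Λ n ∈ tsupport φ) {ε : ℝ} (hε : 0 < ε)
    (hεG : closedBall 0 ε ⊆ G) (hf0 : ∀ z ∈ closedBall (0 : ℂ) ε, f z ≠ 0)
    (hΔ : ∀ z, -(4 * π) * mollifier ε z ≤ Laplacian.laplacian φ z) :
    ∑ n ∈ s, φ (Λ n) ≤
      ∫ z, φ z ∂ν + 2 * ∫ z, mollifier ε z * (M z + C - log ‖f z‖) := by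
  have hφ2 := hφ.two_of_infty
  obtain ⟨hi1, he1⟩ := hf.integral_log_norm_mul_laplacian hG hφ2 hc hφG hs
  have hi2 := integrable_mul_laplacian hM hφ2 hc hφG
  have hharm : HarmonicOnNhd (fun _ : ℂ => C) G := fun _ _ => by simp
  have hi3 := integrable_mul_laplacian hharm.continuousOn hφ2 hc hφG
  have he3 := integral_harmonic_mul_laplacian hG hharm hφ2 hc hφG
  have he2 := hν.integral_eq φ hφ hc hφG
  have hWc : ContinuousOn (fun z => M z + C - log ‖f z‖) (closedBall 0 ε) :=
    ((hM.mono hεG).add continuousOn_const).sub (((hf.1.continuousOn.mono hεG).norm).log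
      fun z hz => norm_ne_zero_iff.2 (hf0 z hz))
  have hi4 := integrable_mollifier_mul_of_continuousOn hε hWc
  -- This is ∫ W (Δφ + 4πρ_ε) ≥ 0 expanded, with W = M + C - log|f| and ρ_ε the mollifier. The four
  -- terms become 2π ∫ φ dν, 0, -2π Σ φ(λ) and 4π ∫ ρ_ε W.
  have hnn : 0 ≤ ∫ z, ((M z * Laplacian.laplacian φ z + C * Laplacian.laplacian φ z -
      log ‖f z‖ * Laplacian.laplacian φ z) +
        4 * π * (mollifier ε z * (M z + C - log ‖f z‖))) := by
    refine integral_nonneg_of_ae ?_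
    -- At a zero of f the convention `log 0 = 0` could make W negative; finitely many zeros in the
    -- support of φ are discarded.
    have hne : ∀ᵐ z : ℂ, ∀ n ∈ s, z ≠ Λ n := by
      rw [Finset.eventually_all]
      exact fun n _ => by simp [ae_iff]
    filter_upwards [hne] with z hz
    have e : (M z * Laplacian.laplacian φ z + C * Laplacian.laplacian φ z -
      log ‖f z‖ * Laplacian.laplacian φ z) + 4 * π * (mollifier ε z * (M z + C - log ‖f z‖)) =
      (M z + C - log ‖f z‖) * (Laplacian.laplacian φ z + 4 * π * mollifier ε z) := by ring
    rw [e]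
    have hpos : 0 ≤ Laplacian.laplacian φ z + 4 * π * mollifier ε z := by linarith [hΔ z]
    have hW : z ∈ G → f z ≠ 0 → 0 ≤ M z + C - log ‖f z‖ := fun hzG hfz => by
      have := hC z hzG
      rw [elogNorm_eq_log hfz, EReal.coe_le_coe_iff] at this
      linarith
    by_cases hzε : z ∈ closedBall (0 : ℂ) ε
    · exact mul_nonneg (hW (hεG hzε) (hf0 z hzε)) hpos
    · have hm : mollifier ε z = 0 :=
        mollifier_eq_zero hε (by simpa using hzε : ε < ‖z‖).le
      by_cases hzφ : z ∈ tsupport φ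
      · refine mul_nonneg (hW (hφG hzφ) fun hfz => ?_) hpos
        have h0 : analyticOrderAt f z ≠ 0 :=
          (hf.1.analyticAt (hG.mem_nhds (hφG hzφ))).analyticOrderAt_ne_zero.2 hfz
        rw [hf.2 z (hφG hzφ), Set.encard_ne_zero] at h0
        obtain ⟨n, hn⟩ := h0
        have hn' : Λ n = z := hn
        exact hz n ((hs n).2 (by rw [hn']; exact hzφ)) hn'.symm
      · simp [laplacian_eq_zero_of_notMem_tsupport hzφ, hm]
  rw [integral_add (f := fun z => M z * Laplacian.laplacian φ z + C * Laplacian.laplacian φ z -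
      log ‖f z‖ * Laplacian.laplacian φ z) (((hi2.add hi3).sub hi1)) (hi4.const_mul _),
    integral_sub (f := fun z => M z * Laplacian.laplacian φ z + C * Laplacian.laplacian φ z)
      (hi2.add hi3) hi1, integral_add hi2 hi3, he3, he1,
    integral_const_mul] at hnn
  have hπ : 0 < 2 * π := by positivity
  have e5 : ∫ z, M z * Laplacian.laplacian φ z = 2 * π * ∫ z, φ z ∂ν := by
    rw [he2]; field_simp
  rw [e5] at hnn
  have : 0 ≤ 2 * π * (∫ z, φ z ∂ν + 2 * (∫ z, mollifier ε z * (M z + C - log ‖f z‖)) -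
      ∑ n ∈ s, φ (Λ n)) := by linarith
  have := nonneg_of_mul_nonneg_right this hπ
  linarith

end NecessaryInequality

/-! ### Truncation of representing functions -/

section Truncation

open Metric Real

open Classical in
/-- The maximum of `V` and `-2 log |z| - A`, extended by zero. -/
noncomputable def logTruncation (G : Set ℂ) (V : ℂ → EReal) (A : ℝ) (z : ℂ) : ℝ :=
  if z ∈ G \ {0} then (max (V z) ((-2 * log ‖z‖ - A : ℝ) : EReal)).toReal else 0

variable {G : Set ℂ} {V : ℂ → EReal} {A : ℝ}

theorem coe_logTruncation (hV : SubharmonicOn V (G \ {0})) {z : ℂ} (hz : z ∈ G \ {0}) :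
    (logTruncation G V A z : EReal) = max (V z) ((-2 * log ‖z‖ - A : ℝ) : EReal) := by
  rw [logTruncation, if_pos hz, EReal.coe_toReal]
  · exact (max_lt (lt_top_iff_ne_top.2 (hV.ne_top z hz)) (EReal.coe_lt_top _)).ne
  · exact (lt_of_lt_of_le (EReal.bot_lt_coe _) (le_max_right _ _)).ne'

theorem logTruncation_lt_iff (hV : SubharmonicOn V (G \ {0})) {z : ℂ} (hz : z ∈ G \ {0}) {a : ℝ} :
    logTruncation G V A z < a ↔ V z < a ∧ -2 * log ‖z‖ - A < a := by
  rw [← EReal.coe_lt_coe_iff, coe_logTruncation hV hz, max_lt_iff, EReal.coe_lt_coe_iff]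

theorem le_coe_logTruncation (hV : SubharmonicOn V (G \ {0})) {z : ℂ} (hz : z ∈ G \ {0}) :
    V z ≤ logTruncation G V A z := by
  rw [coe_logTruncation hV hz]; exact le_max_left _ _

theorem le_logTruncation (hV : SubharmonicOn V (G \ {0})) {z : ℂ} (hz : z ∈ G \ {0}) :
    -2 * log ‖z‖ - A ≤ logTruncation G V A z := by
  rw [← EReal.coe_le_coe_iff, coe_logTruncation hV hz]; exact le_max_right _ _

theorem logTruncation_of_notMem {z : ℂ} (hz : z ∉ G \ {0}) : logTruncation G V A z = 0 :=
  if_neg hz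

theorem logTruncation_anti (hV : SubharmonicOn V (G \ {0})) {A' : ℝ} (h : A ≤ A') (z : ℂ) :
    logTruncation G V A' z ≤ logTruncation G V A z := by
  by_cases hz : z ∈ G \ {0}
  · rw [← EReal.coe_le_coe_iff, coe_logTruncation hV hz, coe_logTruncation hV hz]
    exact max_le_max le_rfl (EReal.coe_le_coe_iff.2 (by linarith))
  · rw [logTruncation_of_notMem hz, logTruncation_of_notMem hz]

theorem upperSemicontinuousOn_logTruncation (hV : SubharmonicOn V (G \ {0})) :
    UpperSemicontinuousOn (logTruncation G V A) (G \ {0}) := by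
  intro z hz a ha
  rw [logTruncation_lt_iff hV hz] at ha
  have h1 := hV.usc z hz a ha.1
  have hz0 : ‖z‖ ≠ 0 := norm_ne_zero_iff.2 hz.2
  have hc : ContinuousAt (fun w : ℂ => -2 * log ‖w‖ - A) z :=
    (continuousAt_const.mul (continuous_norm.continuousAt.log hz0)).sub continuousAt_const
  filter_upwards [h1, nhdsWithin_le_nhds (hc.eventually_lt_const ha.2), self_mem_nhdsWithin]
    with w hw1 hw2 hw3
  exact (logTruncation_lt_iff hV hw3).2 ⟨hw1, hw2⟩

theorem isOpen_diff_singleton_zero (hG : IsOpen G) : IsOpen (G \ {0}) :=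
  hG.sdiff isClosed_singleton

theorem measurable_logTruncation (hG : IsOpen G) (hV : SubharmonicOn V (G \ {0})) :
    Measurable (logTruncation G V A) := by
  have hopen := isOpen_diff_singleton_zero hG
  refine measurable_of_Iio fun a => ?_
  have e : logTruncation G V A ⁻¹' Iio a =
      ((G \ {0}) ∩ logTruncation G V A ⁻¹' Iio a) ∪ ((G \ {0})ᶜ ∩ {_z | (0 : ℝ) < a}) := by
    ext z
    by_cases hz : z ∈ G \ {0}
    · simp [hz]
    · simp [hz, logTruncation_of_notMem hz]
  rw [e]
  refine MeasurableSet.union (IsOpen.measurableSet ?_)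
    (hopen.measurableSet.compl.inter (MeasurableSet.const _))
  rw [isOpen_iff_mem_nhds]
  intro z hz
  have := upperSemicontinuousOn_logTruncation hV z hz.1 a hz.2
  rw [hopen.nhdsWithin_eq hz.1] at this
  filter_upwards [this, hopen.mem_nhds hz.1] with w h1 h2
  exact ⟨h2, h1⟩

theorem exists_forall_abs_logTruncation_le (hV : SubharmonicOn V (G \ {0}))
    {K : Set ℂ} (hK : IsCompact K) (hKG : K ⊆ G \ {0}) :
    ∃ B : ℝ, ∀ z ∈ K, |logTruncation G V A z| ≤ B := by
  obtain ⟨B₁, hB₁⟩ := ((upperSemicontinuousOn_logTruncation (A := A) hV).mono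
    hKG).bddAbove_of_isCompact hK
  have hc : ContinuousOn (fun w : ℂ => -2 * log ‖w‖ - A) K :=
    (continuousOn_const.mul (continuous_norm.continuousOn.log
      fun z hz => norm_ne_zero_iff.2 (hKG hz).2)).sub continuousOn_const
  obtain ⟨B₂, hB₂⟩ := hK.exists_bound_of_continuousOn hc
  refine ⟨max B₁ B₂, fun z hz => abs_le.2 ⟨?_, ?_⟩⟩
  · have h1 := (abs_le.1 (hB₂ z hz)).1
    have h2 := le_logTruncation (A := A) hV (hKG hz)
    linarith [le_max_right B₁ B₂]
  · exact (hB₁ (mem_image_of_mem _ hz)).trans (le_max_left _ _)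

theorem circleIntegrable_neg_two_mul_log (c : ℂ) (r A : ℝ) :
    CircleIntegrable (fun z : ℂ => -2 * log ‖z‖ - A) c r := by
  have hlogi : CircleIntegrable (fun z : ℂ => log ‖z‖) c r := by
    simpa using circleIntegrable_log_norm_sub_const (a := 0) (c := c) r
  exact (hlogi.const_fun_smul (a := (-2 : ℝ))).sub (circleIntegrable_const _ _ _)

theorem circleAverage_neg_two_mul_log {c : ℂ} {r : ℝ} (hr : 0 < r) (hc : c ≠ 0) (A : ℝ) :
    circleAverage (fun z : ℂ => -2 * log ‖z‖ - A) c r = -2 * log ‖c‖ - A - 2 * logKernel r c := by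
  have hlogi : CircleIntegrable (fun z : ℂ => log ‖z‖) c r := by
    simpa using circleIntegrable_log_norm_sub_const (a := 0) (c := c) r
  have e1 := circleAverage_log_norm_sub hr (z := c) (a := 0) hc
  simp only [sub_zero] at e1
  rw [circleAverage_fun_sub (f₁ := fun z : ℂ => -2 * log ‖z‖) (hlogi.const_fun_smul (a := (-2 : ℝ)))
    (circleIntegrable_const _ _ _), circleAverage_const]
  have := circleAverage_fun_smul (f := fun z : ℂ => log ‖z‖) (a := (-2 : ℝ)) (c := c) (R := r)
  simp only [smul_eq_mul] at this
  rw [this, e1]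
  ring

/-- Both members of the maximum qualify: V by subharmonicity, and -2 log ‖·‖ - A because it is
harmonic on a disc avoiding 0. -/
theorem logTruncation_le_circleAverage (hG : IsOpen G) (hV : SubharmonicOn V (G \ {0})) {c : ℂ}
    {r : ℝ} (hr : 0 < r) (hcr : closedBall c r ⊆ G \ {0}) :
    logTruncation G V A c ≤ circleAverage (logTruncation G V A) c r := by
  have hsub : sphere c r ⊆ G \ {0} := sphere_subset_closedBall.trans hcr
  have hmem : ∀ θ, circleMap c r θ ∈ G \ {0} := fun θ => hsub (circleMap_mem_sphere c hr.le θ)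
  have h_int : CircleIntegrable (logTruncation G V A) c r := by
    obtain ⟨B, hB⟩ := exists_forall_abs_logTruncation_le (A := A) hV (isCompact_sphere c r) hsub
    rw [CircleIntegrable, intervalIntegrable_iff_integrableOn_Ioc_of_le (by positivity)]
    refine Measure.integrableOn_of_bounded (M := B) measure_Ioc_lt_top.ne ?_ (ae_of_all _ fun θ => ?_)
    · exact ((measurable_logTruncation hG hV).comp
        (continuous_circleMap c r).measurable).aestronglyMeasurable
    · exact hB _ (circleMap_mem_sphere c hr.le θ)
  rw [← EReal.coe_le_coe_iff, coe_logTruncation hV (hcr (mem_closedBall_self hr.le))]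
  refine max_le ?_ ?_
  · refine (hV.le_circleMean c r hr hcr).trans ?_
    rw [← circleMean_coe h_int]
    exact eintegral_mono_ae (ae_of_all _ fun θ => le_coe_logTruncation hV (hmem θ))
  · rw [EReal.coe_le_coe_iff]
    have hc0 : c ≠ 0 := (hcr (mem_closedBall_self hr.le)).2
    have hrc : r ≤ ‖c‖ := by
      by_contra h
      exact (hcr (by simpa using (not_le.1 h).le : (0 : ℂ) ∈ closedBall c r)).2 rfl
    have e2 := circleAverage_neg_two_mul_log hr hc0 A
    rw [logKernel_eq_zero hr hrc, mul_zero, sub_zero] at e2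
    rw [← e2]
    refine circleAverage_mono ?_ h_int fun z hz => ?_
    · exact circleIntegrable_neg_two_mul_log c r A
    · rw [abs_of_pos hr] at hz
      exact le_logTruncation hV (hsub hz)

end Truncation

/-! ### (1) implies (2) -/

section NecessaryCondition

open Metric Real

theorem EReal.coe_finsetSum {ι : Type*} (s : Finset ι) (a : ι → ℝ) :
    ((∑ n ∈ s, a n : ℝ) : EReal) = ∑ n ∈ s, (a n : EReal) := by
  classical
  induction s using Finset.induction_on with
  | empty => simp
  | insert n s hn ih => rw [Finset.sum_insert hn, Finset.sum_insert hn, EReal.coe_add, ih]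

variable {G : Set ℂ} {V : ℂ → EReal}

/-- The coefficient 2 makes -2 log ‖z‖ - A exceed V ≤ -log ‖z‖ + O(1) near 0, so the truncation is
explicit there; for large A it loses against V = 0 off K. The bound B serves all A ≥ A₀ because
truncations decrease in A. -/
theorem IsRepresentingFunction.exists_logTruncation_bounds (hG : IsOpen G) (h0 : (0 : ℂ) ∈ G)
    (hV : IsRepresentingFunction G V) :
    ∃ (K : Set ℂ) (B A₀ : ℝ), IsCompact K ∧ K ⊆ G ∧ (∀ z ∈ G \ {0}, z ∉ K → V z = 0) ∧
      (∀ A ≥ A₀, ∀ z ∉ K, logTruncation G V A z = 0) ∧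
      (∀ A ≥ A₀, ∃ s > 0, ∀ z ≠ 0, ‖z‖ < s → logTruncation G V A z = -2 * log ‖z‖ - A) ∧
      ∀ A ≥ A₀, ∀ z ∈ K, z ≠ 0 → logTruncation G V A z ≤ B - 2 * log ‖z‖ := by
  obtain ⟨K₀, hK₀, hK₀G, hK₀V⟩ := hV.eq_zero
  obtain ⟨C₀, hC₀⟩ := hV.le_neg_log
  have hS := hV.subharmonic
  obtain ⟨ρ₁, hρ₁, hρ₁V⟩ := Metric.mem_nhdsWithin_iff.1 hC₀
  obtain ⟨ρ₂, hρ₂, hρ₂G⟩ := Metric.nhds_basis_closedBall.mem_iff.1 (hG.mem_nhds h0)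
  set ρ := min ρ₁ ρ₂
  have hρ : 0 < ρ := lt_min hρ₁ hρ₂
  have hρG : closedBall (0 : ℂ) ρ ⊆ G :=
    (closedBall_subset_closedBall (min_le_right _ _)).trans hρ₂G
  set K := K₀ ∪ closedBall (0 : ℂ) ρ
  have hK : IsCompact K := hK₀.union (isCompact_closedBall 0 ρ)
  have hKG : K ⊆ G := union_subset hK₀G hρG
  -- For A ≥ A₀ the logarithmic term is nonpositive where ‖z‖ ≥ ρ.
  set A₀ := -2 * log ρ
  have hnear : ∀ A, ∃ s > 0, s ≤ ρ ∧ ∀ z ≠ 0, ‖z‖ < s →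
      logTruncation G V A z = -2 * log ‖z‖ - A := by
    intro A
    -- The inequality -log ‖z‖ + C₀ ≤ -2 log ‖z‖ - A amounts to log ‖z‖ ≤ -A - C₀.
    refine ⟨min ρ (exp (-A - C₀)), lt_min hρ (exp_pos _), min_le_left _ _, fun z hz hzs => ?_⟩
    have hzG : z ∈ G \ {0} :=
      ⟨hρG (by simpa using (hzs.trans_le (min_le_left _ _)).le), hz⟩
    rw [← EReal.coe_eq_coe_iff, coe_logTruncation hS hzG]
    refine max_eq_right ?_
    have h1 : V z ≤ ((-log ‖z‖ + C₀ : ℝ) : EReal) :=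
      hρ₁V ⟨by simpa using hzs.trans_le ((min_le_left _ _).trans (min_le_left _ _)), hz⟩
    refine h1.trans (EReal.coe_le_coe_iff.2 ?_)
    have h2 : log ‖z‖ < -A - C₀ :=
      (log_lt_iff_lt_exp (norm_pos_iff.2 hz)).2 (hzs.trans_le (min_le_right _ _))
    linarith
  obtain ⟨s, hs, hsρ, hsV⟩ := hnear A₀
  have hcomp : IsCompact (K \ ball 0 s) := hK.diff isOpen_ball
  have hcompG : K \ ball 0 s ⊆ G \ {0} := fun z hz =>
    ⟨hKG hz.1, fun h => hz.2 (by rw [mem_singleton_iff.1 h]; exact mem_ball_self hs)⟩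
  obtain ⟨B₁, hB₁⟩ := exists_forall_abs_logTruncation_le (A := A₀) hS hcomp hcompG
  obtain ⟨R, hR⟩ := hK.isBounded.exists_norm_le
  refine ⟨K, |B₁| + |A₀| + 2 * |log (max R 1)|, A₀, hK, hKG,
    fun z hz hzK => hK₀V z ⟨hz, fun h => hzK (Or.inl h)⟩, fun A hA z hz => ?_,
    fun A _ => ?_, fun A hA z hz hz0 => ?_⟩
  · by_cases hzG : z ∈ G \ {0}
    · rw [← EReal.coe_eq_coe_iff, coe_logTruncation hS hzG,
        hK₀V z ⟨hzG, fun h => hz (Or.inl h)⟩, EReal.coe_zero, max_eq_left]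
      rw [← EReal.coe_zero, EReal.coe_le_coe_iff]
      have h1 : ρ ≤ ‖z‖ := by
        by_contra h
        exact hz (Or.inr (by simpa using (not_le.1 h).le))
      have h2 := log_le_log hρ h1
      simp only [A₀] at hA
      linarith
    · exact logTruncation_of_notMem hzG
  · obtain ⟨s, hs, -, h⟩ := hnear A
    exact ⟨s, hs, h⟩
  · refine (logTruncation_anti hS hA z).trans ?_
    by_cases hzs : z ∈ ball (0 : ℂ) s
    · rw [hsV z hz0 (by simpa using hzs)]
      linarith [neg_abs_le A₀, abs_nonneg B₁, abs_nonneg (log (max R 1))]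
    · have h1 := (le_abs_self _).trans (hB₁ z ⟨hz, hzs⟩)
      have h2 : log ‖z‖ ≤ log (max R 1) :=
        log_le_log (norm_pos_iff.2 hz0) ((hR z hz).trans (le_max_left _ _))
      linarith [le_abs_self B₁, le_abs_self (log (max R 1)), abs_nonneg A₀]

theorem locallyIntegrable_logTruncation (hG : IsOpen G) (hV : SubharmonicOn V (G \ {0}))
    {K : Set ℂ} (hK : IsCompact K) (hKG : K ⊆ G) {A B : ℝ}
    (hzero : ∀ z ∉ K, logTruncation G V A z = 0)
    (hB : ∀ z ∈ K, z ≠ 0 → logTruncation G V A z ≤ B - 2 * log ‖z‖) :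
    LocallyIntegrable (logTruncation G V A) := by
  have hd : IntegrableOn (fun z : ℂ => (|A| + |B|) + 2 * |log ‖z‖|) K :=
    (integrableOn_const hK.measure_lt_top.ne).add
      (((locallyIntegrable_log_norm.integrableOn_isCompact hK).abs).const_mul 2)
  refine Integrable.locallyIntegrable (Integrable.mono'
    (hd.integrable_indicator hK.measurableSet)
    (measurable_logTruncation hG hV).aestronglyMeasurable ?_)
  have hne : ∀ᵐ z : ℂ, z ≠ 0 := by simp [ae_iff]
  filter_upwards [hne] with z hz
  by_cases hzK : z ∈ K
  · rw [indicator_of_mem hzK, norm_eq_abs, abs_le]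
    have h1 := hB z hzK hz
    have h2 := le_logTruncation (A := A) hV (z := z) ⟨hKG hzK, hz⟩
    constructor
    · linarith [le_abs_self A, abs_nonneg B, le_abs_self (log ‖z‖)]
    · linarith [le_abs_self B, abs_nonneg A, neg_abs_le (log ‖z‖)]
  · rw [indicator_of_notMem hzK, hzero z hzK, norm_zero]

/-- A small disc either misses K, where the function vanishes, or avoids 0, where it is subharmonic,
or has 0 in its interior. In the last case circle and centre lie where the function is -2 log ‖·‖ -
A, whose mean falls short by exactly 2 `logKernel r z`. -/
theorem exists_forall_logTruncation_sub_le_circleAverage (hG : IsOpen G)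
    (hV : SubharmonicOn V (G \ {0})) {K : Set ℂ} (hK : IsCompact K) (hKG : K ⊆ G) {A : ℝ}
    (hzero : ∀ z ∉ K, logTruncation G V A z = 0)
    (hnear : ∃ s > 0, ∀ z ≠ 0, ‖z‖ < s → logTruncation G V A z = -2 * log ‖z‖ - A) :
    ∃ r₀ > 0, ∀ z ≠ 0, ∀ r, 0 < r → r < r₀ → r ≠ ‖z‖ →
      logTruncation G V A z - 2 * logKernel r z ≤ circleAverage (logTruncation G V A) z r := by
  obtain ⟨s, hs, hsV⟩ := hnear
  obtain ⟨δ, hδ, hδG⟩ := exists_cthickening_subset hG hK hKG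
  -- s/2 keeps the circle inside the disc of radius s when ‖z‖ < r; δ/2 keeps a disc meeting K
  -- inside the δ-neighbourhood of K.
  refine ⟨min (s / 2) (δ / 2), by positivity, fun z hz r hr hr₀ hrz => ?_⟩
  have hrs : r < s / 2 := hr₀.trans_le (min_le_left _ _)
  have hrδ : r < δ / 2 := hr₀.trans_le (min_le_right _ _)
  have hk := logKernel_nonneg r z
  by_cases hd : ∀ w ∈ closedBall z r, w ∉ K
  · have e : circleAverage (logTruncation G V A) z r = 0 := by
      rw [circleAverage_congr_sphere (f₂ := fun _ => (0 : ℝ)), circleAverage_const]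
      intro w hw
      rw [abs_of_pos hr] at hw
      exact hzero w (hd w (sphere_subset_closedBall hw))
    rw [e, hzero z (hd z (mem_closedBall_self hr.le))]
    linarith
  · push Not at hd
    obtain ⟨w, hw, hwK⟩ := hd
    have hsubG : closedBall z r ⊆ G := fun y hy => by
      refine hδG (mem_cthickening_of_dist_le y w δ K hwK ?_)
      have h1 := mem_closedBall.1 hy
      have h2 := mem_closedBall'.1 hw
      linarith [dist_triangle y z w]
    rcases lt_or_gt_of_ne hrz with h | h
    · refine le_trans (by linarith) (logTruncation_le_circleAverage hG hV hr fun y hy =>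
        ⟨hsubG hy, fun hy0 => ?_⟩)
      rw [mem_singleton_iff.1 hy0, mem_closedBall, dist_comm, dist_zero_right] at hy
      linarith
    · have e : circleAverage (logTruncation G V A) z r =
          circleAverage (fun z : ℂ => -2 * log ‖z‖ - A) z r := by
        refine circleAverage_congr_sphere fun y hy => ?_
        rw [abs_of_pos hr, mem_sphere_iff_norm] at hy
        refine hsV y (fun hy0 => ?_) ?_
        · rw [hy0, zero_sub, norm_neg] at hy
          linarith
        · have := norm_le_norm_add_norm_sub' y z
          linarith
      rw [e, circleAverage_neg_two_mul_log hr hz, hsV z hz (by linarith)]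

variable {M : ℂ → ℝ} {ι : Type*} {Λ : ι → ℂ}

theorem IsRieszMeasure.restrict_diff_singleton_zero {ν : Measure ℂ} (hν : IsRieszMeasure G M ν)
    (hG : IsOpen G) (h0 : (0 : ℂ) ∈ G) (hMc : ContinuousOn M G) : ν.restrict (G \ {0}) = ν := by
  refine Measure.restrict_eq_self_of_ae_mem ?_
  rw [ae_iff]
  refine measure_mono_null (t := Gᶜ ∪ {0}) (fun z hz => ?_)
    (measure_union_null hν.compl_eq_zero (hν.singleton_zero hG h0 hMc))
  by_cases hzG : z ∈ G
  · right; by_contra h; exact hz ⟨hzG, h⟩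
  · exact Or.inl hzG

/-- The test functions are mollified truncations with A → ∞ and ε → 0. The reverse Fatou lemma
handles the ν-integrals, and the error term 2 ∫ ρ_ε W tends to 2 W(0), the same constant for all V.
-/
theorem IsZeroSetFor.exists_finsum_le (hG : IsOpen G) (h0 : (0 : ℂ) ∈ G)
    (hMc : ContinuousOn M G) {ν : Measure ℂ} (hν : IsRieszMeasure G M ν)
    (hΛG : ∀ n, Λ n ∈ G) (hΛ : ∀ K : Set ℂ, IsCompact K → K ⊆ G → {n | Λ n ∈ K}.Finite)
    (hΛ0 : ∀ n, Λ n ≠ 0) (h : IsZeroSetFor G M Λ) :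
    ∃ C : ℝ, ∀ V : ℂ → EReal, IsRepresentingFunction G V →
      ∑ᶠ n, V (Λ n) ≤ eintegral (ν.restrict (G \ {0})) V + (C : EReal) := by
  obtain ⟨f, ⟨-, C, hC⟩, hf⟩ := h
  have hf0 : f 0 ≠ 0 := by
    have h1 := hf.2 0 h0
    have h2 : {n | Λ n = 0} = ∅ := by ext n; simpa using hΛ0 n
    rw [h2, encard_empty] at h1
    exact (hf.1.analyticAt (hG.mem_nhds h0)).analyticOrderAt_eq_zero.1 h1
  set W : ℂ → ℝ := fun z => M z + C - log ‖f z‖ with hW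
  set G₀ := G ∩ {z | f z ≠ 0}
  have hG₀ : IsOpen G₀ := hf.1.continuousOn.isOpen_inter_preimage hG isOpen_ne
  have h0G₀ : (0 : ℂ) ∈ G₀ := ⟨h0, hf0⟩
  have hWc : ContinuousOn W G₀ := ((hMc.mono inter_subset_left).add continuousOn_const).sub
    ((hf.1.continuousOn.mono inter_subset_left).norm.log fun z hz => norm_ne_zero_iff.2 hz.2)
  have hWlim := tendsto_integral_mollifier_mul hG₀ h0G₀ hWc
  have hνr := hν.restrict_diff_singleton_zero hG h0 hMc
  have haeG : ∀ᵐ z ∂ν, z ∈ G \ {0} := by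
    rw [← hνr]; exact ae_restrict_mem (isOpen_diff_singleton_zero hG).measurableSet
  refine ⟨2 * W 0, fun V hV => ?_⟩
  have hS := hV.subharmonic
  obtain ⟨K, B, A₀, hK, hKG, hKV, hzero, hnear, hB⟩ := hV.exists_logTruncation_bounds hG h0
  obtain ⟨δ, hδ, hδG⟩ := exists_cthickening_subset hG hK hKG
  set K₂ := cthickening δ K
  have hK₂ : IsCompact K₂ := hK.cthickening
  have hKK₂ : K ⊆ K₂ := self_subset_cthickening K
  obtain ⟨R, hR⟩ := hK₂.isBounded.exists_norm_le
  set S : Finset ι := (hΛ K₂ hK₂ hδG).toFinset with hSdef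
  have hSm : ∀ n, n ∈ S ↔ Λ n ∈ K₂ := fun n => by simp [hSdef]
  set A : ℕ → ℝ := fun k => A₀ + k
  have hA : ∀ k, A k ≥ A₀ := fun k => by simp [A]
  set v : ℕ → ℂ → ℝ := fun k => logTruncation G V (A k) with hv
  have hvi : ∀ k, LocallyIntegrable (v k) := fun k =>
    locallyIntegrable_logTruncation hG hS hK hKG (hzero _ (hA k)) (hB _ (hA k))
  have hsub : ∀ k, ∃ r₀ > 0, ∀ z ≠ 0, ∀ r, 0 < r → r < r₀ → r ≠ ‖z‖ →
      v k z - 2 * logKernel r z ≤ circleAverage (v k) z r := fun k =>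
    exists_forall_logTruncation_sub_le_circleAverage hG hS hK hKG (hzero _ (hA k)) (hnear _ (hA k))
  choose r hr hrv using hsub
  obtain ⟨ρ, hρ, hρG₀⟩ := Metric.nhds_basis_closedBall.mem_iff.1 (hG₀.mem_nhds h0G₀)
  have hSpos : ∃ t > 0, ∀ n ∈ S, t ≤ ‖Λ n‖ := by
    have : ∀ᶠ t in 𝓝[>] (0 : ℝ), ∀ n ∈ S, t ≤ ‖Λ n‖ := by
      rw [Finset.eventually_all]
      exact fun n _ => mem_of_superset (Ioo_mem_nhdsGT (norm_pos_iff.2 (hΛ0 n))) fun t ht => ht.2.le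
    obtain ⟨t, ht1, ht2⟩ := (this.and self_mem_nhdsWithin).exists
    exact ⟨t, ht2, ht1⟩
  obtain ⟨t, ht, htS⟩ := hSpos
  -- The bounds serve, in order: the sub-mean value inequality, supports inside K₂, f ≠ 0 on the
  -- ε-disc about 0, circles about the points Λ n not enclosing 0, and convergence to 0.
  set ε : ℕ → ℝ := fun k => min (min (r k) δ) (min (min ρ t) (1 / ((k : ℝ) + 1))) with hεdef
  have hε : ∀ k, 0 < ε k := fun k =>
    lt_min (lt_min (hr k) hδ) (lt_min (lt_min hρ ht) (by positivity))
  have hεr : ∀ k, ε k ≤ r k := fun k => (min_le_left _ _).trans (min_le_left _ _)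
  have hεδ : ∀ k, ε k ≤ δ := fun k => (min_le_left _ _).trans (min_le_right _ _)
  have hερ : ∀ k, ε k ≤ ρ := fun k =>
    (min_le_right _ _).trans ((min_le_left _ _).trans (min_le_left _ _))
  have hεt : ∀ k, ε k ≤ t := fun k =>
    (min_le_right _ _).trans ((min_le_left _ _).trans (min_le_right _ _))
  have hεk : ∀ k, ε k ≤ 1 / ((k : ℝ) + 1) := fun k =>
    (min_le_right _ _).trans (min_le_right _ _)
  have hεlim : Tendsto ε atTop (𝓝 0) :=
    squeeze_zero (fun k => (hε k).le) hεk tendsto_one_div_add_atTop_nhds_zero_nat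
  have hεlim' : Tendsto ε atTop (𝓝[>] 0) :=
    tendsto_nhdsWithin_iff.2 ⟨hεlim, Eventually.of_forall hε⟩
  set φ : ℕ → ℂ → ℝ := fun k => mollify (ε k) (v k) with hφdef
  have hφs : ∀ k, ContDiff ℝ ∞ (φ k) := fun k => contDiff_mollify (hε k) (hvi k)
  have hφz : ∀ k, ∀ z ∉ K₂, φ k z = 0 := fun k z hz => by
    have e : φ k z = mollify (ε k) (fun _ => 0) z := by
      refine mollify_congr (hε k) fun w hw => hzero _ (hA k) w fun hwK => hz ?_
      exact mem_cthickening_of_dist_le z w δ K hwK (by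
        rw [dist_comm]; exact (mem_ball.1 hw).le.trans (hεδ k))
    rw [e, mollify_const (hε k)]
  have hφK : ∀ k, tsupport (φ k) ⊆ K₂ := fun k =>
    closure_minimal (fun z hz => by by_contra h; exact hz (hφz k z h)) isClosed_cthickening
  have hφc : ∀ k, HasCompactSupport (φ k) := fun k => HasCompactSupport.intro hK₂ (hφz k)
  set B' := |B| + 2 * log (max (R + 1) 1) with hB'
  have hlogR : 0 ≤ log (max (R + 1) 1) := log_nonneg (le_max_right _ _)
  have hB'0 : 0 ≤ B' := by positivity
  have hB'nn : ∀ z : ℂ, ‖z‖ ≤ R + 1 → 0 ≤ B' - 2 * log ‖z‖ := fun z hz => by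
    rcases eq_or_ne z 0 with rfl | hz0
    · simpa using hB'0
    · have := log_le_log (norm_pos_iff.2 hz0) (hz.trans (le_max_left _ 1))
      linarith [abs_nonneg B]
  have hvB' : ∀ k, ∀ z : ℂ, ‖z‖ ≤ R + 1 → v k z ≤ B' - 2 * log ‖z‖ := fun k z hz => by
    by_cases hzK : z ∈ K
    · rcases eq_or_ne z 0 with rfl | hz0
      · simp only [hv]
        rw [logTruncation_of_notMem (by simp)]
        exact hB'nn 0 hz
      · have := hB _ (hA k) z hzK hz0
        simp only [hv]
        linarith [le_abs_self B]
    · simp only [hv]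
      rw [hzero _ (hA k) z hzK]
      exact hB'nn z hz
  have hφB' : ∀ k, ∀ z ∈ K₂, z ≠ 0 → φ k z ≤ B' - 2 * log ‖z‖ := fun k z hz hz0 => by
    have hloc : LocallyIntegrable fun w : ℂ => -2 * log ‖w‖ := by
      exact locallyIntegrable_log_norm.smul (-2 : ℝ)
    have h1 : φ k z ≤ mollify (ε k) (fun w => B' + -2 * log ‖w‖) z := by
      refine mollify_mono (hε k) (hvi k) ((locallyIntegrable_const B').add hloc) fun w hw => ?_
      have h2 : ‖w‖ ≤ R + 1 := by
        have h3 := norm_le_norm_add_norm_sub' w z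
        have h4 : ‖w - z‖ < ε k := mem_ball_iff_norm.1 hw
        have h5 : 1 / ((k : ℝ) + 1) ≤ 1 := by
          rw [div_le_one (by positivity)]; linarith [(Nat.cast_nonneg k : (0:ℝ) ≤ k)]
        linarith [hR z hz, hεk k]
      have h6 := hvB' k w h2
      simp only [Pi.add_apply]
      linarith
    rw [mollify_add (hε k) (locallyIntegrable_const B') hloc, mollify_const (hε k),
      mollify_const_mul] at h1
    have h2 : log ‖z‖ ≤ mollify (ε k) (fun w => log ‖w‖) z := log_norm_le_smoothLog (hε k) hz0
    linarith
  -- A common ν-integrable majorant of V and of all φ k.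
  set D : ℂ → ℝ := K₂.indicator fun z => B' - 2 * log ‖z‖ with hD
  have hDi : Integrable D ν := by
    rw [hD, integrable_indicator_iff hK₂.measurableSet]
    exact (hν.integrableOn_of_continuousOn hK₂ hδG continuousOn_const).sub
      ((hν.integrableOn_log_norm_of_isCompact hG h0 hMc hK₂ hδG).const_mul 2)
  rw [hνr]
  refine le_eintegral_add_of_forall_eventually_lt (μ := ν) (V := V) (D := D) (u := φ)
    (c := fun k => 2 * ∫ z, mollifier (ε k) z * W z) hDi ?_ ?_ (fun k => ?_) (fun k => ?_) ?_
    ((hWlim.comp hεlim').const_mul 2) (fun k => ?_)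
  · rw [← hνr]
    refine aemeasurable_restrict_of_measurable_subtype
      (isOpen_diff_singleton_zero hG).measurableSet ?_
    refine UpperSemicontinuous.measurable fun z a ha => ?_
    have := hS.usc z z.2 a ha
    rw [(isOpen_diff_singleton_zero hG).nhdsWithin_eq z.2] at this
    exact continuous_subtype_val.continuousAt.eventually this
  · filter_upwards [haeG] with z hz
    by_cases hzK : z ∈ K
    · refine (le_coe_logTruncation (A := A₀) hS hz).trans (EReal.coe_le_coe_iff.2 ?_)
      rw [hD, indicator_of_mem (hKK₂ hzK)]
      have := hB A₀ le_rfl z hzK hz.2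
      linarith [le_abs_self B]
    · rw [hKV z hz hzK, ← EReal.coe_zero, EReal.coe_le_coe_iff]
      refine indicator_nonneg (fun w hw => hB'nn w ?_) z
      linarith [hR w hw]
  · refine (integrableOn_iff_integrable_of_support_subset fun z hz => ?_).1
      (hν.integrableOn_of_continuousOn hK₂ hδG (hφs k).continuous.continuousOn)
    by_contra h
    exact hz (hφz k z h)
  · filter_upwards [haeG] with z hz
    by_cases hzK : z ∈ K₂
    · rw [hD, indicator_of_mem hzK]; exact hφB' k z hzK hz.2
    · rw [hD, indicator_of_notMem hzK, hφz k z hzK]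
  -- Some truncation v m lies below a' at z, hence on a disc about z by semicontinuity. Later
  -- truncations are smaller, so their averages over smaller discs stay at most a' < a.
  · filter_upwards [haeG] with z hz a ha
    obtain ⟨a', ha1, ha2⟩ := EReal.lt_iff_exists_real_btwn.1 ha
    obtain ⟨m, hm⟩ := exists_nat_gt (-2 * log ‖z‖ - A₀ - a')
    have h1 : v m z < a' := (logTruncation_lt_iff hS hz).2 ⟨ha1, by simp only [A]; linarith⟩
    have h2 := upperSemicontinuousOn_logTruncation (A := A m) hS z hz a' h1
    rw [(isOpen_diff_singleton_zero hG).nhdsWithin_eq hz] at h2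
    obtain ⟨d, hd, hdv⟩ := Metric.mem_nhds_iff.1 h2
    filter_upwards [hεlim.eventually_lt_const hd, eventually_ge_atTop m] with k hk1 hk2
    refine lt_of_le_of_lt (mollify_le_of_forall_le (hε k) (hvi k) (C := a') fun w hw => ?_)
      (EReal.coe_lt_coe_iff.1 ha2)
    have h3 : v m w < a' := hdv (ball_subset_ball hk1.le hw)
    have h4 : v k w ≤ v m w := logTruncation_anti hS (by simpa [A] using hk2) w
    linarith
  · have hfin : {n | Λ n ∈ tsupport (φ k)}.Finite := hΛ _ (hφc k).isCompact ((hφK k).trans hδG)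
    have key := hf.sum_le_integral_add hG hMc hν hC (hφs k) (hφc k) ((hφK k).trans hδG)
      (s := hfin.toFinset) (fun n => by simp) (hε k)
      ((closedBall_subset_closedBall (hερ k)).trans (hρG₀.trans inter_subset_left))
      (fun z hz => (hρG₀ (closedBall_subset_closedBall (hερ k) hz)).2)
      (le_laplacian_mollify (hvi k) (hr k) (hrv k) (hε k))
    have hsumS : ∑ n ∈ hfin.toFinset, φ k (Λ n) = ∑ n ∈ S, φ k (Λ n) := by
      refine Finset.sum_subset (fun n hn => ?_) fun n _ hn => ?_
      · rw [hSm]; exact hφK k (by simpa using hn)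
      · exact image_eq_zero_of_notMem_tsupport (by simpa using hn)
    rw [hsumS] at key
    -- V vanishes at every Λ n outside K₂, so the support is finite and `∑ᶠ` does not take its
    -- default value 0.
    have hfs : ∑ᶠ n, V (Λ n) = ∑ n ∈ S, V (Λ n) := by
      refine finsum_eq_sum_of_support_subset _ fun n hn => ?_
      rw [Finset.mem_coe, hSm]
      by_contra h
      exact hn (hKV (Λ n) ⟨hΛG n, hΛ0 n⟩ fun hK' => h (hKK₂ hK'))
    rw [hfs]
    refine le_trans ?_ (EReal.coe_le_coe_iff.2 key)
    rw [EReal.coe_finsetSum]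
    refine Finset.sum_le_sum fun n hn => (le_coe_logTruncation (A := A k) hS
      ⟨hΛG n, hΛ0 n⟩).trans (EReal.coe_le_coe_iff.2 ?_)
    -- Circles of radius below ε k ≤ ‖Λ n‖ do not enclose 0, so the defect `logKernel` vanishes and
    -- mollifying does not lower the value at Λ n.
    refine le_mollify_of_forall_le_circleAverage (hε k) (hvi k) fun q hq0 hqε => ?_
    have hqΛ : q < ‖Λ n‖ := hqε.trans_le ((hεt k).trans (htS n hn))
    have := hrv k (Λ n) (hΛ0 n) q hq0 (hqε.trans_le (hεr k)) hqΛ.ne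
    rwa [logKernel_eq_zero hq0 hqΛ.le, mul_zero, sub_zero] at this

end NecessaryCondition

/-! ### Regularized logarithmic potentials -/

section Potential

open Metric Real

variable {μ : Measure ℂ} {K : Set ℂ}

theorem integrable_circleMap_sub [IsFiniteMeasure μ] (hK : IsCompact K) (hμ : μ Kᶜ = 0) {N : ℂ → ℝ}
    (hN : Continuous N) (z : ℂ) (r : ℝ) :
    Integrable (fun p : ℝ × ℂ => N (circleMap z r p.1 - p.2))
      ((volume.restrict (Ioc 0 (2 * π))).prod μ) := by
  have hμK : μ.restrict K = μ := Measure.restrict_eq_self_of_ae_mem (by rwa [ae_iff])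
  rw [← hμK, Measure.prod_restrict]
  have hc : Continuous fun p : ℝ × ℂ => N (circleMap z r p.1 - p.2) :=
    hN.comp (((continuous_circleMap z r).comp continuous_fst).sub continuous_snd)
  exact (hc.continuousOn.integrableOn_compact (isCompact_Icc.prod hK)).mono_set
    (prod_mono Ioc_subset_Icc_self Subset.rfl)

theorem integrable_comp_sub [IsFiniteMeasure μ] (hK : IsCompact K) (hμ : μ Kᶜ = 0) {N : ℂ → ℝ} (hN : Continuous N)
    (z : ℂ) : Integrable (fun w => N (z - w)) μ :=
  integrable_of_continuousOn_of_compl_eq_zero hK hμ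
    (hN.comp (continuous_const.sub continuous_id)).continuousOn

theorem circleAverage_integral_sub [IsFiniteMeasure μ] (hK : IsCompact K) (hμ : μ Kᶜ = 0) {N : ℂ → ℝ}
    (hN : Continuous N) (z : ℂ) (r : ℝ) :
    circleAverage (fun z => ∫ w, N (z - w) ∂μ) z r = ∫ w, circleAverage N (z - w) r ∂μ := by
  have h := integral_integral_swap (f := fun (θ : ℝ) w => N (circleMap z r θ - w))
    (integrable_circleMap_sub hK hμ hN z r)
  rw [circleAverage_eq_setIntegral, h, ← integral_const_mul]
  congr 1; ext w
  rw [circleAverage_eq_setIntegral]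
  congr 2; ext θ
  congr 1
  simp [circleMap]; ring

theorem circleLaplacian_integral_sub [IsFiniteMeasure μ] (hK : IsCompact K) (hμ : μ Kᶜ = 0) {N : ℂ → ℝ}
    (hN : Continuous N) (z : ℂ) (r : ℝ) :
    circleLaplacian (fun z => ∫ w, N (z - w) ∂μ) r z = ∫ w, circleLaplacian N r (z - w) ∂μ := by
  simp only [circleLaplacian]
  rw [circleAverage_integral_sub hK hμ hN, ← integral_sub
    (integrable_comp_sub hK hμ (continuous_circleAverage_center hN r) z)
    (integrable_comp_sub hK hμ hN z), ← integral_const_mul]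

theorem contDiff_integral_sub [IsFiniteMeasure μ] {N : ℂ → ℝ} (hN : ContDiff ℝ ∞ N) (hc : HasCompactSupport N) :
    ContDiff ℝ ∞ fun z => ∫ w, N (z - w) ∂μ := by
  have h := hc.contDiff_convolution_right (μ := μ) (f := fun _ => (1 : ℝ))
    (ContinuousLinearMap.mul ℝ ℝ) (integrable_const 1).locallyIntegrable hN
  have e : (fun z => ∫ w, N (z - w) ∂μ) =
      convolution (fun _ => (1 : ℝ)) N (ContinuousLinearMap.mul ℝ ℝ) μ := by
    ext z; simp [convolution]
  rwa [e]

/-- Circle Laplacians commute with integration against μ and are uniformly bounded for N, so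
dominated convergence moves the Laplacian inside. -/
theorem laplacian_integral_sub [IsFiniteMeasure μ] (hK : IsCompact K) (hμ : μ Kᶜ = 0) {N : ℂ → ℝ}
    (hN : ContDiff ℝ ∞ N) (hc : HasCompactSupport N) (z : ℂ) :
    Laplacian.laplacian (fun z => ∫ w, N (z - w) ∂μ) z =
      ∫ w, Laplacian.laplacian N (z - w) ∂μ := by
  have h1 := tendsto_circleLaplacian (contDiff_integral_sub (μ := μ) hN hc).two_of_infty z
  obtain ⟨C, hC⟩ := exists_abs_circleLaplacian_le hN.two_of_infty hc
  refine tendsto_nhds_unique h1 ?_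
  simp only [circleLaplacian_integral_sub hK hμ hN.continuous]
  refine tendsto_integral_filter_of_dominated_convergence (fun _ => C) ?_ ?_ (integrable_const C)
    (ae_of_all _ fun w => tendsto_circleLaplacian hN.two_of_infty (z - w))
  · refine Eventually.of_forall fun r => Continuous.aestronglyMeasurable ?_
    exact continuous_const.mul (((continuous_circleAverage_center hN.continuous r).comp
      (continuous_const.sub continuous_id)).sub (hN.continuous.comp
      (continuous_const.sub continuous_id)))
  · filter_upwards [self_mem_nhdsWithin] with r hr
    exact ae_of_all _ fun w => hC r hr (z - w)

/-- The logarithmic potential of `μ`, regularized at scale `ε`. -/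
noncomputable def smoothPotential (μ : Measure ℂ) (ε : ℝ) (z : ℂ) : ℝ := ∫ w, smoothLog ε (z - w) ∂μ

/-- `smoothLog ε` lacks compact support, but for z near z₀ and w in K only its values on a fixed
disc matter. Cutting it off there makes the results on compactly supported kernels applicable. -/
theorem exists_smoothPotential_eventuallyEq (hK : IsCompact K) (hμ : μ Kᶜ = 0) {ε : ℝ}
    (hε : 0 < ε) (z₀ : ℂ) : ∃ N : ℂ → ℝ, ContDiff ℝ ∞ N ∧ HasCompactSupport N ∧
      (∀ w ∈ K, N =ᶠ[𝓝 (z₀ - w)] smoothLog ε) ∧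
      smoothPotential μ ε =ᶠ[𝓝 z₀] fun z => ∫ w, N (z - w) ∂μ := by
  obtain ⟨R, hR⟩ := hK.isBounded.exists_norm_le
  obtain ⟨χ, hχ, hχc, -, -, hχ1⟩ := exists_contDiff_eq_one isOpen_univ
    (isCompact_closedBall (0 : ℂ) (‖z₀‖ + 1 + R)) (subset_univ _)
  have hval : ∀ z : ℂ, ‖z‖ ≤ ‖z₀‖ + 1 + R → χ z * smoothLog ε z = smoothLog ε z := fun z hz => by
    rw [hχ1 z (by simpa using hz), one_mul]
  have hnear : ∀ w ∈ K, ∀ z ∈ ball z₀ 1, ‖z - w‖ < ‖z₀‖ + 1 + R := fun w hw z hz => by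
    have h1 : ‖z - z₀‖ < 1 := mem_ball_iff_norm.1 hz
    have h2 := norm_le_norm_add_norm_sub' z z₀
    linarith [norm_sub_le z w, hR w hw]
  refine ⟨fun z => χ z * smoothLog ε z, hχ.mul (contDiff_smoothLog hε), hχc.mul_right,
    fun w hw => ?_, ?_⟩
  · have h1 : ∀ᶠ z in 𝓝 (z₀ - w), ‖z‖ < ‖z₀‖ + 1 + R :=
      continuous_norm.continuousAt.eventually_lt_const (hnear w hw z₀ (mem_ball_self one_pos))
    exact h1.mono fun z hz => hval z hz.le
  · filter_upwards [ball_mem_nhds z₀ one_pos] with z hz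
    refine integral_congr_ae ?_
    have hae : ∀ᵐ w ∂μ, w ∈ K := by rwa [ae_iff]
    filter_upwards [hae] with w hw
    exact (hval _ (hnear w hw z hz).le).symm

theorem contDiff_smoothPotential [IsFiniteMeasure μ] (hK : IsCompact K) (hμ : μ Kᶜ = 0) {ε : ℝ} (hε : 0 < ε) :
    ContDiff ℝ ∞ (smoothPotential μ ε) := by
  refine contDiff_iff_contDiffAt.2 fun z₀ => ?_
  obtain ⟨N, hN, hNc, -, he⟩ := exists_smoothPotential_eventuallyEq hK hμ hε z₀
  exact (contDiff_integral_sub hN hNc).contDiffAt.congr_of_eventuallyEq he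

theorem laplacian_smoothPotential [IsFiniteMeasure μ] (hK : IsCompact K) (hμ : μ Kᶜ = 0) {ε : ℝ} (hε : 0 < ε)
    (z : ℂ) : Laplacian.laplacian (smoothPotential μ ε) z =
      2 * π * ∫ w, mollifier ε (z - w) ∂μ := by
  obtain ⟨N, hN, hNc, hloc, he⟩ := exists_smoothPotential_eventuallyEq hK hμ hε z
  rw [(InnerProductSpace.laplacian_congr_nhds he).self_of_nhds, laplacian_integral_sub hK hμ hN hNc,
    ← integral_const_mul]
  refine integral_congr_ae ?_
  have hae : ∀ᵐ w ∂μ, w ∈ K := by rwa [ae_iff]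
  filter_upwards [hae] with w hw
  rw [(InnerProductSpace.laplacian_congr_nhds (hloc w hw)).self_of_nhds, laplacian_smoothLog hε]

theorem smoothPotential_le_circleAverage [IsFiniteMeasure μ] (hK : IsCompact K) (hμ : μ Kᶜ = 0) {ε : ℝ} (hε : 0 < ε)
    (z : ℂ) {r : ℝ} (hr : 0 < r) :
    smoothPotential μ ε z ≤ circleAverage (smoothPotential μ ε) z r := by
  have hc := (contDiff_smoothLog hε).continuous
  refine le_trans ?_ (circleAverage_integral_sub hK hμ hc z r).ge
  exact integral_mono (integrable_comp_sub hK hμ hc z)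
    (integrable_comp_sub hK hμ (continuous_circleAverage_center hc r) z)
    fun w => smoothLog_le_circleAverage hε (z - w) hr

end Potential

/-! ### Potentials of representing measures off the support -/

section RepresentingPotential

open Metric Real InnerProductSpace

variable {G K : Set ℂ} {μ : Measure ℂ}

/-- Representing measures reproduce `log |1 - q|` for holomorphic `q` with `|q| < 1` on the
support. -/
theorem IsRepresentingMeasure.integral_log_norm_one_sub (hG : IsOpen G)
    (hμ : IsRepresentingMeasure G μ) (hK : IsCompact K) (hKG : K ⊆ G) (hμK : μ Kᶜ = 0)
    (h0 : (0 : ℂ) ∈ K) {q : ℂ → ℂ} (hq : DifferentiableOn ℂ q G) (hq1 : ∀ w ∈ K, ‖q w‖ < 1) :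
    ∫ w, log ‖1 - q w‖ ∂μ = log ‖1 - q 0‖ := by
  have := hμ.finite
  obtain ⟨w₀, hw₀, hmax⟩ := hK.exists_isMaxOn ⟨0, h0⟩ (hq.continuousOn.mono hKG).norm
  set θ := ‖q w₀‖
  have hθ1 : θ < 1 := hq1 w₀ hw₀
  have hθ0 : 0 ≤ θ := norm_nonneg _
  have hle : ∀ w ∈ K, ‖q w‖ ≤ θ := fun w hw => hmax hw
  -- Terms of log|1 - q| = -Σ Re qⁿ/n: each is harmonic, and bounded by θⁿ on K with θ = max |q| <
  -- 1. The term n = 0 is 0 because division by zero gives 0.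
  set F : ℕ → ℂ → ℝ := fun n w => -(q w ^ n / n).re
  have hFh : ∀ n, HarmonicOnNhd (F n) G := fun n w hw => by
    have ha : AnalyticAt ℂ (fun w => q w ^ n / (n : ℂ)) w :=
      ((hq.analyticAt (hG.mem_nhds hw)).pow n).div_const
    exact ha.harmonicAt_re.neg
  have hsum : ∀ w ∈ K, HasSum (fun n => F n w) (log ‖1 - q w‖) := fun w hw => by
    have h1 := Complex.hasSum_re (Complex.hasSum_taylorSeries_neg_log (hq1 w hw))
    rw [Complex.neg_re, Complex.log_re] at h1
    simpa [F] using h1.neg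
  have hFle : ∀ n, ∀ w ∈ K, ‖F n w‖ ≤ θ ^ n := fun n w hw => by
    rw [norm_neg]
    refine (Complex.abs_re_le_norm _).trans ?_
    rw [norm_div, norm_pow, Complex.norm_natCast]
    rcases Nat.eq_zero_or_pos n with rfl | hn
    · simp
    · refine (div_le_self (by positivity) (by exact_mod_cast hn)).trans ?_
      exact pow_le_pow_left₀ (norm_nonneg _) (hle w hw) n
  have hae : ∀ᵐ w ∂μ, w ∈ K := by rwa [ae_iff]
  have hFi : ∀ n, Integrable (F n) μ := fun n => hμ.integrable (hFh n).continuousOn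
  have hs : Summable fun n => ∫ w, ‖F n w‖ ∂μ := by
    refine Summable.of_nonneg_of_le (fun n => integral_nonneg fun w => norm_nonneg _)
      (fun n => ?_) (summable_geometric_of_lt_one hθ0 hθ1)
    rw [← hμ.integral_const (θ ^ n)]
    exact integral_mono_ae (hFi n).norm (integrable_const _)
      (hae.mono fun w hw => hFle n w hw)
  have h2 := hasSum_integral_of_summable_integral_norm hFi hs
  have h3 : ∫ w, log ‖1 - q w‖ ∂μ = ∫ w, ∑' n, F n w ∂μ :=
    integral_congr_ae (hae.mono fun w hw => (hsum w hw).tsum_eq.symm)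
  rw [h3]
  refine h2.unique ?_
  have h4 : ∀ n, ∫ w, F n w ∂μ = F n 0 := fun n => (hμ.eq_integral _ (hFh n)).symm
  simp only [h4]
  exact hsum 0 h0

/-- The logarithmic potential of a representing measure carried by a set of the standard
exhaustion agrees with that of the unit mass at the origin off this set. -/
theorem IsRepresentingMeasure.integral_log_norm_sub (hG : IsOpen G)
    (hμ : IsRepresentingMeasure G μ) {m : ℕ} (hμK : μ (planeExhaustion G m)ᶜ = 0)
    (h0 : (0 : ℂ) ∈ planeExhaustion G m) {z : ℂ} (hz : z ∉ planeExhaustion G m) :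
    ∫ w, log ‖z - w‖ ∂μ = log ‖z‖ := by
  have := hμ.finite
  have hKG := planeExhaustion_subset G m
  have hK := isCompact_planeExhaustion G m
  have hae : ∀ᵐ w ∂μ, w ∈ planeExhaustion G m := by rwa [ae_iff]
  have hz0 : z ≠ 0 := fun h => hz (h ▸ h0)
  by_cases hzm : ‖z‖ ≤ m
  · have hb : ∃ b ∉ G, dist z b < 1 / ((m : ℝ) + 1) := by
      by_contra hcon
      push Not at hcon
      exact hz ⟨hzm, hcon⟩
    -- Here z is nearer to b ∉ G than the points w of the exhausting set are, so log|z - w| = log|w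
    -- - b| + log|1 - (z - b)/(w - b)| expands about the pole b, and log|w - b| is harmonic on G.
    obtain ⟨b, hbG, hzb⟩ := hb
    have hwb : ∀ w ∈ G, w - b ≠ 0 := fun w hw h => hbG (sub_eq_zero.1 h ▸ hw)
    have hq : DifferentiableOn ℂ (fun w => (z - b) / (w - b)) G := fun w hw =>
      (DifferentiableAt.fun_div (differentiableAt_const (z - b))
        (differentiableAt_id.sub_const b) (hwb w hw)).differentiableWithinAt
    have hq1 : ∀ w ∈ planeExhaustion G m, ‖(z - b) / (w - b)‖ < 1 := fun w hw => by
      have h1 := hw.2 b hbG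
      rw [dist_eq_norm] at h1 hzb
      rw [norm_div, div_lt_one (norm_pos_iff.2 (hwb w (hKG hw)))]
      linarith
    have hh : HarmonicOnNhd (fun w => log ‖w - b‖) G :=
      harmonicOnNhd_log_norm hG (by fun_prop) hwb
    have e1 := hμ.integral_log_norm_one_sub hG hK hKG hμK h0 hq hq1
    have hne : ∀ w ∈ planeExhaustion G m, 1 - (z - b) / (w - b) ≠ 0 := fun w hw h => by
      have h1 := hq1 w hw
      rw [← sub_eq_zero.1 h, norm_one] at h1
      exact lt_irrefl _ h1
    have hpt : ∀ w ∈ planeExhaustion G m, log ‖z - w‖ =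
        log ‖w - b‖ + log ‖1 - (z - b) / (w - b)‖ := fun w hw => by
      have hw0 := hwb w (hKG hw)
      rw [← log_mul (norm_ne_zero_iff.2 hw0) (norm_ne_zero_iff.2 (hne w hw)), ← norm_mul,
        norm_sub_rev z w]
      congr 2
      field_simp
      ring
    have hi : Integrable (fun w => log ‖1 - (z - b) / (w - b)‖) μ :=
      integrable_of_continuousOn_of_compl_eq_zero hK hμK
        ((continuousOn_const.sub (hq.continuousOn.mono hKG)).norm.log
          fun w hw => norm_ne_zero_iff.2 (hne w hw))
    rw [integral_congr_ae (hae.mono fun w hw => hpt w hw),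
      integral_add (hμ.integrable hh.continuousOn) hi, e1, ← hμ.eq_integral _ hh, ← hpt 0 h0, sub_zero]
  -- Here ‖w‖ ≤ m < ‖z‖, and the expansion is about infinity.
  · have hq : DifferentiableOn ℂ (fun w => w / z) G := by fun_prop
    have hq1 : ∀ w ∈ planeExhaustion G m, ‖w / z‖ < 1 := fun w hw => by
      rw [norm_div, div_lt_one (norm_pos_iff.2 hz0)]
      linarith [hw.1]
    have e1 := hμ.integral_log_norm_one_sub hG hK hKG hμK h0 hq hq1
    have hne : ∀ w ∈ planeExhaustion G m, 1 - w / z ≠ 0 := fun w hw h => by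
      have h1 := hq1 w hw
      rw [← sub_eq_zero.1 h, norm_one] at h1
      exact lt_irrefl _ h1
    have hpt : ∀ w ∈ planeExhaustion G m, log ‖z - w‖ = log ‖z‖ + log ‖1 - w / z‖ := fun w hw => by
      rw [← log_mul (norm_ne_zero_iff.2 hz0) (norm_ne_zero_iff.2 (hne w hw)), ← norm_mul]
      congr 2
      field_simp
    have hi : Integrable (fun w => log ‖1 - w / z‖) μ :=
      integrable_of_continuousOn_of_compl_eq_zero hK hμK
        ((continuousOn_const.sub (hq.continuousOn.mono hKG)).norm.log
          fun w hw => norm_ne_zero_iff.2 (hne w hw))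
    rw [integral_congr_ae (hae.mono fun w hw => hpt w hw), integral_add (integrable_const _) hi, e1, hμ.integral_const]
    simp

end RepresentingPotential

/-! ### From representing measures to representing functions -/

section RepresentingFunctionOfMeasure

open Metric Real InnerProductSpace

variable {G : Set ℂ} {μ : Measure ℂ} {m : ℕ} {ε : ℝ}

theorem smoothPotential_eq_log (hG : IsOpen G) (hμ : IsRepresentingMeasure G μ)
    (hμK : μ (planeExhaustion G m)ᶜ = 0) (h0 : (0 : ℂ) ∈ planeExhaustion G m) (hε : 0 < ε) {z : ℂ}
    (hz : z ∉ cthickening ε (planeExhaustion G m)) : smoothPotential μ ε z = log ‖z‖ := by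
  have hzK : z ∉ planeExhaustion G m := fun h => hz (self_subset_cthickening _ h)
  rw [← hμ.integral_log_norm_sub hG hμK h0 hzK]
  have hae : ∀ᵐ w ∂μ, w ∈ planeExhaustion G m := by rwa [ae_iff]
  refine integral_congr_ae (hae.mono fun w hw => smoothLog_eq_log hε ?_)
  by_contra h
  exact hz (mem_cthickening_of_dist_le z w ε _ hw (by rw [dist_eq_norm]; exact (not_le.1 h).le))

theorem log_le_smoothPotential (hG : IsOpen G) (hμ : IsRepresentingMeasure G μ)
    (hμK : μ (planeExhaustion G m)ᶜ = 0) (h0 : (0 : ℂ) ∈ planeExhaustion G m) (hε : 0 < ε) {z : ℂ}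
    (hz : z ∉ planeExhaustion G m) : log ‖z‖ ≤ smoothPotential μ ε z := by
  have := hμ.finite
  rw [← hμ.integral_log_norm_sub hG hμK h0 hz]
  have hae : ∀ᵐ w ∂μ, w ∈ planeExhaustion G m := by rwa [ae_iff]
  have hne : ∀ w ∈ planeExhaustion G m, z - w ≠ 0 := fun w hw h => hz (sub_eq_zero.1 h ▸ hw)
  have hK := isCompact_planeExhaustion G m
  refine integral_mono_ae (integrable_of_continuousOn_of_compl_eq_zero hK hμK
    ((continuous_const.sub continuous_id).norm.continuousOn.log
      fun w hw => norm_ne_zero_iff.2 (hne w hw)))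
    (integrable_comp_sub hK hμK (contDiff_smoothLog hε).continuous z) ?_
  exact hae.mono fun w hw => log_norm_le_smoothLog hε (hne w hw)

/-- Regularization makes the potential real-valued and continuous, at the price of enlarging by ε
the set off which it equals log ‖·‖. It is finite at 0, so the difference has the admissible pole
-log ‖z‖. -/
theorem isRepresentingFunction_smoothPotential_sub_log (hG : IsOpen G)
    (hμ : IsRepresentingMeasure G μ) (hμK : μ (planeExhaustion G m)ᶜ = 0)
    (h0 : (0 : ℂ) ∈ planeExhaustion G m) (hε : 0 < ε)
    (hεG : cthickening ε (planeExhaustion G m) ⊆ G) :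
    IsRepresentingFunction G fun z => ((smoothPotential μ ε z - log ‖z‖ : ℝ) : EReal) := by
  have := hμ.finite
  have hK := isCompact_planeExhaustion G m
  have hUc : Continuous (smoothPotential μ ε) := (contDiff_smoothPotential hK hμK hε).continuous
  have hlogc : ContinuousOn (fun z : ℂ => log ‖z‖) {0}ᶜ :=
    continuous_norm.continuousOn.log fun z hz => norm_ne_zero_iff.2 hz
  refine ⟨⟨fun z _ => EReal.coe_ne_top _, ?_, ?_, fun c r hr hcr => ?_⟩,
    ⟨_, hK.cthickening, hεG, fun z hz => ?_⟩, smoothPotential μ ε 0 + 1, ?_⟩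
  · have hGn : G ∈ 𝓝[≠] (0 : ℂ) :=
      nhdsWithin_le_nhds (hG.mem_nhds (planeExhaustion_subset G m h0))
    obtain ⟨z, hz⟩ := (Filter.nonempty_of_mem (inter_mem hGn self_mem_nhdsWithin) : (G ∩ {0}ᶜ).Nonempty)
    exact ⟨z, ⟨hz.1, hz.2⟩, EReal.coe_ne_bot _⟩
  · refine ContinuousOn.upperSemicontinuousOn ?_
    exact continuous_coe_real_ereal.comp_continuousOn
      (hUc.continuousOn.sub (hlogc.mono fun z hz => hz.2))
  · have hc0 : c ≠ 0 := (hcr (mem_closedBall_self hr.le)).2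
    have hrc : r ≤ ‖c‖ := by
      by_contra h
      exact (hcr (by simpa using (not_le.1 h).le : (0 : ℂ) ∈ closedBall c r)).2 rfl
    have hUi : CircleIntegrable (smoothPotential μ ε) c r := hUc.continuousOn.circleIntegrable hr.le
    have hlogi : CircleIntegrable (fun z : ℂ => log ‖z‖) c r := by
      simpa using circleIntegrable_log_norm_sub_const (a := 0) (c := c) r
    have e1 := circleAverage_log_norm_sub hr (z := c) (a := 0) hc0
    simp only [sub_zero, logKernel_eq_zero hr hrc, add_zero] at e1
    rw [circleMean_coe (v := fun z => smoothPotential μ ε z - log ‖z‖) (hUi.sub hlogi), EReal.coe_le_coe_iff, circleAverage_fun_sub hUi hlogi, e1]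
    linarith [smoothPotential_le_circleAverage hK hμK hε c hr]
  · rw [smoothPotential_eq_log hG hμ hμK h0 hε hz.2, sub_self, EReal.coe_zero]
  · have h1 : ∀ᶠ z in 𝓝 (0 : ℂ), smoothPotential μ ε z < smoothPotential μ ε 0 + 1 :=
      hUc.continuousAt.eventually_lt_const (by linarith)
    filter_upwards [nhdsWithin_le_nhds h1] with z hz
    rw [EReal.coe_le_coe_iff]
    linarith

variable {M : ℂ → ℝ} {ν : Measure ℂ}

/-- The integrand vanishes for ‖z‖ ≥ δ and lies between 0 and -log ‖z‖ otherwise when δ ≤ 1; log ‖·‖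
is ν-integrable near 0. -/
theorem IsRieszMeasure.tendsto_integral_smoothLog_sub_log (hG : IsOpen G) (h0 : (0 : ℂ) ∈ G)
    (hν : IsRieszMeasure G M ν) (hM : ContinuousOn M G) :
    Tendsto (fun δ => ∫ z, (smoothLog δ z - log ‖z‖) ∂ν) (𝓝[>] 0) (𝓝 0) := by
  obtain ⟨s, hs0, hs⟩ := Metric.nhds_basis_closedBall.mem_iff.1 (hG.mem_nhds h0)
  have hne : ∀ᵐ z ∂ν, z ≠ 0 := by
    rw [ae_iff]
    simpa using hν.singleton_zero hG h0 hM
  have hbi : Integrable ((closedBall (0 : ℂ) s).indicator fun z => |log ‖z‖|) ν :=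
    (integrable_indicator_iff isClosed_closedBall.measurableSet).2
      (hν.integrableOn_log_norm hG h0 hM hs0 hs).abs
  suffices h : Tendsto (fun δ => ∫ z, (smoothLog δ z - log ‖z‖) ∂ν) (𝓝[>] 0)
      (𝓝 (∫ _, (0 : ℝ) ∂ν)) by simpa using h
  refine tendsto_integral_filter_of_dominated_convergence _ ?_ ?_ hbi ?_
  · filter_upwards [self_mem_nhdsWithin] with δ hδ
    exact ((contDiff_smoothLog hδ).continuous.measurable.sub measurable_norm.log).aestronglyMeasurable
  · filter_upwards [Ioo_mem_nhdsGT (lt_min hs0 one_pos)] with δ hδ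
    filter_upwards [hne] with z hz
    have hδs : δ ≤ s := hδ.2.le.trans (min_le_left _ _)
    have hδ1 : δ ≤ 1 := hδ.2.le.trans (min_le_right _ _)
    rcases le_total δ ‖z‖ with h | h
    · rw [smoothLog_eq_log hδ.1 h, sub_self, norm_zero]
      exact indicator_nonneg (fun _ _ => abs_nonneg _) _
    · rw [indicator_of_mem (by simpa using h.trans hδs), norm_eq_abs]
      have h1 := log_norm_le_smoothLog hδ.1 hz
      have h2 := smoothLog_le_log hδ.1 h
      have h3 : log δ ≤ 0 := log_nonpos hδ.1.le hδ1
      have h4 : log ‖z‖ ≤ 0 := log_nonpos (norm_nonneg z) (h.trans hδ1)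
      rw [abs_of_nonneg (by linarith), abs_of_nonpos h4]
      linarith
  · filter_upwards [hne] with z hz
    refine tendsto_const_nhds.congr' ?_
    filter_upwards [Ioo_mem_nhdsGT (norm_pos_iff.2 hz)] with δ hδ
    rw [smoothLog_eq_log hδ.1 hδ.2.le, sub_self]

/-- Fubini's theorem for the regularization of a representing measure. -/
theorem integral_mul_integral_mollifier_sub_le {K : Set ℂ} (hK : IsCompact K)
    [IsFiniteMeasure μ] (hμK : μ Kᶜ = 0) (hε : 0 < ε) (hM : ContinuousOn M (cthickening ε K))
    (hMε : ∀ w ∈ K, ∀ z, ‖z - w‖ ≤ ε → M z ≤ M w + 1) :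
    ∫ z, M z * ∫ w, mollifier ε (z - w) ∂μ ≤ ∫ w, (M w + 1) ∂μ := by
  set T := cthickening ε K
  have hT : IsCompact T := hK.cthickening
  have hae : ∀ᵐ w ∂μ, w ∈ K := by rwa [ae_iff]
  set N := T.indicator M with hN
  have hNi : Integrable N := (hM.integrableOn_compact hT).integrable_indicator hT.measurableSet
  have e1 : ∀ z, M z * ∫ w, mollifier ε (z - w) ∂μ = ∫ w, N z * mollifier ε (z - w) ∂μ := by
    intro z
    rw [integral_const_mul]
    by_cases hz : z ∈ T
    · rw [hN, indicator_of_mem hz]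
    · have : ∫ w, mollifier ε (z - w) ∂μ = 0 := by
        refine integral_eq_zero_of_ae (hae.mono fun w hw => mollifier_eq_zero hε ?_)
        by_contra h
        exact hz (mem_cthickening_of_dist_le z w ε K hw (by
          rw [dist_eq_norm]; exact (not_le.1 h).le))
      rw [this, mul_zero, mul_zero]
  obtain ⟨b, hb⟩ := (hasCompactSupport_mollifier hε).exists_bound_of_continuous
    (continuous_mollifier ε)
  have hprod : Integrable (fun p : ℂ × ℂ => N p.1 * mollifier ε (p.1 - p.2)) (volume.prod μ) :=
    (hNi.comp_fst μ).mul_bdd (c := b) ((continuous_mollifier ε).comp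
      (continuous_fst.sub continuous_snd)).aestronglyMeasurable (ae_of_all _ fun p => hb _)
  simp only [e1]
  rw [integral_integral_swap hprod]
  refine integral_mono_ae hprod.integral_prod_right
    ((integrable_of_continuousOn_of_compl_eq_zero hK hμK
      (hM.mono (self_subset_cthickening K))).add (integrable_const 1)) ?_
  filter_upwards [hae] with w hw
  have e2 : ∫ z, N z * mollifier ε (z - w) = mollify ε N w := by
    rw [mollify_eq_integral_mul_sub]
    congr 1; ext z
    rw [mollifier_eq_of_norm_eq ε (norm_sub_rev z w)]
  simp only [e2]
  refine mollify_le_of_forall_le hε hNi.locallyIntegrable fun z hz => ?_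
  have hzw : ‖z - w‖ ≤ ε := (mem_ball_iff_norm.1 hz).le
  have hzT : z ∈ T := mem_cthickening_of_dist_le z w ε K hw (by rwa [dist_eq_norm])
  rw [hN, indicator_of_mem hzT]
  exact hMε w hw z hzw

/-- Green's formula turns the ν-integral into the integral of M against the mollified μ, minus M(0),
and mollifying costs at most 1. The pole is not admissible in a test function, so log ‖·‖ is first
replaced by `smoothLog δ`, and then δ → 0. -/
theorem IsRieszMeasure.integral_smoothPotential_sub_log_le (hG : IsOpen G)
    (hν : IsRieszMeasure G M ν) (hM : ContinuousOn M G)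
    (hμ : IsRepresentingMeasure G μ) (hμK : μ (planeExhaustion G m)ᶜ = 0)
    (h0 : (0 : ℂ) ∈ planeExhaustion G m) (hε : 0 < ε)
    (hεG : cthickening ε (planeExhaustion G m) ⊆ G)
    (hMε : ∀ w ∈ planeExhaustion G m, ∀ z, ‖z - w‖ ≤ ε → M z ≤ M w + 1) :
    Integrable (fun z => smoothPotential μ ε z - log ‖z‖) ν ∧
      ∫ z, (smoothPotential μ ε z - log ‖z‖) ∂ν ≤ ∫ z, M z ∂μ + 1 - M 0 := by
  have := hμ.finite
  have hK := isCompact_planeExhaustion G m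
  have h0G : (0 : ℂ) ∈ G := planeExhaustion_subset G m h0
  set T := cthickening ε (planeExhaustion G m)
  have hT : IsCompact T := hK.cthickening
  have hUs := contDiff_smoothPotential hK hμK hε
  have hballT : closedBall (0 : ℂ) ε ⊆ T := closedBall_subset_cthickening h0 ε
  have h_int : Integrable (fun z => smoothPotential μ ε z - log ‖z‖) ν := by
    refine (integrableOn_iff_integrable_of_support_subset (s := T) fun z hz => ?_).1
      ((hν.integrableOn_of_continuousOn hT hεG hUs.continuous.continuousOn).sub
        (hν.integrableOn_log_norm_of_isCompact hG h0G hM hT hεG))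
    by_contra h
    exact hz (by
      change smoothPotential μ ε z - log ‖z‖ = 0
      rw [smoothPotential_eq_log hG hμ hμK h0 hε h, sub_self])
  refine ⟨h_int, ?_⟩
  set I := ∫ z, M z * ∫ w, mollifier ε (z - w) ∂μ
  have hI : I ≤ ∫ z, M z ∂μ + 1 := by
    refine (integral_mul_integral_mollifier_sub_le hK hμK hε (hM.mono hεG) hMε).trans ?_
    rw [integral_add (hμ.integrable hM) (integrable_const 1), hμ.integral_const]
  have hδ : ∀ᶠ δ in 𝓝[>] (0 : ℝ), (I - ∫ z, mollifier δ z * M z) +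
      ∫ z, (smoothLog δ z - log ‖z‖) ∂ν = ∫ z, (smoothPotential μ ε z - log ‖z‖) ∂ν := by
    filter_upwards [Ioo_mem_nhdsGT hε] with δ hδ
    set φ : ℂ → ℝ := fun z => smoothPotential μ ε z - smoothLog δ z with hφ
    have hφs : ContDiff ℝ ∞ φ := hUs.sub (contDiff_smoothLog hδ.1)
    have hφz : ∀ z ∉ T, φ z = 0 := fun z hz => by
      have h1 : δ ≤ ‖z‖ := by
        by_contra h
        exact hz (hballT (by simpa using (not_le.1 h).le.trans hδ.2.le))
      simp only [hφ]
      rw [smoothPotential_eq_log hG hμ hμK h0 hε hz, smoothLog_eq_log hδ.1 h1, sub_self]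
    have hφc : HasCompactSupport φ := HasCompactSupport.intro hT hφz
    have hφT : tsupport φ ⊆ T :=
      closure_minimal (fun z hz => by by_contra h; exact hz (hφz z h)) hT.isClosed
    have hφi : Integrable φ ν := by
      refine (integrableOn_iff_integrable_of_support_subset (s := T) fun z hz => ?_).1
        (hν.integrableOn_of_continuousOn hT hεG hφs.continuous.continuousOn)
      by_contra h
      exact hz (hφz z h)
    have hΔ : ∀ z, Laplacian.laplacian φ z =
        2 * π * ∫ w, mollifier ε (z - w) ∂μ - 2 * π * mollifier δ z := fun z => by
      have := (hUs.two_of_infty.contDiffAt (x := z)).laplacian_sub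
        ((contDiff_smoothLog hδ.1).two_of_infty.contDiffAt (x := z))
      rw [laplacian_smoothPotential hK hμK hε, laplacian_smoothLog hδ.1] at this
      exact this
    have hρi := integrable_mollifier_mul_of_continuousOn hδ.1 (hM.mono
      ((closedBall_subset_closedBall hδ.2.le).trans (hballT.trans hεG)))
    have hMi : Integrable fun z => M z * ∫ w, mollifier ε (z - w) ∂μ := by
      refine (((integrable_mul_laplacian hM hφs.two_of_infty hφc
        (hφT.trans hεG)).const_mul (2 * π)⁻¹).add hρi).congr (ae_of_all _ fun z => ?_)
      simp only [Pi.add_apply, hΔ]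
      field_simp
      ring
    have e1 : ∫ z, φ z ∂ν = I - ∫ z, mollifier δ z * M z := by
      rw [hν.integral_eq φ hφs hφc (hφT.trans hεG), ← integral_sub hMi hρi, ← integral_const_mul]
      congr 1; ext z
      rw [hΔ]
      field_simp
    have e2 : ∫ z, (smoothLog δ z - log ‖z‖) ∂ν =
        ∫ z, ((smoothPotential μ ε z - log ‖z‖) - φ z) ∂ν := by
      congr 1; ext z; simp only [hφ]; ring
    rw [e2, integral_sub h_int hφi, e1]
    ring
  have hlim := ((tendsto_const_nhds (x := I)).sub
    (tendsto_integral_mollifier_mul hG h0G hM)).add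
    (hν.tendsto_integral_smoothLog_sub_log hG h0G hM)
  have := tendsto_nhds_unique (hlim.congr' hδ) tendsto_const_nhds
  linarith

end RepresentingFunctionOfMeasure

/-! ### (2) implies (1) -/

section SufficientCondition

open Metric Real InnerProductSpace

variable {G : Set ℂ} {M : ℂ → ℝ} {ν : Measure ℂ} {ι : Type*} {Λ : ι → ℂ}

/-- The bound for representing functions gives the bound for representing measures on the sets of
the standard exhaustion. -/
theorem eintegral_prod_sub_le (hG : IsOpen G) (hM : ContinuousOn M G)
    (hν : IsRieszMeasure G M ν)
    (hΛ : ∀ K : Set ℂ, IsCompact K → K ⊆ G → {n | Λ n ∈ K}.Finite) {C : ℝ}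
    (hC : ∀ V : ℂ → EReal, IsRepresentingFunction G V →
      ∑ᶠ n, V (Λ n) ≤ eintegral (ν.restrict (G \ {0})) V + (C : EReal))
    {m : ℕ} (h0 : (0 : ℂ) ∈ planeExhaustion G m) {s : Finset ι}
    (hs : ∀ n, n ∈ s ↔ Λ n ∈ planeExhaustion G m) {μ : Measure ℂ}
    (hμ : IsRepresentingMeasure G μ) (hμK : μ (planeExhaustion G m)ᶜ = 0) :
    eintegral μ (fun w => elogNorm (∏ n ∈ s, (w - Λ n))) ≤
      ((∫ z, M z ∂μ + (1 - M 0 + C + ∑ n ∈ s, log ‖Λ n‖) : ℝ) : EReal) := by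
  have := hμ.finite
  have hK := isCompact_planeExhaustion G m
  have h0G : (0 : ℂ) ∈ G := planeExhaustion_subset G m h0
  obtain ⟨ε₀, hε₀, hε₀G⟩ := exists_cthickening_subset hG hK (planeExhaustion_subset G m)
  have hT₀ : IsCompact (cthickening ε₀ (planeExhaustion G m)) := hK.cthickening
  obtain ⟨ε₁, hε₁, hε₁M⟩ := Metric.uniformContinuousOn_iff.1
    (hT₀.uniformContinuousOn_of_continuous (hM.mono hε₀G)) 1 one_pos
  set ε := min ε₀ (ε₁ / 2)
  have hε : 0 < ε := lt_min hε₀ (half_pos hε₁)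
  have hεG : cthickening ε (planeExhaustion G m) ⊆ G :=
    (cthickening_mono (min_le_left _ _) _).trans hε₀G
  have hMε : ∀ w ∈ planeExhaustion G m, ∀ z, ‖z - w‖ ≤ ε → M z ≤ M w + 1 := fun w hw z hz => by
    have h1 : dist (M z) (M w) < 1 := hε₁M z
      (mem_cthickening_of_dist_le z w ε₀ _ hw (by
        rw [dist_eq_norm]; exact hz.trans (min_le_left _ _))) w (self_subset_cthickening _ hw) (by
        rw [dist_eq_norm]; linarith [min_le_right ε₀ (ε₁ / 2)])
    rw [Real.dist_eq] at h1
    linarith [le_abs_self (M z - M w)]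
  obtain ⟨hvi, hvle⟩ := hν.integral_smoothPotential_sub_log_le hG hM hμ hμK h0 hε hεG hMε
  have h1 := hC _ (isRepresentingFunction_smoothPotential_sub_log hG hμ hμK h0 hε hεG)
  rw [hν.restrict_diff_singleton_zero hG h0G hM, eintegral_coe hvi, ← EReal.coe_add] at h1
  have hTfin := hΛ _ (hK.cthickening (r := ε)) hεG
  have hfs : ∑ᶠ n, ((smoothPotential μ ε (Λ n) - log ‖Λ n‖ : ℝ) : EReal) =
      ∑ n ∈ hTfin.toFinset, ((smoothPotential μ ε (Λ n) - log ‖Λ n‖ : ℝ) : EReal) := by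
    refine finsum_eq_sum_of_support_subset _ fun n hn => ?_
    by_contra h
    refine hn ?_
    simp only
    rw [smoothPotential_eq_log hG hμ hμK h0 hε (by simpa using h), sub_self, EReal.coe_zero]
  rw [hfs, ← EReal.coe_finsetSum, EReal.coe_le_coe_iff] at h1
  -- The additional points lie off the exhausting set, where the potential is at least log ‖·‖, so
  -- their terms are nonnegative.
  have h2 : ∑ n ∈ s, (smoothPotential μ ε (Λ n) - log ‖Λ n‖) ≤
      ∑ n ∈ hTfin.toFinset, (smoothPotential μ ε (Λ n) - log ‖Λ n‖) := by
    refine Finset.sum_le_sum_of_subset_of_nonneg (fun n hn => ?_) fun n _ hn => ?_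
    · simpa using self_subset_cthickening _ ((hs n).1 hn)
    · have := log_le_smoothPotential hG hμ hμK h0 hε (fun h => hn ((hs n).2 h))
      linarith
  rw [Finset.sum_sub_distrib] at h2
  have hsi : ∀ n ∈ s, Integrable (fun w => smoothLog ε (Λ n - w)) μ := fun n _ =>
    integrable_comp_sub hK hμK (contDiff_smoothLog hε).continuous (Λ n)
  have h3 : eintegral μ (fun w => elogNorm (∏ n ∈ s, (w - Λ n))) ≤
      eintegral μ (fun w => ((∑ n ∈ s, smoothLog ε (Λ n - w) : ℝ) : EReal)) := by
    refine eintegral_mono_ae (ae_of_all _ fun w => ?_)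
    rw [elogNorm_le_coe, norm_prod, exp_sum]
    refine Finset.prod_le_prod (fun n _ => norm_nonneg _) fun n _ => ?_
    rw [norm_sub_rev]
    rcases eq_or_ne (Λ n - w) 0 with h | h
    · rw [h, norm_zero]; exact (exp_pos _).le
    · rw [← log_le_iff_le_exp (norm_pos_iff.2 h)]
      exact log_norm_le_smoothLog hε h
  refine h3.trans ?_
  rw [eintegral_coe (integrable_finsetSum _ hsi), integral_finsetSum _ hsi, EReal.coe_le_coe_iff]
  -- Reciprocity: integrating the smoothed log-modulus of the polynomial against μ evaluates the
  -- potential of μ at the zeros.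
  change ∑ n ∈ s, smoothPotential μ ε (Λ n) ≤ _
  linarith

/-- On each set of the exhaustion, duality is applied to the polynomial with the zeros Λ n in that
set instead of a function with zero set Λ. The functions F m obey |F m| ≤ exp M and have the right
zeros there, and their limit keeps both properties by Hurwitz's theorem. -/
theorem isZeroSetFor_of_exists_finsum_le (hG : IsOpen G) (hGs : IsSimplyConnected G)
    (h0 : (0 : ℂ) ∈ G) (hM : ContinuousOn M G) (hν : IsRieszMeasure G M ν)
    (hΛ : ∀ K : Set ℂ, IsCompact K → K ⊆ G → {n | Λ n ∈ K}.Finite) (hΛ0 : ∀ n, Λ n ≠ 0)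
    (h : ∃ C : ℝ, ∀ V : ℂ → EReal, IsRepresentingFunction G V →
      ∑ᶠ n, V (Λ n) ≤ eintegral (ν.restrict (G \ {0})) V + (C : EReal)) :
    IsZeroSetFor G M Λ := by
  obtain ⟨C, hC⟩ := h
  have hex : ∀ m : ℕ, ∃ F : ℂ → ℂ, DifferentiableOn ℂ F G ∧ ((0 : ℂ) ∈ planeExhaustion G m →
      ‖F 0‖ = exp (-(2 - M 0 + C)) ∧ ∀ z ∈ planeExhaustion G m,
        ‖F z‖ ≤ exp (M z) ∧ analyticOrderAt F z = {n | Λ n = z}.encard) := by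
    intro m
    by_cases h0m : (0 : ℂ) ∈ planeExhaustion G m
    swap
    · exact ⟨0, differentiableOn_const 0, fun h => absurd h h0m⟩
    have hK := isCompact_planeExhaustion G m
    have hKG := planeExhaustion_subset G m
    set s := (hΛ _ hK hKG).toFinset with hsdef
    have hs : ∀ n, n ∈ s ↔ Λ n ∈ planeExhaustion G m := fun n => by simp [hsdef]
    have hPd : Differentiable ℂ fun w : ℂ => ∏ n ∈ s, (w - Λ n) := by fun_prop
    obtain ⟨h, hh, hh0, hle⟩ := exists_harmonicOnNhd_of_forall_eintegral_le hK hKG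
      hPd.continuous.continuousOn (hM.mono hKG) fun μ hμ hμK =>
        eintegral_prod_sub_le hG hM hν hΛ hC h0m hs hμ hμK
    obtain ⟨H, hH, hHre⟩ := exists_differentiableOn_re_eq hG hGs hh
    have hE : DifferentiableOn ℂ (fun z => Complex.exp (H z)) G := hH.cexp
    refine ⟨fun z => Complex.exp (H z) * ∏ n ∈ s, (z - Λ n), hE.mul hPd.differentiableOn,
      fun _ => ⟨?_, fun z hz => ⟨?_, ?_⟩⟩⟩
    · rw [norm_mul, Complex.norm_exp, hHre 0 h0, hh0, norm_prod]
      -- This factor cancels the sum in the duality constant, so ‖F 0‖ does not depend on m and the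
      -- limit does not vanish at 0.
      have : ∏ n ∈ s, ‖0 - Λ n‖ = exp (∑ n ∈ s, log ‖Λ n‖) := by
        rw [exp_sum]
        refine Finset.prod_congr rfl fun n _ => ?_
        rw [zero_sub, norm_neg, exp_log (norm_pos_iff.2 (hΛ0 n))]
      rw [this, ← exp_add]
      congr 1
      ring
    · rw [norm_mul, Complex.norm_exp, hHre z (hKG hz), mul_comm]
      exact (hle z hz).le
    · rw [analyticOrderAt_eq_add_of_eq_mul hG hPd.differentiableOn hE (fun _ _ => rfl) (hKG hz),
        (hE.analyticAt (hG.mem_nhds (hKG hz))).analyticOrderAt_eq_zero.2 (Complex.exp_ne_zero _),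
        zero_add, analyticOrderAt_prod_sub]
      congr 1
      ext n
      simp only [mem_ofPred_eq, hs, and_iff_right_iff_imp]
      rintro rfl
      exact hz
  choose F hFd hF using hex
  have h0ev : ∀ᶠ m in atTop, (0 : ℂ) ∈ planeExhaustion G m :=
    (eventually_subset_planeExhaustion hG (isCompact_singleton (x := (0 : ℂ)))
      (by simpa using h0)).mono fun m hm => hm rfl
  have hat : (hyperfilter ℕ : Filter ℕ) ≤ atTop := Nat.hyperfilter_le_atTop
  obtain ⟨f, hf⟩ := exists_tendstoLocallyUniformlyOn_hyperfilter hG hFd fun z hz => by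
    obtain ⟨r, hr, hrG⟩ := Metric.nhds_basis_closedBall.mem_iff.1 (hG.mem_nhds hz)
    have hMc : ContinuousOn (fun w => exp (M w)) (closedBall z r) :=
      continuous_exp.comp_continuousOn (hM.mono hrG)
    obtain ⟨B, hB⟩ := (isCompact_closedBall z r).exists_bound_of_continuousOn hMc
    refine ⟨r, hr, B, ?_⟩
    filter_upwards [h0ev, eventually_subset_planeExhaustion hG (isCompact_closedBall z r) hrG]
      with m hm0 hm w hw
    have hwr := ball_subset_closedBall hw
    exact (((hF m hm0).2 w (hm hwr)).1).trans ((le_abs_self _).trans (hB w hwr))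
  have hf0 : f 0 ≠ 0 := by
    have h1 : Tendsto (fun m => ‖F m 0‖) (hyperfilter ℕ : Filter ℕ) (𝓝 ‖f 0‖) :=
      (hf.tendsto_at h0).norm
    have h2 : Tendsto (fun m => ‖F m 0‖) (hyperfilter ℕ : Filter ℕ)
        (𝓝 (exp (-(2 - M 0 + C)))) := by
      refine tendsto_const_nhds.congr' (hat ?_)
      exact h0ev.mono fun m hm => ((hF m hm).1).symm
    rw [← norm_ne_zero_iff, tendsto_nhds_unique h1 h2]
    positivity
  have hfz : HasZeroSet G Λ f := by
    refine hasZeroSet_of_tendstoLocallyUniformlyOn hG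
      hGs.isPathConnected.isConnected.isPreconnected hΛ hFd hf (fun K hK hKG => hat ?_)
      ⟨0, h0, hf0⟩
    filter_upwards [h0ev, eventually_subset_planeExhaustion hG hK hKG] with m hm0 hm z hz
    exact ((hF m hm0).2 z (hm hz)).2
  refine ⟨f, ⟨hfz.1, 0, fun z hz => ?_⟩, hfz⟩
  rw [elogNorm_le_coe, add_zero]
  refine le_of_tendsto ((hf.tendsto_at hz).norm) (hat ?_)
  filter_upwards [h0ev, eventually_subset_planeExhaustion hG (isCompact_singleton (x := z))
    (by simpa using hz)] with m hm0 hm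
  exact ((hF m hm0).2 z (hm rfl)).1

end SufficientCondition

theorem theorem1p2 {G : Set ℂ} (hGo : IsOpen G) (hGs : IsSimplyConnected G) (hG0 : (0 : ℂ) ∈ G)
    {M : ℂ → ℝ} (hMc : ContinuousOn M G) (hMs : SubharmonicOn (fun z => (M z : EReal)) G)
    {ι : Type*} (Λ : ι → ℂ) (hΛG : ∀ n, Λ n ∈ G)
    (hΛ : ∀ K : Set ℂ, IsCompact K → K ⊆ G → {n | Λ n ∈ K}.Finite) :
    -- (1) ↔ (3)
    (∀ g : ℂ → ℂ, HasZeroSet G Λ g →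
      (IsZeroSetFor G M Λ ↔
        ∃ C : ℝ, ∀ μ : Measure ℂ, IsRepresentingMeasure G μ →
          eintegral μ (fun z => elogNorm (g z)) ≤ ((∫ z, M z ∂μ + C : ℝ) : EReal))) ∧
    -- (1) ↔ (2)
    ((∀ n, Λ n ≠ 0) →
      (IsZeroSetFor G M Λ ↔
        ∃ C : ℝ, ∀ V : ℂ → EReal, IsRepresentingFunction G V →
          ∑ᶠ n, V (Λ n) ≤ eintegral ((rieszMeasure G M).restrict (G \ {0})) V + (C : EReal))) := by
  refine ⟨fun g hg => ⟨fun h => h.exists_eintegral_le hGo hMc hΛ hg,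
    fun h => isZeroSetFor_of_exists_eintegral_le hGo hGs hG0 hMc hΛ hg h⟩, fun hΛ0 => ⟨?_, ?_⟩⟩
  · exact fun h => h.exists_finsum_le hGo hG0 hMc (isRieszMeasure_rieszMeasure hGo hMc hMs) hΛG hΛ hΛ0
  · exact fun h => isZeroSetFor_of_exists_finsum_le hGo hGs hG0 hMc
      (isRieszMeasure_rieszMeasure hGo hMc hMs) hΛ hΛ0 h
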